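/- Let $N\ge 2$, $T\ge 1$, let $(\mathcal X_t,d_t)$, $t=1,\dots,T$, be separable complete metric spaces, and $\mathcal X=\prod_{t=1}^T\mathcal X_t$ with $d(x,y)=\sum_t d_t(x_t,y_t)$. **Setting.** A filtered process $\mathbb X=(\Omega,\mathcal F,(\mathcal F_t)_{t=1}^T,\mathbb P,X)$ consists of a product $\Omega=\Omega_1\times\dots\times\Omega_T$ of Polish spaces with its Borel $\sigma$-algebra $\mathcal F$, the canonical filtration $\mathcal F_t=\sigma(\omega_{1:t})$ ($\mathcal F_0$ trivial), a probability measure $\mathbb P$ on $\Omega$, and a continuous adapted process $X:\Omega\to\mathcal X$, such that $\mathbb P$ has a disintegration $\mathbb P(\mathrm d\omega)=\mathbb P_1(\mathrm d\omega_1)\otimes\mathbb P_{2,\omega_1}(\mathrm d\omega_2)\otimes\cdots\otimes\mathbb P_{T,\omega_{1:T-1}}(\mathrm d\omega_T)$ whose kernels $\omega_{1:t-1}\mapsto\mathbb P_{t,\omega_{1:t-1}}$ are weakly continuous. For filtered processes $\mathbb X^1,\dots,\mathbb X^N$ put $\overline\Omega=\prod_i\Omega^i$, $\overline{\mathcal F}_v=\bigotimes_i\mathcal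 F^i_{v_i}$ for $v\in\{0,\dots,T\}^N$, $\overline{\mathcal F}_t=\overline{\mathcal F}_{(t,\dots,t)}$, $\overline\omega_t=(\omega^1_t,\dots,\omega^N_t)$, and let $e_i$ be the $i$-th unit vector. $\mathrm{cpl}(\mu^1,\dots,\mu^N)$ denotes the set of probability measures with marginals $\mu^1,\dots,\mu^N$. $\mathrm{cpl}_{\rm mc}(\mathbb X^1,\dots,\mathbb X^N)$ is the set of $\pi\in\mathrm{cpl}(\mathbb P^1,\dots,\mathbb P^N)$ such that, under $\pi$, $\overline{\mathcal F}_{Te_i}$ is conditionally independent of $\overline{\mathcal F}_t$ given $\overline{\mathcal F}_{te_i}$ for all $t\in\{1,\dots,T\}$ and all $i$. For $N=2$, a coupling $\pi$ is bicausal if, for all $t\in\{1,\dots,T\}$, under $\pi$, $\overline{\mathcal F}_{(T,0)}$ is conditionally independent of $\overline{\mathcal F}_{(0,t)}$ given $\overline{\mathcal F}_{(t,0)}$, and $\overline{\mathcal F}_{(0,T)}$ is conditionally independent of $\overline{\mathcal F}_{(t,0)}$ given $\overline{\mathcal F}_{(0,t)}$. Let $\mathcal{AW}(\mathbb X,\mathbb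 Y)=\inf_\pi\mathbb E_\pi[d(X,Y)\wedge 1]$, the infimum being over the bicausal couplings of $\mathbb X$ and $\mathbb Y$. $\mathrm{FP}$ is the space of filtered processes modulo $\mathcal{AW}=0$, with the topology generated by the metric $\mathcal{AW}$ (the adapted weak topology). **Theorem.** Let $c:\mathcal X^N\to\mathbb R$ be lower-semicontinuous and bounded from below, and $$V_c^{\rm mc}(\mathbb X^1,\dots,\mathbb X^N)=\inf_{\pi\in\mathrm{cpl}_{\rm mc}(\mathbb X^1,\dots,\mathbb X^N)}\mathbb E_\pi[c(X^1,\dots,X^N)]\in\mathbb R\cup\{\infty\}.$$ For filtered processes $\mathbb X^1,\dots,\mathbb X^N$ and any choice of continuous versions of the kernels $\mathbb P^i_{t,\cdot}$, set $V(T,\overline\omega)=c(X^1(\omega^1),\dots,X^N(\omega^N))$ and, backwards for $t=T-1,\dots,0$ (for $t=0$ there is no $\overline\omega_{1:t}$, and the kernels are $\mathbb P^i_1$), $$V(t,\overline\omega_{1:t})=\inf\Big\{\int V(t+1,\overline\omega_{1:t},\overline\omega_{t+1})\,\rho(\mathrm d\overline\omega_{t+1})\ \Big|\ \rho\in\mathrm{cpl}\big(\mathbb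 P^1_{t+1,\omega^1_{1:t}},\dots,\mathbb P^N_{t+1,\omega^N_{1:t}}\big)\Big\}.$$ 1. (Dynamic programming.) $V_c^{\rm mc}(\mathbb X^1,\dots,\mathbb X^N)=V(0)$. 2. (Characterization of optimizers.) Let $\pi^\star\in\mathrm{cpl}_{\rm mc}(\mathbb X^1,\dots,\mathbb X^N)$, and consider the condition: there is a version of the disintegration $\pi^\star(\mathrm d\overline\omega)=K_1^\star(\mathrm d\overline\omega_1)\otimes K^\star_2(\overline\omega_1;\mathrm d\overline\omega_2)\otimes\cdots\otimes K_T^\star(\overline\omega_{1:T-1};\mathrm d\overline\omega_T)$ such that, for every $t\in\{1,\dots,T\}$ and every $\overline\omega_{1:t-1}$, $$K_t^\star(\overline\omega_{1:t-1};\cdot)\in\arg\min\Big\{\int V(t,\overline\omega_{1:t-1},\overline\omega_{t})\,\rho(\mathrm d\overline\omega_{t})\ \Big|\ \rho\in\mathrm{cpl}\big(\mathbb P^1_{t,\omega^1_{1:t-1}},\dots,\mathbb P^N_{t,\omega^N_{1:t-1}}\big)\Big\}.$$ This condition implies that $\pi^\star$ is optimal for $V_c^{\rm mc}(\mathbb X^1,\dots,\mathbb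 X^N)$; if $V_c^{\rm mc}(\mathbb X^1,\dots,\mathbb X^N)<\infty$, then conversely every optimal $\pi^\star$ satisfies it. 3. (Existence.) There is $\pi^\star\in\mathrm{cpl}_{\rm mc}(\mathbb X^1,\dots,\mathbb X^N)$ with $\mathbb E_{\pi^\star}[c(X^1,\dots,X^N)]=V_c^{\rm mc}(\mathbb X^1,\dots,\mathbb X^N)$. 4. (Lower semicontinuity.) $V_c^{\rm mc}$ is well defined on $\mathrm{FP}^N$, and $V_c^{\rm mc}:\mathrm{FP}^N\to\mathbb R\cup\{\infty\}$ is lower-semicontinuous for the product of the adapted weak topologies. -/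

import Mathlib

open MeasureTheory ProbabilityTheory Topology
open scoped ENNReal

universe u v w

namespace MultiCausal

noncomputable section

/-! ### Extended integrals and couplings -/

/-- The integral `∫ f dμ ∈ [-∞, ∞]` of an extended real function, as the difference of the integrals
of its positive and negative parts. (It is only used for functions that are bounded from below and
finite measures, so that the second term is finite.) -/
def extIntegral {α : Type*} [MeasurableSpace α] (μ : Measure α) (f : α → EReal) : EReal :=
  ((∫⁻ x, (f x).toENNReal ∂μ : ℝ≥0∞) : EReal) - ((∫⁻ x, (-f x).toENNReal ∂μ : ℝ≥0∞) : EReal)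

/-- Probability measures on the product with the prescribed marginals. -/
def couplings {ι : Type*} {E : ι → Type*} [∀ i, MeasurableSpace (E i)]
    (μ : ∀ i, Measure (E i)) : Set (Measure (∀ i, E i)) :=
  {π | IsProbabilityMeasure π ∧ ∀ i, π.map (fun x => x i) = μ i}

/-! ### Paths, prefixes, canonical filtration, disintegration

Times `1, …, T` are indexed by `Fin T` (so `t : Fin T` stands for the time `t + 1`), while
`t : Fin (T + 1)` stands for the time `t ∈ {0, …, T}`. -/

variable {T : ℕ}

/-- The space `Ω_{1:t}`; it is a one-point space for `t = 0`. -/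
abbrev Prefix (Ω : Fin T → Type u) (t : Fin (T + 1)) : Type u :=
  ∀ s : Fin (t : ℕ), Ω (s.castLE t.is_le)

/-- The projection `ω ↦ ω_{1:t}`. -/
def toPrefix (Ω : Fin T → Type u) (t : Fin (T + 1)) (ω : ∀ s, Ω s) : Prefix Ω t :=
  fun s => ω (s.castLE t.is_le)

/-- `(ω_{1:t}, ω_{t+1}) ↦ ω_{1:t+1}`. -/
def Prefix.append {Ω : Fin T → Type u} {t : Fin T} (p : Prefix Ω t.castSucc) (y : Ω t) :
    Prefix Ω t.succ :=
  Fin.snoc (α := fun s : Fin ((t : ℕ) + 1) => Ω (s.castLE t.succ.is_le)) p y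

/-- A full prefix `ω_{1:T}` is a path. -/
def Prefix.toPath {Ω : Fin T → Type u} (p : Prefix Ω (Fin.last T)) : ∀ s, Ω s :=
  fun s => p s

/-- The canonical filtration `𝓕_t` on `Ω_{1:T}`, `t ∈ {0, …, T}`: the sets that depend measurably
on `ω_{1:t}`. -/
abbrev canonicalFiltration (Ω : Fin T → Type u) [∀ t, MeasurableSpace (Ω t)] (t : Fin (T + 1)) :
    MeasurableSpace (∀ s, Ω s) :=
  MeasurableSpace.comap (toPrefix Ω t) inferInstance

/-- `κ` is a version of the disintegration `P(dω) = κ_1(dω_1) ⊗ κ_2(ω_1; dω_2) ⊗ ⋯ ⊗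
κ_T(ω_{1:T-1}; dω_T)`: the law of `ω_{1:t}` is the law of `ω_{1:t-1}` followed by `κ_t`. -/
structure IsDisintegration {Ω : Fin T → Type u} [∀ t, MeasurableSpace (Ω t)]
    (P : Measure (∀ t, Ω t)) (κ : ∀ t : Fin T, Kernel (Prefix Ω t.castSucc) (Ω t)) : Prop where
  markov : ∀ t, IsMarkovKernel (κ t)
  law_eq : ∀ t : Fin T, P.map (fun ω => (toPrefix Ω t.castSucc ω, ω t)) =
    (P.map (toPrefix Ω t.castSucc)) ⊗ₘ (κ t)

/-- A version of the disintegration whose kernels are continuous for the weak topology. -/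
structure IsContinuousDisintegration {Ω : Fin T → Type u} [∀ t, TopologicalSpace (Ω t)]
    [∀ t, MeasurableSpace (Ω t)] [∀ t, OpensMeasurableSpace (Ω t)]
    (P : Measure (∀ t, Ω t)) (κ : ∀ t : Fin T, Kernel (Prefix Ω t.castSucc) (Ω t)) : Prop
    extends IsDisintegration P κ where
  continuous : ∀ t : Fin T, @Continuous (Prefix Ω t.castSucc) (ProbabilityMeasure (Ω t)) _ _
    fun p => ⟨κ t p, (markov t).isProbabilityMeasure p⟩

/-! ### Filtered processes -/

/-- A filtered process with values in `∏ₜ 𝒳 t`: the sample space is a product of Polish spaces with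
its Borel σ-algebra and canonical filtration, the process is adapted, and the process and
(a version of) the successive disintegration kernels are continuous. -/
structure FilteredProcess (𝒳 : Fin T → Type v) [∀ t, MetricSpace (𝒳 t)]
    [∀ t, MeasurableSpace (𝒳 t)] where
  Ω : Fin T → Type u
  [top : ∀ t, TopologicalSpace (Ω t)]
  [polish : ∀ t, PolishSpace (Ω t)]
  [meas : ∀ t, MeasurableSpace (Ω t)]
  [borel : ∀ t, BorelSpace (Ω t)]
  P : Measure (∀ t, Ω t)
  [prob : IsProbabilityMeasure P]
  X : (∀ t, Ω t) → ∀ t, 𝒳 t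
  adapted : ∀ t : Fin T, Measurable[canonicalFiltration Ω t.succ] fun ω => X ω t
  continuous_X : Continuous X
  exists_kernels : ∃ κ : ∀ t : Fin T, Kernel (Prefix Ω t.castSucc) (Ω t),
    IsContinuousDisintegration P κ

attribute [instance] FilteredProcess.top FilteredProcess.polish FilteredProcess.meas
  FilteredProcess.borel FilteredProcess.prob

variable {𝒳 : Fin T → Type v} [∀ t, MetricSpace (𝒳 t)] [∀ t, MeasurableSpace (𝒳 t)]

/-- The σ-algebra `𝓕_t` of a filtered process, `t ∈ {0, …, T}`. -/
abbrev FilteredProcess.filtration (𝕏 : FilteredProcess.{u} 𝒳) (t : Fin (T + 1)) :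
    MeasurableSpace (∀ s, 𝕏.Ω s) :=
  canonicalFiltration 𝕏.Ω t

theorem canonicalFiltration_le (Ω : Fin T → Type u) [∀ t, MeasurableSpace (Ω t)]
    (t : Fin (T + 1)) : canonicalFiltration Ω t ≤ MeasurableSpace.pi :=
  Measurable.comap_le (measurable_pi_lambda _ fun _ => measurable_pi_apply _)

/-! ### Multicausal couplings -/

section Multi

variable {N : ℕ}

/-- The product sample space `Ω̄ = ∏ᵢ Ωⁱ`. -/
abbrev ProdSpace (𝕏 : Fin N → FilteredProcess.{u} 𝒳) : Type u :=
  ∀ i, ∀ t, (𝕏 i).Ω t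

/-- `Ω̄_t = ∏ᵢ Ωⁱ_t`. -/
abbrev ProdSpaceAt (𝕏 : Fin N → FilteredProcess.{u} 𝒳) (t : Fin T) : Type u :=
  ∀ i, (𝕏 i).Ω t

/-- `𝓕̄_v = ⨂ᵢ 𝓕ⁱ_{vᵢ}` for `v ∈ {0, …, T}ᴺ`. -/
abbrev prodFiltration (𝕏 : Fin N → FilteredProcess.{u} 𝒳) (v : Fin N → Fin (T + 1)) :
    MeasurableSpace (ProdSpace 𝕏) :=
  ⨆ i, MeasurableSpace.comap (fun ω => ω i) ((𝕏 i).filtration (v i))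

theorem prodFiltration_le (𝕏 : Fin N → FilteredProcess.{u} 𝒳) (v : Fin N → Fin (T + 1)) :
    prodFiltration 𝕏 v ≤ MeasurableSpace.pi :=
  iSup_mono fun i => MeasurableSpace.comap_mono (canonicalFiltration_le (𝕏 i).Ω (v i))

/-- The set of multicausal couplings: for all `t ∈ {1, …, T}` and `i`, the σ-algebras `𝓕̄_{T eᵢ}`
and `𝓕̄_t` are conditionally independent given `𝓕̄_{t eᵢ}`. -/
def multicausalCouplings (𝕏 : Fin N → FilteredProcess.{u} 𝒳) :
    Set (ProbabilityMeasure (ProdSpace 𝕏)) :=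
  {π | (π : Measure (ProdSpace 𝕏)) ∈ couplings (fun i => (𝕏 i).P) ∧
    ∀ (t : Fin T) (i : Fin N),
      CondIndep (prodFiltration 𝕏 (Pi.single i t.succ))
        (prodFiltration 𝕏 (Pi.single i (Fin.last T))) (prodFiltration 𝕏 (fun _ => t.succ))
        (prodFiltration_le 𝕏 _) (π : Measure (ProdSpace 𝕏))}

/-- The expected cost `𝔼_π[c(X¹, …, Xᴺ)]`. -/
def expectedCost (c : (Fin N → ∀ t, 𝒳 t) → ℝ) (𝕏 : Fin N → FilteredProcess.{u} 𝒳)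
    (π : ProbabilityMeasure (ProdSpace 𝕏)) : EReal :=
  extIntegral (π : Measure (ProdSpace 𝕏)) fun ω => (c (fun i => (𝕏 i).X (ω i)) : EReal)

/-- The value of the multicausal transport problem. -/
def multicausalValue (c : (Fin N → ∀ t, 𝒳 t) → ℝ) (𝕏 : Fin N → FilteredProcess.{u} 𝒳) : EReal :=
  ⨅ π ∈ multicausalCouplings 𝕏, expectedCost c 𝕏 π

/-! ### The value process -/

/-- The couplings of the conditional one-step laws given `ω̄_{1:t}`. -/
def stepCouplings (𝕏 : Fin N → FilteredProcess.{u} 𝒳)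
    (κ : ∀ i, ∀ t : Fin T, Kernel (Prefix (𝕏 i).Ω t.castSucc) ((𝕏 i).Ω t))
    (t : Fin T) (p : Prefix (ProdSpaceAt 𝕏) t.castSucc) : Set (Measure (ProdSpaceAt 𝕏 t)) :=
  couplings fun i => κ i t fun s => p s i

/-- The one-step objective `ρ ↦ ∫ W(ω̄_{1:t}, ω̄_{t+1}) ρ(dω̄_{t+1})`. -/
def stepCost (𝕏 : Fin N → FilteredProcess.{u} 𝒳) (t : Fin T)
    (W : Prefix (ProdSpaceAt 𝕏) t.succ → EReal) (p : Prefix (ProdSpaceAt 𝕏) t.castSucc)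
    (ρ : Measure (ProdSpaceAt 𝕏 t)) : EReal :=
  extIntegral ρ fun y => W (p.append y)

/-- The value process `V(t, ω̄_{1:t})`, `t ∈ {0, …, T}`, by backward induction. -/
def valueProcess (c : (Fin N → ∀ t, 𝒳 t) → ℝ) (𝕏 : Fin N → FilteredProcess.{u} 𝒳)
    (κ : ∀ i, ∀ t : Fin T, Kernel (Prefix (𝕏 i).Ω t.castSucc) ((𝕏 i).Ω t))
    (t : Fin (T + 1)) : Prefix (ProdSpaceAt 𝕏) t → EReal :=
  Fin.reverseInduction (motive := fun t => Prefix (ProdSpaceAt 𝕏) t → EReal)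
    (fun p => (c (fun i => (𝕏 i).X fun s => p.toPath s i) : EReal))
    (fun t W p => ⨅ ρ ∈ stepCouplings 𝕏 κ t p, stepCost 𝕏 t W p ρ) t

/-- `V(0)`. -/
def initialValue (c : (Fin N → ∀ t, 𝒳 t) → ℝ) (𝕏 : Fin N → FilteredProcess.{u} 𝒳)
    (κ : ∀ i, ∀ t : Fin T, Kernel (Prefix (𝕏 i).Ω t.castSucc) ((𝕏 i).Ω t)) : EReal :=
  valueProcess c 𝕏 κ 0 (fun s => s.elim0)

/-- `π` has a version of its disintegration along `ω̄_1, …, ω̄_T` all of whose kernels are minimizers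
of the one-step problems. -/
def HasStepwiseOptimalKernels (c : (Fin N → ∀ t, 𝒳 t) → ℝ) (𝕏 : Fin N → FilteredProcess.{u} 𝒳)
    (κ : ∀ i, ∀ t : Fin T, Kernel (Prefix (𝕏 i).Ω t.castSucc) ((𝕏 i).Ω t))
    (π : ProbabilityMeasure (ProdSpace 𝕏)) : Prop :=
  ∃ K : ∀ t : Fin T, Kernel (Prefix (ProdSpaceAt 𝕏) t.castSucc) (ProdSpaceAt 𝕏 t),
    IsDisintegration (Ω := ProdSpaceAt 𝕏)
      ((π : Measure (ProdSpace 𝕏)).map fun ω t i => ω i t) K ∧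
    ∀ (t : Fin T) (p : Prefix (ProdSpaceAt 𝕏) t.castSucc),
      K t p ∈ stepCouplings 𝕏 κ t p ∧
      IsMinOn (stepCost 𝕏 t (valueProcess c 𝕏 κ t.succ) p) (stepCouplings 𝕏 κ t p) (K t p)

end Multi

/-! ### Bicausal couplings and the adapted weak topology -/

/-- `𝓕_{(s,t)} = 𝓕¹_s ⊗ 𝓕²_t`. -/
abbrev pairFiltration (𝕏 : FilteredProcess.{u} 𝒳) (𝕐 : FilteredProcess.{w} 𝒳) (s t : Fin (T + 1)) :
    MeasurableSpace ((∀ r, 𝕏.Ω r) × (∀ r, 𝕐.Ω r)) :=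
  MeasurableSpace.prod (𝕏.filtration s) (𝕐.filtration t)

theorem pairFiltration_le (𝕏 : FilteredProcess.{u} 𝒳) (𝕐 : FilteredProcess.{w} 𝒳)
    (s t : Fin (T + 1)) : pairFiltration 𝕏 𝕐 s t ≤ Prod.instMeasurableSpace :=
  sup_le_sup (MeasurableSpace.comap_mono (canonicalFiltration_le 𝕏.Ω s))
    (MeasurableSpace.comap_mono (canonicalFiltration_le 𝕐.Ω t))

/-- Causality from `𝕏` to `𝕐`: for all `t ∈ {1, …, T}`, `𝓕_{(T,0)}` and `𝓕_{(0,t)}` are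
conditionally independent given `𝓕_{(t,0)}`. -/
def IsCausal (𝕏 : FilteredProcess.{u} 𝒳) (𝕐 : FilteredProcess.{w} 𝒳)
    (π : Measure ((∀ t, 𝕏.Ω t) × (∀ t, 𝕐.Ω t))) [IsFiniteMeasure π] : Prop :=
  ∀ t : Fin T, CondIndep (pairFiltration 𝕏 𝕐 t.succ 0) (pairFiltration 𝕏 𝕐 (Fin.last T) 0)
    (pairFiltration 𝕏 𝕐 0 t.succ) (pairFiltration_le 𝕏 𝕐 _ _) π

/-- The set of bicausal couplings of two filtered processes. -/
def bicausalCouplings (𝕏 : FilteredProcess.{u} 𝒳) (𝕐 : FilteredProcess.{w} 𝒳) :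
    Set (ProbabilityMeasure ((∀ t, 𝕏.Ω t) × (∀ t, 𝕐.Ω t))) :=
  {π | π.toMeasure.map Prod.fst = 𝕏.P ∧ π.toMeasure.map Prod.snd = 𝕐.P ∧
    IsCausal 𝕏 𝕐 π.toMeasure ∧ IsCausal 𝕐 𝕏 (π.toMeasure.map Prod.swap)}

/-- The truncated path metric `d ∧ 1`, where `d(x, y) = ∑ₜ dₜ(xₜ, yₜ)`. -/
def truncDist (x y : ∀ t, 𝒳 t) : ℝ := min (∑ t, dist (x t) (y t)) 1

/-- The adapted Wasserstein distance for the metric `d ∧ 1`. -/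
def adaptedDist (𝕏 : FilteredProcess.{u} 𝒳) (𝕐 : FilteredProcess.{w} 𝒳) : ℝ≥0∞ :=
  ⨅ π ∈ bicausalCouplings 𝕏 𝕐,
    ∫⁻ ω, ENNReal.ofReal (truncDist (𝕏.X ω.1) (𝕐.X ω.2)) ∂π.toMeasure

variable (𝒳) in
/-- The space `FP`: filtered processes modulo vanishing adapted distance. -/
def FP : Type (max (u + 1) v) :=
  Quot fun 𝕏 𝕐 : FilteredProcess.{u} 𝒳 => adaptedDist 𝕏 𝕐 = 0

/-- The class of a filtered process in `FP`. -/
def FP.mk (𝕏 : FilteredProcess.{u} 𝒳) : FP.{u} 𝒳 := Quot.mk _ 𝕏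

/-- The adapted weak topology on `FP`, generated by the open balls
`{[𝕐] | adaptedDist 𝕏 𝕐 < ε}` of the adapted distance. -/
instance : TopologicalSpace (FP.{u} 𝒳) :=
  TopologicalSpace.generateFrom
    {B | ∃ (𝕏 : FilteredProcess.{u} 𝒳) (ε : ℝ≥0∞), 0 < ε ∧
      B = FP.mk '' {𝕐 | adaptedDist 𝕏 𝕐 < ε}}

end

end MultiCausal

/-! Adding a constant makes the cost nonnegative, so everything is first proved for
$[0,\infty]$-valued lower semicontinuous costs; `shift` and `extIntegral_shift` carry the results
back to costs bounded from below.

Multicausality is a one-step property. A probability measure is multicausal exactly when, given the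
joint past $\overline\omega_{1:t}$, each $\omega^i_{t+1}$ has conditional law
$\kappa^i_{t+1}(\omega^i_{1:t})$; this is `IsStepwiseCoupling`, and the two directions are
`isStepwiseCoupling_of_mem_multicausalCouplings` and
`mem_multicausalCouplings_of_isStepwiseCoupling`. Equivalently, almost every kernel in the joint
disintegration is a coupling of the individual kernels. The multicausal problem is thus a control
problem whose controls are one-step couplings.

For dynamic programming, weak continuity of the kernels and compactness of sets of couplings keep
the value process lower semicontinuous through the backward induction
(`lowerSemicontinuous_costToGo`) and give measurable optimal one-step couplings
(`exists_optimal_kernels`). Under any multicausal coupling the expected value process is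
nondecreasing in time (`monotone_expectedCostToGo`), and it is constant if the kernels are optimal.
This yields the value, existence and sufficiency. If an optimal coupling has finite cost, the
expectations cannot increase, so its kernels are optimal almost surely and can be replaced by
measurable optimal ones on null sets.

For semicontinuity on $\mathrm{FP}^N$, a multicausal coupling of the $\mathbb Y^i$ is glued with
bicausal couplings of $\mathbb X^i$ and $\mathbb Y^i$: conditionally on the $\mathbb Y$-paths, the
$\mathbb X$-paths are drawn independently. The result is multicausal for the $\mathbb X^i$
(`IsStepwiseCoupling.bind_piKernel`), and the integral of the $k$-Lipschitz envelope of the cost,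
truncated at $k$, grows by at most $k$ times the sum of the truncated transport costs. Compactness
of the set of multicausal couplings makes the values for the envelopes approximate the value for the
cost (`exists_lt_multicausalCost_lipschitzEnvelope`). The argument uses no triangle inequality for
the adapted distance. -/

namespace MultiCausal

noncomputable section

/-! ### Lower semicontinuous functions and their integrals -/

section LSC

variable {α : Type*}

/-- The truncated Pasch–Hausdorff envelopes of an extended nonnegative function. -/
def lipschitzEnvelope [PseudoEMetricSpace α] (W : α → ℝ≥0∞) (k : ℕ) (x : α) : ℝ≥0∞ :=
  (⨅ z, W z + k * edist x z) ⊓ k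

variable [PseudoEMetricSpace α]

theorem lipschitzEnvelope_le (W : α → ℝ≥0∞) (k : ℕ) (x : α) : lipschitzEnvelope W k x ≤ W x :=
  inf_le_left.trans ((iInf_le _ x).trans (by simp))

theorem lipschitzEnvelope_le_natCast (W : α → ℝ≥0∞) (k : ℕ) (x : α) :
    lipschitzEnvelope W k x ≤ k :=
  inf_le_right

theorem lipschitzEnvelope_le_add (W : α → ℝ≥0∞) (k : ℕ) (x y : α) :
    lipschitzEnvelope W k x ≤ lipschitzEnvelope W k y + k * edist x y := by
  unfold lipschitzEnvelope
  rw [← min_add_add_right]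
  refine le_min ?_ (inf_le_right.trans le_self_add)
  rw [ENNReal.iInf_add]
  refine le_iInf fun z => inf_le_left.trans ((iInf_le _ z).trans ?_)
  rw [add_assoc, ← mul_add]
  gcongr
  rw [add_comm]
  exact edist_triangle _ _ _

theorem continuous_lipschitzEnvelope (W : α → ℝ≥0∞) (k : ℕ) :
    Continuous (lipschitzEnvelope W k) :=
  continuous_of_le_add_edist k (by simp) (lipschitzEnvelope_le_add W k)

theorem monotone_lipschitzEnvelope (W : α → ℝ≥0∞) : Monotone (lipschitzEnvelope W) := by
  intro k l hkl x
  unfold lipschitzEnvelope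
  gcongr

/-- Take $b<W(x)$. Points $z$ near $x$ satisfy $W(z)>b$ by lower semicontinuity, while points at
distance at least $\varepsilon$ are penalized by $k\varepsilon\ge b$ once $k$ is large; the
truncation level must exceed $b$ as well. -/
theorem iSup_lipschitzEnvelope {W : α → ℝ≥0∞} (hW : LowerSemicontinuous W) (x : α) :
    ⨆ k, lipschitzEnvelope W k x = W x := by
  refine le_antisymm (iSup_le fun k => lipschitzEnvelope_le W k x) ?_
  refine le_of_forall_lt fun a ha => ?_
  obtain ⟨b, hab, hb⟩ := exists_between ha
  have hbt : b ≠ ∞ := (lt_of_lt_of_le hb le_top).ne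
  obtain ⟨ε, hε, hball⟩ := EMetric.mem_nhds_iff.1 (hW x b hb)
  obtain ⟨k₁, hk₁⟩ := ENNReal.exists_nat_gt hbt
  obtain ⟨k₂, hk₂⟩ : ∃ k : ℕ, b ≤ k * ε := by
    rcases eq_or_ne ε ∞ with rfl | hεt
    · exact ⟨1, by simp⟩
    · obtain ⟨k, hk⟩ := ENNReal.exists_nat_gt (ENNReal.div_ne_top hbt hε.ne')
      exact ⟨k, ((ENNReal.div_lt_iff (Or.inl hε.ne') (Or.inl hεt)).1 hk).le⟩
  refine hab.trans_le (le_trans ?_ (le_iSup _ (max k₁ k₂)))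
  refine le_inf (le_iInf fun z => ?_) (hk₁.le.trans (by exact_mod_cast le_max_left _ _))
  by_cases hz : edist z x < ε
  · exact (le_of_lt (hball hz)).trans le_self_add
  · refine hk₂.trans (le_trans ?_ le_add_self)
    rw [edist_comm]
    gcongr
    · exact le_max_right _ _
    · exact not_lt.1 hz

end LSC

section Integral

variable {α : Type*} [TopologicalSpace α] [MeasurableSpace α]

theorem continuous_lintegral_of_continuous_of_le [OpensMeasurableSpace α] {f : α → ℝ≥0∞}
    (hf : Continuous f) {k : ℕ} (hk : ∀ x, f x ≤ k) :
    Continuous fun μ : ProbabilityMeasure α => ∫⁻ x, f x ∂(μ : Measure α) := by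
  have hft : ∀ x, f x ≠ ∞ := fun x => ((hk x).trans_lt (ENNReal.natCast_lt_top k)).ne
  have hc : Continuous fun x => (f x).toNNReal := by
    refine continuous_iff_continuousAt.2 fun x => ?_
    exact (ENNReal.tendsto_toNNReal (hft x)).comp hf.continuousAt
  have hb : ∀ x y, dist (f x).toNNReal (f y).toNNReal ≤ k := by
    intro x y
    have h : ∀ x, ((f x).toNNReal : ℝ) ≤ k := fun x => by
      have := ENNReal.toNNReal_mono (by simp) (hk x)
      exact_mod_cast this
    rw [NNReal.dist_eq, abs_le]
    constructor <;> linarith [h x, h y, (f x).toNNReal.2, (f y).toNNReal.2]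
  have := ProbabilityMeasure.continuous_lintegral_boundedContinuousFunction
    (BoundedContinuousFunction.mkOfBound ⟨_, hc⟩ k hb)
  convert this using 4 with μ x
  exact (ENNReal.coe_toNNReal (hft x)).symm

/-- By monotone convergence the integral is the supremum of the integrals of the Lipschitz
envelopes, each of which is weakly continuous. -/
theorem lowerSemicontinuous_lintegral [TopologicalSpace.PseudoMetrizableSpace α]
    [OpensMeasurableSpace α] {W : α → ℝ≥0∞} (hW : LowerSemicontinuous W) :
    LowerSemicontinuous fun μ : ProbabilityMeasure α => ∫⁻ x, W x ∂(μ : Measure α) := by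
  let _ := TopologicalSpace.pseudoMetrizableSpacePseudoMetric α
  have : (fun μ : ProbabilityMeasure α => ∫⁻ x, W x ∂(μ : Measure α)) =
      fun μ : ProbabilityMeasure α => ⨆ k, ∫⁻ x, lipschitzEnvelope W k x ∂(μ : Measure α) := by
    ext μ
    rw [← lintegral_iSup (fun k => (continuous_lipschitzEnvelope W k).measurable)
      (monotone_lipschitzEnvelope W)]
    simp_rw [iSup_lipschitzEnvelope hW]
  rw [this]
  exact lowerSemicontinuous_iSup fun k => (continuous_lintegral_of_continuous_of_le
    (continuous_lipschitzEnvelope W k) (lipschitzEnvelope_le_natCast W k)).lowerSemicontinuous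

/-- The integral is taken against $\delta_x\otimes\mu$, which depends continuously on $(x,\mu)$.
Joint semicontinuity is what the backward induction needs, since the past and the coupling vary
together. -/
theorem lowerSemicontinuous_lintegral_prodMk {β : Type*} [TopologicalSpace β] [MeasurableSpace β]
    [TopologicalSpace.PseudoMetrizableSpace α] [TopologicalSpace.PseudoMetrizableSpace β]
    [SecondCountableTopology α] [SecondCountableTopology β]
    [OpensMeasurableSpace α] [OpensMeasurableSpace β]
    {W : α × β → ℝ≥0∞} (hW : LowerSemicontinuous W) :
    LowerSemicontinuous fun q : α × ProbabilityMeasure β =>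
      ∫⁻ y, W (q.1, y) ∂(q.2 : Measure β) := by
  have hc : Continuous fun q : α × ProbabilityMeasure β => (diracProba q.1).prod q.2 :=
    ProbabilityMeasure.continuous_prod.comp
      ((continuous_diracProba.comp continuous_fst).prodMk continuous_snd)
  have : LowerSemicontinuous ((fun μ : ProbabilityMeasure (α × β) =>
      ∫⁻ x, W x ∂(μ : Measure (α × β))) ∘
        fun q : α × ProbabilityMeasure β => (diracProba q.1).prod q.2) := by
    intro q a ha
    exact hc.continuousAt.eventually (lowerSemicontinuous_lintegral hW _ a ha)
  convert this using 2 with q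
  simp only [Function.comp, ProbabilityMeasure.toMeasure_prod]
  rw [diracProba, ProbabilityMeasure.coe_mk, Measure.dirac_prod,
    lintegral_map hW.measurable measurable_prodMk_left]

theorem continuous_lintegral_prodMk {β : Type*} [TopologicalSpace β] [MeasurableSpace β]
    [TopologicalSpace.PseudoMetrizableSpace α] [TopologicalSpace.PseudoMetrizableSpace β]
    [SecondCountableTopology α] [SecondCountableTopology β]
    [OpensMeasurableSpace α] [OpensMeasurableSpace β]
    {f : α × β → ℝ≥0∞} (hf : Continuous f) {k : ℕ} (hk : ∀ x, f x ≤ k) :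
    Continuous fun q : α × ProbabilityMeasure β => ∫⁻ y, f (q.1, y) ∂(q.2 : Measure β) := by
  have hc : Continuous fun q : α × ProbabilityMeasure β => (diracProba q.1).prod q.2 :=
    ProbabilityMeasure.continuous_prod.comp
      ((continuous_diracProba.comp continuous_fst).prodMk continuous_snd)
  have := (continuous_lintegral_of_continuous_of_le hf hk).comp hc
  convert this using 2 with q
  simp only [Function.comp, ProbabilityMeasure.toMeasure_prod]
  rw [diracProba, ProbabilityMeasure.coe_mk, Measure.dirac_prod,
    lintegral_map hf.measurable measurable_prodMk_left]

end Integral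

/-! ### Compactness of sets of couplings -/

section Couplings

variable {ι : Type*} {E : ι → Type*} [∀ i, MeasurableSpace (E i)]

/-- The marginal of a probability measure on a finite product. -/
def marginal (ρ : ProbabilityMeasure (∀ i, E i)) (i : ι) : ProbabilityMeasure (E i) :=
  ρ.map (measurable_pi_apply i).aemeasurable

theorem toMeasure_marginal (ρ : ProbabilityMeasure (∀ i, E i)) (i : ι) :
    (marginal ρ i : Measure (E i)) = (ρ : Measure (∀ i, E i)).map fun x => x i :=
  rfl

variable [Fintype ι] [∀ i, TopologicalSpace (E i)] [∀ i, PolishSpace (E i)] [∀ i, BorelSpace (E i)]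

theorem continuous_marginal (i : ι) :
    Continuous fun ρ : ProbabilityMeasure (∀ i, E i) => marginal ρ i :=
  ProbabilityMeasure.continuous_map (continuous_apply i)

/-- Prokhorov's theorem in both directions: compact sets of marginals are tight, a product of
compact sets then captures almost all mass of every coupling by a union bound, and tight closed sets
are compact. -/
theorem isCompact_setOf_marginal_mem {S : ∀ i, Set (ProbabilityMeasure (E i))}
    (hS : ∀ i, IsCompact (S i)) :
    IsCompact {ρ : ProbabilityMeasure (∀ i, E i) | ∀ i, marginal ρ i ∈ S i} := by
  have hclosed : IsClosed {ρ : ProbabilityMeasure (∀ i, E i) | ∀ i, marginal ρ i ∈ S i} := by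
    simp only [Set.ofPred_forall]
    exact isClosed_iInter fun i => (hS i).isClosed.preimage (continuous_marginal i)
  rw [← hclosed.closure_eq]
  refine isCompact_closure_of_isTightMeasureSet ?_
  rw [isTightMeasureSet_iff_exists_isCompact_measure_compl_le]
  intro ε hε
  -- The extra one in the denominator covers an empty index type.
  have hε' : 0 < ε / (Fintype.card ι + 1) :=
    ENNReal.div_pos hε.ne' (by finiteness)
  have htight : ∀ i, ∃ K : Set (E i), IsCompact K ∧ ∀ μ ∈ S i, (μ : Measure (E i)) Kᶜ ≤
      ε / (Fintype.card ι + 1) := by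
    intro i
    let _ := TopologicalSpace.upgradeIsCompletelyMetrizable (E i)
    have h := isTightMeasureSet_of_isCompact_closure (S := S i)
      (by rw [(hS i).isClosed.closure_eq]; exact hS i)
    obtain ⟨K, hK, h⟩ := isTightMeasureSet_iff_exists_isCompact_measure_compl_le.1 h _ hε'
    exact ⟨K, hK, fun μ hμ => h _ ⟨μ, hμ, rfl⟩⟩
  choose K hK hKS using htight
  refine ⟨Set.univ.pi K, isCompact_univ_pi hK, ?_⟩
  rintro _ ⟨ρ, hρ, rfl⟩
  have hsub : (Set.univ.pi K)ᶜ ⊆ ⋃ i ∈ (Finset.univ : Finset ι), (fun x : ∀ i, E i => x i) ⁻¹' (K i)ᶜ := by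
    intro x hx
    simpa [Set.mem_pi] using hx
  calc (ρ : Measure (∀ i, E i)) (Set.univ.pi K)ᶜ
      ≤ ∑ i, (ρ : Measure (∀ i, E i)) ((fun x : ∀ i, E i => x i) ⁻¹' (K i)ᶜ) :=
        (measure_mono hsub).trans (measure_biUnion_finset_le _ _)
    _ ≤ ∑ _i : ι, ε / (Fintype.card ι + 1) := by
        refine Finset.sum_le_sum fun i _ => ?_
        have := hKS i _ (hρ i)
        rwa [toMeasure_marginal, Measure.map_apply (measurable_pi_apply i)
          (hK i).isClosed.measurableSet.compl] at this
    _ ≤ ε := by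
        rw [Finset.sum_const, Finset.card_univ, nsmul_eq_mul]
        calc (Fintype.card ι : ℝ≥0∞) * (ε / (Fintype.card ι + 1))
            ≤ (Fintype.card ι + 1) * (ε / (Fintype.card ι + 1)) := by gcongr; exact le_self_add
          _ ≤ ε := ENNReal.mul_div_le

variable {P : Type*} [TopologicalSpace P]

/-- If the marginals depend continuously on a parameter, the parameters for which some coupling in a
closed set has cost at most `r` form a closed set. -/
theorem isClosed_setOf_exists_coupling_le [T2Space P] [SequentialSpace P]
    {k : ∀ i, P → ProbabilityMeasure (E i)} (hk : ∀ i, Continuous (k i))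
    {J : P × ProbabilityMeasure (∀ i, E i) → ℝ≥0∞} (hJ : LowerSemicontinuous J)
    {C : Set (ProbabilityMeasure (∀ i, E i))} (hC : IsClosed C) (r : ℝ≥0∞) :
    IsClosed {p | ∃ ρ ∈ C, (∀ i, marginal ρ i = k i p) ∧ J (p, ρ) ≤ r} := by
  -- Compactness of the couplings is available only over a compact set of parameters. There the set
  -- is a projection of the compact set `Γ`.
  rw [CompactlyCoherentSpace.isClosed_iff]
  intro K hK
  let Γ : Set (P × ProbabilityMeasure (∀ i, E i)) :=
    (K ×ˢ {ρ | ∀ i, marginal ρ i ∈ k i '' K}) ∩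
      ({q | q.2 ∈ C} ∩ ({q | ∀ i, marginal q.2 i = k i q.1} ∩ {q | J q ≤ r}))
  have hΓ : IsCompact Γ := by
    refine (hK.prod (isCompact_setOf_marginal_mem fun i => hK.image (hk i))).inter_right ?_
    refine (hC.preimage continuous_snd).inter (IsClosed.inter ?_ (hJ.isClosed_preimage r))
    simp only [Set.ofPred_forall]
    exact isClosed_iInter fun i => isClosed_eq ((continuous_marginal i).comp continuous_snd)
      ((hk i).comp continuous_fst)
  have : ((↑) : K → P) ⁻¹' {p | ∃ ρ ∈ C, (∀ i, marginal ρ i = k i p) ∧ J (p, ρ) ≤ r} =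
      ((↑) : K → P) ⁻¹' (Prod.fst '' Γ) := by
    ext ⟨p, hp⟩
    constructor
    · rintro ⟨ρ, h1, h2, h3⟩
      exact ⟨(p, ρ), ⟨⟨hp, fun i => ⟨p, hp, (h2 i).symm⟩⟩, h1, h2, h3⟩, rfl⟩
    · rintro ⟨⟨_, ρ⟩, ⟨_, h1, h2, h3⟩, rfl⟩
      exact ⟨ρ, h1, h2, h3⟩
  rw [this]
  exact (hΓ.image continuous_fst).isClosed.preimage continuous_subtype_val

end Couplings

/-! ### Measurable selection by successive minimization -/

section Selection

variable {P R : Type*} [MeasurableSpace P] [TopologicalSpace R]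

/-- A multifunction with nonempty compact values that meets each closed set on a measurable set. -/
structure IsCompactMultifunction (A : P → Set R) : Prop where
  isCompact : ∀ p, IsCompact (A p)
  nonempty : ∀ p, (A p).Nonempty
  measurableSet : ∀ C : Set R, IsClosed C → MeasurableSet {p | (A p ∩ C).Nonempty}

/-- The minimizers of `g p` over `A p`. -/
def argminOn (A : P → Set R) (g : P → R → ℝ≥0∞) (p : P) : Set R :=
  {ρ ∈ A p | ∀ ρ' ∈ A p, g p ρ ≤ g p ρ'}

/-- A lower semicontinuous function attains its minimum on the compact set $A(p)\cap C$.
Nonemptiness is listed separately because an empty infimum is $\infty$, which may equal the infimum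
over $A(p)$. -/
theorem argminOn_inter_nonempty_iff {A : P → Set R} (hA : IsCompactMultifunction A)
    {g : P → R → ℝ≥0∞} (hg : ∀ p, LowerSemicontinuous (g p)) {C : Set R} (hC : IsClosed C) (p : P) :
    (argminOn A g p ∩ C).Nonempty ↔
      (A p ∩ C).Nonempty ∧ ⨅ ρ ∈ A p ∩ C, g p ρ ≤ ⨅ ρ ∈ A p, g p ρ := by
  constructor
  · rintro ⟨ρ, ⟨h1, h2⟩, h3⟩
    exact ⟨⟨ρ, h1, h3⟩, (iInf₂_le ρ ⟨h1, h3⟩).trans (le_iInf₂ h2)⟩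
  · rintro ⟨hne, hle⟩
    obtain ⟨ρ, hρ, hmin⟩ := ((hg p).lowerSemicontinuousOn _).exists_isMinOn hne
      ((hA.isCompact p).inter_right hC)
    refine ⟨ρ, ⟨hρ.1, fun ρ' hρ' => ?_⟩, hρ.2⟩
    calc g p ρ ≤ ⨅ ρ ∈ A p ∩ C, g p ρ := le_iInf₂ fun σ hσ => hmin hσ
      _ ≤ _ := hle.trans (iInf₂_le ρ' hρ')

/-- Meeting a closed set becomes a comparison of two infima, so measurability of these infima lets
the minimization be repeated. -/
theorem IsCompactMultifunction.argminOn {A : P → Set R} (hA : IsCompactMultifunction A)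
    {g : P → R → ℝ≥0∞} (hg : ∀ p, LowerSemicontinuous (g p))
    (hm : ∀ C : Set R, IsClosed C → Measurable fun p => ⨅ ρ ∈ A p ∩ C, g p ρ) :
    IsCompactMultifunction (argminOn A g) where
  isCompact p := by
    have : MultiCausal.argminOn A g p = A p ∩ ⋂ ρ' ∈ A p, {ρ | g p ρ ≤ g p ρ'} := by
      ext ρ
      simp [MultiCausal.argminOn]
    rw [this]
    exact (hA.isCompact p).inter_right
      (isClosed_biInter fun ρ' _ => (hg p).isClosed_preimage (g p ρ'))
  nonempty p := by
    have := (argminOn_inter_nonempty_iff hA hg isClosed_univ p).2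
    simp only [Set.inter_univ] at this
    exact this ⟨hA.nonempty p, le_rfl⟩
  measurableSet C hC := by
    simp only [argminOn_inter_nonempty_iff hA hg hC]
    refine (hA.measurableSet C hC).inter (measurableSet_le (hm C hC) ?_)
    simpa using hm _ isClosed_univ

/-- The infimum is attained when the set is nonempty, so for finite $r$ it is at most $r$ exactly
when $A(p)$ meets the closed set $C\cap\{g\le r\}$. -/
theorem IsCompactMultifunction.measurable_iInf {A : P → Set R} (hA : IsCompactMultifunction A)
    {g : R → ℝ≥0∞} (hg : LowerSemicontinuous g) {C : Set R} (hC : IsClosed C) :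
    Measurable fun p => ⨅ ρ ∈ A p ∩ C, g ρ := by
  refine measurable_of_Iic fun r => ?_
  rcases eq_or_ne r ∞ with rfl | hr
  · simp
  convert hA.measurableSet (C ∩ {ρ | g ρ ≤ r}) (hC.inter (hg.isClosed_preimage r)) using 1
  ext p
  constructor
  · intro h
    have hne : (A p ∩ C).Nonempty := by
      by_contra hne
      rw [Set.not_nonempty_iff_eq_empty] at hne
      simp only [Set.mem_preimage, Set.mem_Iic, hne] at h
      simp at h
      exact hr h
    obtain ⟨ρ, hρ, hmin⟩ := (hg.lowerSemicontinuousOn _).exists_isMinOn hne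
      ((hA.isCompact p).inter_right hC)
    have hle : ⨅ ρ ∈ A p ∩ C, g ρ ≤ r := h
    have hle : g ρ ≤ r := (le_iInf₂ fun σ hσ => hmin hσ).trans hle
    exact ⟨ρ, hρ.1, hρ.2, hle⟩
  · rintro ⟨ρ, h1, h2, h3⟩
    have hle : g ρ ≤ r := h3
    exact (iInf₂_le (f := fun ρ (_ : ρ ∈ A p ∩ C) => g ρ) ρ ⟨h1, h2⟩).trans hle

/-- Successive minimization of the functions `g 0, g 1, …`. -/
def iteratedArgmin (A : P → Set R) (g : ℕ → R → ℝ≥0∞) : ℕ → P → Set R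
  | 0 => A
  | n + 1 => argminOn (iteratedArgmin A g n) fun _ => g n

/-- Minimizing one function after another shrinks $A(p)$ to a point, as the functions separate
points. By compactness this point lies in a closed $C$ if and only if every stage meets $C$, a
countable intersection of measurable conditions. -/
theorem IsCompactMultifunction.exists_selection [T2Space R] {A : P → Set R}
    (hA : IsCompactMultifunction A) {g : ℕ → R → ℝ≥0∞} (hg : ∀ n, LowerSemicontinuous (g n))
    (hsep : ∀ ρ ρ', (∀ n, g n ρ = g n ρ') → ρ = ρ') :
    ∃ s : P → R, (∀ p, s p ∈ A p) ∧ ∀ C : Set R, IsClosed C → MeasurableSet (s ⁻¹' C) := by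
  have hit : ∀ n, IsCompactMultifunction (iteratedArgmin A g n) := by
    intro n
    induction n with
    | zero => exact hA
    | succ n ih => exact ih.argminOn (fun _ => hg n) fun C hC => ih.measurable_iInf (hg n) hC
  have hanti : ∀ p n, iteratedArgmin A g (n + 1) p ⊆ iteratedArgmin A g n p :=
    fun p n ρ hρ => hρ.1
  have key : ∀ p (C : Set R), IsClosed C → (∀ n, (iteratedArgmin A g n p ∩ C).Nonempty) →
      ∃ ρ ∈ C, ∀ n, ρ ∈ iteratedArgmin A g n p := by
    intro p C hC h
    obtain ⟨ρ, hρ⟩ := IsCompact.nonempty_iInter_of_sequence_nonempty_isCompact_isClosed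
      (fun n => iteratedArgmin A g n p ∩ C) (fun n => Set.inter_subset_inter_left _ (hanti p n)) h
      (((hit 0).isCompact p).inter_right hC)
      (fun n => (((hit n).isCompact p).inter_right hC).isClosed)
    rw [Set.mem_iInter] at hρ
    exact ⟨ρ, (hρ 0).2, fun n => (hρ n).1⟩
  have huniq : ∀ p ρ ρ', (∀ n, ρ ∈ iteratedArgmin A g n p) →
      (∀ n, ρ' ∈ iteratedArgmin A g n p) → ρ = ρ' := fun p ρ ρ' h h' =>
    hsep ρ ρ' fun n => le_antisymm ((h (n + 1)).2 ρ' (h' n)) ((h' (n + 1)).2 ρ (h n))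
  choose s hs using fun p => key p Set.univ isClosed_univ
    fun n => by simpa using (hit n).nonempty p
  refine ⟨s, fun p => (hs p).2 0, fun C hC => ?_⟩
  have : s ⁻¹' C = ⋂ n, {p | (iteratedArgmin A g n p ∩ C).Nonempty} := by
    ext p
    simp only [Set.mem_preimage, Set.mem_iInter, Set.mem_ofPred_eq]
    constructor
    · exact fun h n => ⟨s p, (hs p).2 n, h⟩
    · intro h
      obtain ⟨ρ, hρC, hρ⟩ := key p C hC h
      rwa [huniq p _ _ (hs p).2 hρ]
  rw [this]
  exact MeasurableSet.iInter fun n => (hit n).measurableSet C hC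

end Selection

/-! ### Semicontinuous functionals separating probability measures -/

section MeasureSelection

variable {E : Type*} [TopologicalSpace E] [PolishSpace E] [MeasurableSpace E] [BorelSpace E]

theorem lowerSemicontinuous_measure_of_isOpen {U : Set E} (hU : IsOpen U) :
    LowerSemicontinuous fun ρ : ProbabilityMeasure E => (ρ : Measure E) U := by
  have := lowerSemicontinuous_lintegral (α := E)
    (hU.lowerSemicontinuous_indicator (y := (1 : ℝ≥0∞)) zero_le_one)
  convert this using 2 with ρ
  simp [lintegral_indicator hU.measurableSet]

variable (E) in
-- Finite intersections of a countable base form a countable π-system generating the Borel sets, and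
-- the mass of an open set is lower semicontinuous.
theorem exists_separating_seq : ∃ g : ℕ → ProbabilityMeasure E → ℝ≥0∞,
    (∀ n, LowerSemicontinuous (g n)) ∧ ∀ ρ ρ', (∀ n, g n ρ = g n ρ') → ρ = ρ' := by
  obtain ⟨b, hbc, -, hb⟩ := TopologicalSpace.exists_countable_basis E
  have hcount : {t : Set (Set E) | t.Finite ∧ t ⊆ b}.Countable :=
    Set.countable_ofPred_finite_subset hbc
  obtain ⟨f, hf⟩ := hcount.exists_eq_range ⟨∅, Set.finite_empty, Set.empty_subset _⟩
  have hfm : ∀ n, (f n).Finite ∧ f n ⊆ b := fun n => by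
    have : f n ∈ {t : Set (Set E) | t.Finite ∧ t ⊆ b} := hf ▸ Set.mem_range_self n
    exact this
  have hopen : ∀ n, IsOpen (⋂₀ f n) := fun n =>
    (hfm n).1.isOpen_sInter fun s hs => hb.isOpen ((hfm n).2 hs)
  refine ⟨fun n ρ => (ρ : Measure E) (⋂₀ f n),
    fun n => lowerSemicontinuous_measure_of_isOpen (hopen n), fun ρ ρ' h => ?_⟩
  suffices hρ : (ρ : Measure E) = ρ' from Subtype.ext hρ
  refine ext_of_generate_finite (Set.range fun n => ⋂₀ f n) ?_ ?_ ?_ (by simp)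
  · refine le_antisymm ?_ ?_
    · rw [BorelSpace.measurable_eq (α := E), hb.borel_eq_generateFrom]
      refine MeasurableSpace.generateFrom_mono ?_
      intro s hs
      have : ({s} : Set (Set E)) ∈ Set.range f :=
        hf ▸ ⟨Set.finite_singleton s, Set.singleton_subset_iff.2 hs⟩
      obtain ⟨n, hn⟩ := this
      exact ⟨n, by simp [hn]⟩
    · refine MeasurableSpace.generateFrom_le ?_
      rintro _ ⟨n, rfl⟩
      exact (hopen n).measurableSet
  · rintro _ ⟨n, rfl⟩ _ ⟨m, rfl⟩ -
    have : f n ∪ f m ∈ Set.range f :=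
      hf ▸ ⟨(hfm n).1.union (hfm m).1, Set.union_subset (hfm n).2 (hfm m).2⟩
    obtain ⟨k, hk⟩ := this
    exact ⟨k, by simp [hk, Set.sInter_union]⟩
  · rintro _ ⟨n, rfl⟩
    exact h n

/-- Open sets form a generating π-system, and $\{\rho : \rho(U)\le r\}$ is weakly closed for open
$U$. -/
theorem measurable_toMeasure_of_measurableSet_preimage {P : Type*} [MeasurableSpace P]
    {s : P → ProbabilityMeasure E}
    (hs : ∀ C : Set (ProbabilityMeasure E), IsClosed C → MeasurableSet (s ⁻¹' C)) :
    Measurable fun p => (s p : Measure E) := by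
  refine Measurable.measure_of_isPiSystem_of_isProbabilityMeasure
    (BorelSpace.measurable_eq (α := E)) isPiSystem_isOpen fun U hU => ?_
  refine measurable_of_Iic fun r => ?_
  exact hs _ ((lowerSemicontinuous_measure_of_isOpen hU).isClosed_preimage r)

end MeasureSelection

/-! ### One-step optimal transport with parameters -/

section OneStep

variable {ι : Type*} {E : ι → Type*} [∀ i, MeasurableSpace (E i)] {P : Type*}

/-- The optimal transport value between the laws `k i p` for the cost `W (p, ·)`. -/
def transportValue (k : ∀ i, P → ProbabilityMeasure (E i)) (W : P × (∀ i, E i) → ℝ≥0∞) (p : P) :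
    ℝ≥0∞ :=
  ⨅ ρ ∈ couplings (fun i => (k i p : Measure (E i))), ∫⁻ y, W (p, y) ∂ρ

/-- The couplings of `k i p`, as probability measures. -/
def couplingSet (k : ∀ i, P → ProbabilityMeasure (E i)) (p : P) :
    Set (ProbabilityMeasure (∀ i, E i)) :=
  {ρ | ∀ i, marginal ρ i = k i p}

theorem mem_couplings_iff {μ : ∀ i, ProbabilityMeasure (E i)} {ρ : ProbabilityMeasure (∀ i, E i)} :
    (ρ : Measure (∀ i, E i)) ∈ couplings (fun i => (μ i : Measure (E i))) ↔
      ∀ i, marginal ρ i = μ i := by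
  constructor
  · rintro ⟨-, h⟩ i
    exact Subtype.ext (h i)
  · exact fun h => ⟨inferInstance, fun i => congrArg Subtype.val (h i)⟩

theorem transportValue_eq_iInf_couplingSet (k : ∀ i, P → ProbabilityMeasure (E i))
    (W : P × (∀ i, E i) → ℝ≥0∞) (p : P) :
    transportValue k W p = ⨅ ρ ∈ couplingSet k p, ∫⁻ y, W (p, y) ∂(ρ : Measure (∀ i, E i)) := by
  refine le_antisymm (le_iInf₂ fun ρ hρ => ?_) (le_iInf₂ fun ρ hρ => ?_)
  · exact iInf₂_le (f := fun (ρ : Measure (∀ i, E i))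
      (_ : ρ ∈ couplings (fun i => (k i p : Measure (E i)))) => ∫⁻ y, W (p, y) ∂ρ)
      (ρ : Measure (∀ i, E i)) (mem_couplings_iff.2 hρ)
  · let ρ' : ProbabilityMeasure (∀ i, E i) := ⟨ρ, hρ.1⟩
    have h' : ρ' ∈ couplingSet k p := fun i => Subtype.ext (hρ.2 i)
    exact iInf₂_le (f := fun (ρ : ProbabilityMeasure (∀ i, E i)) (_ : ρ ∈ couplingSet k p) =>
      ∫⁻ y, W (p, y) ∂(ρ : Measure (∀ i, E i))) ρ' h'

variable [Fintype ι] [∀ i, TopologicalSpace (E i)] [∀ i, PolishSpace (E i)]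
  [∀ i, BorelSpace (E i)] [TopologicalSpace P]
  {k : ∀ i, P → ProbabilityMeasure (E i)} {W : P × (∀ i, E i) → ℝ≥0∞}

theorem couplingSet_nonempty (k : ∀ i, P → ProbabilityMeasure (E i)) (p : P) :
    (couplingSet k p).Nonempty := by
  refine ⟨ProbabilityMeasure.pi fun i => k i p, fun i => Subtype.ext ?_⟩
  rw [ProbabilityMeasure.val_eq_to_measure, toMeasure_marginal]
  exact (measurePreserving_eval (fun i => (k i p : Measure (E i))) i).map_eq

theorem isCompact_couplingSet (k : ∀ i, P → ProbabilityMeasure (E i)) (p : P) :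
    IsCompact (couplingSet k p) := by
  have := isCompact_setOf_marginal_mem (S := fun i => {k i p}) fun i => isCompact_singleton
  simpa [couplingSet] using this

variable [PolishSpace P]

/-- Since the infimum is attained, a sublevel set consists of the parameters admitting a coupling in
$C$ of cost at most $r$, which is closed. The set $C$ is kept general because measurable selection
needs the minimal cost over every closed set of couplings. -/
theorem lowerSemicontinuous_iInf_couplingSet (hk : ∀ i, Continuous (k i))
    (hW : LowerSemicontinuous W) {C : Set (ProbabilityMeasure (∀ i, E i))} (hC : IsClosed C)
    [MeasurableSpace P] [BorelSpace P] :
    LowerSemicontinuous fun p => ⨅ ρ ∈ couplingSet k p ∩ C,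
      ∫⁻ y, W (p, y) ∂(ρ : Measure (∀ i, E i)) := by
  have hJ := lowerSemicontinuous_lintegral_prodMk hW
  rw [lowerSemicontinuous_iff_isClosed_preimage]
  intro r
  rcases eq_or_ne r ∞ with rfl | hr
  · simp
  convert isClosed_setOf_exists_coupling_le hk hJ hC r using 1
  ext p
  have hp : LowerSemicontinuous fun ρ : ProbabilityMeasure (∀ i, E i) =>
      ∫⁻ y, W (p, y) ∂(ρ : Measure (∀ i, E i)) := by
    intro ρ a ha
    exact (Continuous.prodMk_right p).continuousAt.eventually (hJ (p, ρ) a ha)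
  constructor
  · intro h
    have h : ⨅ ρ ∈ couplingSet k p ∩ C, ∫⁻ y, W (p, y) ∂(ρ : Measure (∀ i, E i)) ≤ r := h
    have hne : (couplingSet k p ∩ C).Nonempty := by
      by_contra hne
      rw [Set.not_nonempty_iff_eq_empty] at hne
      simp [hne] at h
      exact hr h
    obtain ⟨ρ, hρ, hmin⟩ := (hp.lowerSemicontinuousOn _).exists_isMinOn hne
      ((isCompact_couplingSet k p).inter_right hC)
    have hle : ∫⁻ y, W (p, y) ∂(ρ : Measure (∀ i, E i)) ≤ r :=
      (le_iInf₂ fun σ hσ => hmin hσ).trans h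
    exact ⟨ρ, hρ.2, hρ.1, hle⟩
  · rintro ⟨ρ, h1, h2, h3⟩
    exact (iInf₂_le (f := fun ρ (_ : ρ ∈ couplingSet k p ∩ C) =>
      ∫⁻ y, W (p, y) ∂(ρ : Measure (∀ i, E i))) ρ ⟨h2, h1⟩).trans h3

variable [MeasurableSpace P] [BorelSpace P]

theorem lowerSemicontinuous_transportValue (hk : ∀ i, Continuous (k i))
    (hW : LowerSemicontinuous W) : LowerSemicontinuous (transportValue k W) := by
  have := lowerSemicontinuous_iInf_couplingSet hk hW isClosed_univ
  simp only [Set.inter_univ] at this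
  convert this using 1
  ext p
  exact transportValue_eq_iInf_couplingSet k W p

theorem isCompactMultifunction_couplingSet (hk : ∀ i, Continuous (k i)) :
    IsCompactMultifunction (couplingSet k) where
  isCompact := isCompact_couplingSet k
  nonempty := couplingSet_nonempty k
  measurableSet C hC := by
    -- With zero cost and level $0$, the cost constraint is void.
    have := (isClosed_setOf_exists_coupling_le hk
      (lowerSemicontinuous_const (z := (0 : ℝ≥0∞))) hC 0).measurableSet
    convert this using 1
    ext p
    exact ⟨fun ⟨ρ, h1, h2⟩ => ⟨ρ, h2, h1, le_rfl⟩, fun ⟨ρ, h1, h2, _⟩ => ⟨ρ, h2, h1⟩⟩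

/-- A measurable choice of optimal couplings. -/
theorem exists_optimal_kernel (hk : ∀ i, Continuous (k i)) (hW : LowerSemicontinuous W) :
    ∃ K : Kernel P (∀ i, E i), IsMarkovKernel K ∧
      (∀ p, K p ∈ couplings (fun i => (k i p : Measure (E i)))) ∧
      ∀ p, ∫⁻ y, W (p, y) ∂(K p) = transportValue k W p := by
  -- The transport cost, which depends on the parameter, is minimized first; the separating
  -- functionals then only break ties among optimal couplings.
  have hA := (isCompactMultifunction_couplingSet hk).argminOn
    (g := fun p ρ => ∫⁻ y, W (p, y) ∂(ρ : Measure (∀ i, E i)))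
    (fun p ρ a ha => (Continuous.prodMk_right p).continuousAt.eventually
      (lowerSemicontinuous_lintegral_prodMk hW (p, ρ) a ha))
    fun C hC => (lowerSemicontinuous_iInf_couplingSet hk hW hC).measurable
  obtain ⟨g, hg, hsep⟩ := exists_separating_seq (∀ i, E i)
  obtain ⟨s, hs, hsm⟩ := hA.exists_selection hg hsep
  refine ⟨⟨fun p => s p, measurable_toMeasure_of_measurableSet_preimage hsm⟩,
    ⟨fun p => inferInstanceAs (IsProbabilityMeasure (s p : Measure (∀ i, E i)))⟩,
    fun p => mem_couplings_iff.2 (hs p).1, fun p => ?_⟩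
  rw [transportValue_eq_iInf_couplingSet]
  exact le_antisymm (le_iInf₂ (hs p).2) (iInf₂_le (f := fun ρ (_ : ρ ∈ couplingSet k p) =>
      ∫⁻ y, W (p, y) ∂(ρ : Measure (∀ i, E i))) (s p) (hs p).1)

end OneStep

/-! ### Prefixes and disintegrations -/

section PrefixBasics

variable {T : ℕ} {Ω : Fin T → Type u} {t : Fin T}

/-- `ω_{1:t+1} ↦ ω_{1:t}`. -/
def Prefix.init (p : Prefix Ω t.succ) : Prefix Ω t.castSucc :=
  Fin.init (α := fun s : Fin ((t : ℕ) + 1) => Ω (s.castLE t.succ.is_le)) p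

/-- `ω_{1:t+1} ↦ ω_{t+1}`. -/
def Prefix.final (p : Prefix Ω t.succ) : Ω t :=
  p (Fin.last (t : ℕ))

theorem Prefix.append_init_final (p : Prefix Ω t.succ) : p.init.append p.final = p :=
  Fin.snoc_init_self (α := fun s : Fin ((t : ℕ) + 1) => Ω (s.castLE t.succ.is_le)) p

theorem Prefix.init_append (p : Prefix Ω t.castSucc) (y : Ω t) : (p.append y).init = p :=
  Fin.init_snoc (α := fun s : Fin ((t : ℕ) + 1) => Ω (s.castLE t.succ.is_le)) y p

theorem Prefix.final_append (p : Prefix Ω t.castSucc) (y : Ω t) : (p.append y).final = y :=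
  Fin.snoc_last (α := fun s : Fin ((t : ℕ) + 1) => Ω (s.castLE t.succ.is_le)) y p

theorem toPrefix_succ (ω : ∀ s, Ω s) :
    toPrefix Ω t.succ ω = (toPrefix Ω t.castSucc ω).append (ω t) :=
  (Prefix.append_init_final (toPrefix Ω t.succ ω)).symm

variable [∀ s, MeasurableSpace (Ω s)]

@[fun_prop]
theorem measurable_toPrefix (t : Fin (T + 1)) : Measurable (toPrefix Ω t) :=
  measurable_pi_lambda _ fun _ => measurable_pi_apply _

theorem Prefix.measurable_toPath : Measurable (Prefix.toPath : Prefix Ω (Fin.last T) → _) :=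
  measurable_pi_lambda _ fun _ => measurable_pi_apply _

theorem Prefix.measurable_init : Measurable (Prefix.init : Prefix Ω t.succ → _) :=
  measurable_pi_lambda _ fun _ => measurable_pi_apply _

theorem Prefix.measurable_final : Measurable (Prefix.final : Prefix Ω t.succ → _) :=
  measurable_pi_apply _

theorem Prefix.measurable_append :
    Measurable fun q : Prefix Ω t.castSucc × Ω t => q.1.append q.2 := by
  refine measurable_pi_lambda _ fun s => ?_
  refine Fin.lastCases (motive := fun s : Fin ((t : ℕ) + 1) =>
    Measurable fun q : Prefix Ω t.castSucc × Ω t => q.1.append q.2 s) ?_ (fun s => ?_) s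
  · simpa only [Prefix.append, Fin.snoc_last] using! measurable_snd
  · simpa only [Prefix.append, Fin.snoc_castSucc] using! (measurable_pi_apply s).comp measurable_fst

end PrefixBasics

section Continuity

variable {T : ℕ} {Ω : Fin T → Type u} {t : Fin T} [∀ s, TopologicalSpace (Ω s)]

theorem continuous_toPrefix (t : Fin (T + 1)) : Continuous (toPrefix Ω t) :=
  continuous_pi fun _ => continuous_apply _

theorem Prefix.continuous_append :
    Continuous fun q : Prefix Ω t.castSucc × Ω t => q.1.append q.2 := by
  refine continuous_pi fun s => ?_
  refine Fin.lastCases (motive := fun s : Fin ((t : ℕ) + 1) =>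
    Continuous fun q : Prefix Ω t.castSucc × Ω t => q.1.append q.2 s) ?_ (fun s => ?_) s
  · simpa only [Prefix.append, Fin.snoc_last] using! continuous_snd
  · simpa only [Prefix.append, Fin.snoc_castSucc] using! (continuous_apply s).comp continuous_fst

end Continuity

/-! ### Laws of prefixes and successive kernels -/

section Disintegration

variable {T : ℕ} {Ω : Fin T → Type u} [∀ s, MeasurableSpace (Ω s)]
  {κ : ∀ t : Fin T, Kernel (Prefix Ω t.castSucc) (Ω t)}

theorem IsDisintegration.map_toPrefix_succ {P : Measure (∀ t, Ω t)} (h : IsDisintegration P κ)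
    (t : Fin T) : P.map (toPrefix Ω t.succ) =
      ((P.map (toPrefix Ω t.castSucc)) ⊗ₘ (κ t)).map fun q => q.1.append q.2 := by
  rw [← h.law_eq t, Measure.map_map Prefix.measurable_append
    ((measurable_toPrefix _).prodMk (measurable_pi_apply t))]
  exact congrArg (fun f => P.map f) (funext toPrefix_succ)

theorem IsDisintegration.lintegral_toPrefix_succ {P : Measure (∀ t, Ω t)} [IsFiniteMeasure P]
    (h : IsDisintegration P κ) {t : Fin T} {f : Prefix Ω t.castSucc → Ω t → ℝ≥0∞}
    (hf : Measurable (Function.uncurry f)) :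
    ∫⁻ ω, f (toPrefix Ω t.castSucc ω) (ω t) ∂P =
      ∫⁻ ω, ∫⁻ y, f (toPrefix Ω t.castSucc ω) y ∂(κ t (toPrefix Ω t.castSucc ω)) ∂P := by
  have := h.markov t
  have h1 : ∫⁻ q, Function.uncurry f q ∂(P.map fun ω => (toPrefix Ω t.castSucc ω, ω t)) =
      ∫⁻ ω, f (toPrefix Ω t.castSucc ω) (ω t) ∂P :=
    lintegral_map hf ((measurable_toPrefix _).prodMk (measurable_pi_apply t))
  rw [← h1, h.law_eq t, Measure.lintegral_compProd hf,
    lintegral_map hf.lintegral_kernel_prod_right' (measurable_toPrefix _)]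
  rfl

/-- The law of `ω_{1:t}` built from the kernels. -/
def prefixLaw (κ : ∀ t : Fin T, Kernel (Prefix Ω t.castSucc) (Ω t)) (t : Fin (T + 1)) :
    Measure (Prefix Ω t) :=
  Fin.induction (motive := fun t => Measure (Prefix Ω t)) (Measure.dirac fun s => s.elim0)
    (fun t μ => (μ ⊗ₘ κ t).map fun q => q.1.append q.2) t

theorem prefixLaw_succ (t : Fin T) :
    prefixLaw κ t.succ = (prefixLaw κ t.castSucc ⊗ₘ κ t).map fun q => q.1.append q.2 :=
  Fin.induction_succ ..

theorem isProbabilityMeasure_prefixLaw (h : ∀ t, IsMarkovKernel (κ t)) (t : Fin (T + 1)) :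
    IsProbabilityMeasure (prefixLaw κ t) := by
  induction t using Fin.induction with
  | zero =>
    change IsProbabilityMeasure (Measure.dirac _)
    infer_instance
  | succ t ih =>
    have := h t
    rw [prefixLaw_succ]
    exact Measure.isProbabilityMeasure_map Prefix.measurable_append.aemeasurable

theorem IsDisintegration.map_toPrefix {P : Measure (∀ t, Ω t)} [IsProbabilityMeasure P]
    (h : IsDisintegration P κ) (t : Fin (T + 1)) : P.map (toPrefix Ω t) = prefixLaw κ t := by
  induction t using Fin.induction with
  | zero =>
    have : toPrefix Ω 0 = fun _ => (fun s : Fin ((0 : Fin (T + 1)) : ℕ) => s.elim0) := by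
      ext ω s
      exact s.elim0
    rw [this, Measure.map_const, measure_univ, one_smul]
    rfl
  | succ t ih => rw [h.map_toPrefix_succ, ih, prefixLaw_succ]

/-- A probability measure is determined by the kernels of its disintegration. -/
theorem IsDisintegration.unique {P P' : Measure (∀ t, Ω t)} [IsProbabilityMeasure P]
    [IsProbabilityMeasure P'] (h : IsDisintegration P κ) (h' : IsDisintegration P' κ) : P = P' := by
  have key : ∀ Q : Measure (∀ t, Ω t), Q = (Q.map (toPrefix Ω (Fin.last T))).map Prefix.toPath := by
    intro Q
    rw [Measure.map_map Prefix.measurable_toPath (measurable_toPrefix _)]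
    exact Measure.map_id.symm
  rw [key P, key P', h.map_toPrefix, h'.map_toPrefix]

/-- Kernels can be composed to a probability measure. -/
theorem exists_isDisintegration (h : ∀ t, IsMarkovKernel (κ t)) :
    ∃ P : Measure (∀ t, Ω t), IsProbabilityMeasure P ∧ IsDisintegration P κ := by
  have hprob := isProbabilityMeasure_prefixLaw h
  let P : Measure (∀ t, Ω t) := (prefixLaw κ (Fin.last T)).map Prefix.toPath
  -- The measure is defined at the terminal time, so its prefix laws are identified backwards: the
  -- law at $t+1$ gives the joint law of prefix and next state, whose first marginal is the law at
  -- $t$.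
  have hstep : ∀ t : Fin T, P.map (toPrefix Ω t.succ) = prefixLaw κ t.succ →
      P.map (fun ω => (toPrefix Ω t.castSucc ω, ω t)) = prefixLaw κ t.castSucc ⊗ₘ κ t := by
    intro t ht
    have : (fun ω => (toPrefix Ω t.castSucc ω, ω t)) =
        (fun p : Prefix Ω t.succ => (p.init, p.final)) ∘ toPrefix Ω t.succ := rfl
    rw [this, ← Measure.map_map (Prefix.measurable_init.prodMk Prefix.measurable_final)
      (measurable_toPrefix _), ht, prefixLaw_succ, Measure.map_map
      (Prefix.measurable_init.prodMk Prefix.measurable_final) Prefix.measurable_append]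
    convert Measure.map_id
    ext1 q
    simp [Prefix.init_append, Prefix.final_append]
  have hmap : ∀ t, P.map (toPrefix Ω t) = prefixLaw κ t := by
    intro t
    induction t using Fin.reverseInduction with
    | last =>
      rw [Measure.map_map (measurable_toPrefix _) Prefix.measurable_toPath]
      exact Measure.map_id
    | cast t ih =>
      have := h t
      have h1 := congrArg Measure.fst (hstep t ih)
      rw [Measure.fst_compProd, Measure.fst, Measure.map_map measurable_fst
        ((measurable_toPrefix _).prodMk (measurable_pi_apply t))] at h1
      exact h1
  refine ⟨P, Measure.isProbabilityMeasure_map Prefix.measurable_toPath.aemeasurable, h,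
    fun t => ?_⟩
  rw [hstep t (hmap _), hmap]

/-- A probability measure on a product of standard Borel spaces has a disintegration. -/
theorem exists_isDisintegration_of_isProbabilityMeasure [∀ t, StandardBorelSpace (Ω t)]
    (P : Measure (∀ t, Ω t)) [IsProbabilityMeasure P] :
    ∃ κ : ∀ t : Fin T, Kernel (Prefix Ω t.castSucc) (Ω t), IsDisintegration P κ := by
  have : Nonempty (∀ t, Ω t) := nonempty_of_isProbabilityMeasure P
  have : ∀ t, Nonempty (Ω t) := fun t => ⟨this.some t⟩
  refine ⟨fun t => condDistrib (fun ω : ∀ t, Ω t => ω t) (toPrefix Ω t.castSucc) P,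
    fun t => inferInstance, fun t => ?_⟩
  exact (compProd_map_condDistrib (measurable_pi_apply t).aemeasurable).symm

end Disintegration

/-! ### Conditional independence through versions of conditional probabilities -/

section CondIndep

variable {α : Type*} {m' m₁ m₂ mα : MeasurableSpace α} {μ : Measure α} [IsProbabilityMeasure μ]
  {A : Set α} {g : α → ℝ≥0∞}

/-- Here and in the next lemmas, the hypothesis on $g$ says that it is a $[0,\infty]$-valued version
of $\mu(A\mid m')$. This form suits kernels, whose values are extended nonnegative reals. -/
theorem lintegral_ne_top_of_version (h : ∀ C, MeasurableSet[m'] C → μ (A ∩ C) = ∫⁻ x in C, g x ∂μ) :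
    ∫⁻ x, g x ∂μ ≠ ∞ := by
  have := h Set.univ MeasurableSet.univ
  rw [Measure.restrict_univ] at this
  rw [← this]
  exact measure_ne_top _ _

theorem integrable_toReal_of_version (hm' : m' ≤ mα) (hg : Measurable[m'] g)
    (h : ∀ C, MeasurableSet[m'] C → μ (A ∩ C) = ∫⁻ x in C, g x ∂μ) :
    Integrable (fun x => (g x).toReal) μ :=
  integrable_toReal_of_lintegral_ne_top (hg.mono hm' le_rfl).aemeasurable
    (lintegral_ne_top_of_version h)

theorem setIntegral_toReal_of_version (hm' : m' ≤ mα) (hg : Measurable[m'] g)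
    (h : ∀ C, MeasurableSet[m'] C → μ (A ∩ C) = ∫⁻ x in C, g x ∂μ) (D : Set α) :
    ∫ x in D, (g x).toReal ∂μ = (∫⁻ x in D, g x ∂μ).toReal := by
  refine integral_toReal (hg.mono hm' le_rfl).aemeasurable (ae_lt_top (hg.mono hm' le_rfl) ?_)
  exact ((setLIntegral_le_lintegral D g).trans_lt (lintegral_ne_top_of_version h).lt_top).ne

theorem condExp_indicator_eq_of_version (hm' : m' ≤ mα) (hA : MeasurableSet A)
    (hg : Measurable[m'] g) (h : ∀ C, MeasurableSet[m'] C → μ (A ∩ C) = ∫⁻ x in C, g x ∂μ) :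
    (fun x => (g x).toReal) =ᵐ[μ] μ⟦A | m'⟧ := by
  refine ae_eq_condExp_of_forall_setIntegral_eq hm' ((integrable_const 1).indicator hA)
    (fun C _ _ => (integrable_toReal_of_version hm' hg h).integrableOn) (fun C hC _ => ?_)
    (Measurable.ennreal_toReal hg).stronglyMeasurable.aestronglyMeasurable
  rw [setIntegral_toReal_of_version hm' hg h, ← h C hC, integral_indicator hA,
    Measure.restrict_restrict hA]
  simp [Measure.real]

theorem integrable_toReal_mul_indicator (hm' : m' ≤ mα) {D : Set α} (hD : MeasurableSet D)
    (hg : Measurable[m'] g) (h : ∀ C, MeasurableSet[m'] C → μ (A ∩ C) = ∫⁻ x in C, g x ∂μ) :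
    Integrable ((fun x => (g x).toReal) * D.indicator fun _ => (1 : ℝ)) μ := by
  have : (fun x => (g x).toReal) * (D.indicator fun _ => (1 : ℝ)) =
      D.indicator fun x => (g x).toReal := by
    ext x
    by_cases hx : x ∈ D <;> simp [hx]
  rw [this]
  exact (integrable_toReal_of_version hm' hg h).indicator hD

theorem setIntegral_toReal_mul_indicator (hm' : m' ≤ mα) {C D : Set α} (hD : MeasurableSet D)
    (hg : Measurable[m'] g) (h : ∀ C, MeasurableSet[m'] C → μ (A ∩ C) = ∫⁻ x in C, g x ∂μ) :
    ∫ x in C, ((fun x => (g x).toReal) * D.indicator fun _ => (1 : ℝ)) x ∂μ =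
      (∫⁻ x in C ∩ D, g x ∂μ).toReal := by
  have : (fun x => (g x).toReal) * (D.indicator fun _ => (1 : ℝ)) =
      D.indicator fun x => (g x).toReal := by
    ext x
    by_cases hx : x ∈ D <;> simp [hx]
  rw [this, integral_indicator hD, Measure.restrict_restrict hD, Set.inter_comm,
    setIntegral_toReal_of_version hm' hg h]

theorem condExp_toReal_mul_indicator (hm' : m' ≤ mα) (hA : MeasurableSet A) {D : Set α}
    (hD : MeasurableSet D)
    (hg : Measurable[m'] g) (h : ∀ C, MeasurableSet[m'] C → μ (A ∩ C) = ∫⁻ x in C, g x ∂μ) :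
    μ[(fun x => (g x).toReal) * D.indicator fun _ => (1 : ℝ) | m'] =ᵐ[μ] μ⟦A | m'⟧ * μ⟦D | m'⟧ :=
  (condExp_mul_of_stronglyMeasurable_left (Measurable.ennreal_toReal hg).stronglyMeasurable
    (integrable_toReal_mul_indicator hm' hD hg h) ((integrable_const 1).indicator hD)).trans
    ((condExp_indicator_eq_of_version hm' hA hg h).mul .rfl)

variable [StandardBorelSpace α]

/-- The function $g$ is a version of $\mu(A\mid m_2)$ that is already measurable for the smaller
$m'$. So it is also $\mu(A\mid m')$, and taking the conditional expectation of $g\,1_D$ gives the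
product formula. -/
theorem condIndep_of_forall_exists_version (hm' : m' ≤ mα) (hm₁ : m₁ ≤ mα) (hm₂ : m₂ ≤ mα)
    (hle : m' ≤ m₂)
    (H : ∀ A, MeasurableSet[m₁] A → ∃ g : α → ℝ≥0∞, Measurable[m'] g ∧
      ∀ D, MeasurableSet[m₂] D → μ (A ∩ D) = ∫⁻ x in D, g x ∂μ) :
    CondIndep m' m₁ m₂ hm' μ := by
  rw [condIndep_iff m' m₁ m₂ hm' hm₁ hm₂]
  intro A D hA hD
  obtain ⟨g, hg, h⟩ := H A hA
  have h' : ∀ C, MeasurableSet[m'] C → μ (A ∩ C) = ∫⁻ x in C, g x ∂μ := fun C hC => h C (hle C hC)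
  have hAm := hm₁ A hA
  have hDm := hm₂ D hD
  refine (Filter.EventuallyEq.symm ?_).trans (condExp_toReal_mul_indicator hm' hAm hDm hg h')
  refine ae_eq_condExp_of_forall_setIntegral_eq hm' ((integrable_const 1).indicator (hAm.inter hDm))
    (fun C _ _ => integrable_condExp.integrableOn) (fun C hC _ => ?_)
    stronglyMeasurable_condExp.aestronglyMeasurable
  rw [setIntegral_condExp hm' (integrable_toReal_mul_indicator hm' hDm hg h') hC,
    setIntegral_toReal_mul_indicator hm' hDm hg h', ← h _ ((hle C hC).inter hD),
    integral_indicator (hAm.inter hDm), Measure.restrict_restrict (hAm.inter hDm)]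
  rw [setIntegral_const, smul_eq_mul, mul_one, Measure.real, Set.inter_comm C D, Set.inter_assoc]

/-- Conversely, conditional independence extends the defining identity of a version of $\mu(A\mid
m')$ from sets of $m'$ to sets $C\cap D$ with $D\in m_2$. It suffices to integrate the product
formula over $C$. -/
theorem measure_inter_eq_of_condIndep (hm' : m' ≤ mα) (hm₁ : m₁ ≤ mα) (hm₂ : m₂ ≤ mα)
    (hci : CondIndep m' m₁ m₂ hm' μ) (hA : MeasurableSet[m₁] A) (hg : Measurable[m'] g)
    (h : ∀ C, MeasurableSet[m'] C → μ (A ∩ C) = ∫⁻ x in C, g x ∂μ)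
    {C D : Set α} (hC : MeasurableSet[m'] C) (hD : MeasurableSet[m₂] D) :
    μ (A ∩ (C ∩ D)) = ∫⁻ x in C ∩ D, g x ∂μ := by
  rw [condIndep_iff m' m₁ m₂ hm' hm₁ hm₂] at hci
  have hAm := hm₁ A hA
  have hDm := hm₂ D hD
  have hfin : ∫⁻ x in C ∩ D, g x ∂μ ≠ ∞ :=
    ((setLIntegral_le_lintegral _ g).trans_lt (lintegral_ne_top_of_version h).lt_top).ne
  rw [← ENNReal.toReal_eq_toReal_iff' (measure_ne_top _ _) hfin,
    ← setIntegral_toReal_mul_indicator hm' hDm hg h,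
    ← setIntegral_condExp hm' (integrable_toReal_mul_indicator hm' hDm hg h) hC,
    setIntegral_congr_ae (hm' C hC) (g := μ⟦A ∩ D | m'⟧)
      (((condExp_toReal_mul_indicator hm' hAm hDm hg h).trans (hci A D hA hD).symm).mono
        fun x hx _ => hx),
    setIntegral_condExp hm' ((integrable_const 1).indicator (hAm.inter hDm)) hC,
    integral_indicator (hAm.inter hDm), Measure.restrict_restrict (hAm.inter hDm)]
  rw [setIntegral_const, smul_eq_mul, mul_one, Measure.real, Set.inter_comm C D, Set.inter_assoc]

/-- Supplies the case $t=0$, absent from the definitions of causality but needed for the first step.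
-/
theorem condIndep_of_le_right (hm' : m' ≤ mα) (hm₁ : m₁ ≤ mα) (hle : m₂ ≤ m') :
    CondIndep m' m₁ m₂ hm' μ := by
  refine condIndep_of_condIndep_of_le_right (m₂ := m')
    (condIndep_of_forall_exists_version hm' hm₁ hm' le_rfl fun A hA => ?_) hle
  refine ⟨fun x => ENNReal.ofReal ((μ⟦A | m'⟧) x),
    stronglyMeasurable_condExp.measurable.ennreal_ofReal, fun D hD => ?_⟩
  have hAm := hm₁ A hA
  rw [← ofReal_integral_eq_lintegral_ofReal integrable_condExp.integrableOn
    (ae_restrict_of_ae (condExp_nonneg (ae_of_all _ fun x =>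
      Set.indicator_nonneg (fun _ _ => zero_le_one) x))),
    setIntegral_condExp hm' ((integrable_const 1).indicator hAm) hD,
    integral_indicator hAm, Measure.restrict_restrict hAm]
  simp

end CondIndep

/-! ### Stepwise couplings -/

section Stepwise

variable {T N : ℕ} {Ω : Fin N → Fin T → Type u}

/-- `ω̄ ↦ (ω¹_{1:t}, …, ωᴺ_{1:t})`. -/
def prefixes (Ω : Fin N → Fin T → Type u) (t : Fin (T + 1)) (ω : ∀ i t, Ω i t) :
    ∀ i, Prefix (Ω i) t :=
  fun i => toPrefix (Ω i) t (ω i)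

variable [∀ i t, MeasurableSpace (Ω i t)]

@[fun_prop]
theorem measurable_prefixes (t : Fin (T + 1)) : Measurable (prefixes Ω t) :=
  measurable_pi_lambda _ fun i => (measurable_toPrefix t).comp (measurable_pi_apply i)

theorem measurable_prefixes_prodMk (t : Fin T) (i : Fin N) :
    Measurable fun ω : ∀ i t, Ω i t => (prefixes Ω t.castSucc ω, ω i t) :=
  (measurable_prefixes _).prodMk ((measurable_pi_apply t).comp (measurable_pi_apply i))

/-- The kernel `κ i t`, as a kernel on the joint prefixes. -/
def liftKernel (κ : ∀ i, ∀ t : Fin T, Kernel (Prefix (Ω i) t.castSucc) (Ω i t)) (i : Fin N)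
    (t : Fin T) : Kernel (∀ j, Prefix (Ω j) t.castSucc) (Ω i t) :=
  (κ i t).comap (fun z => z i) (measurable_pi_apply i)

/-- Under `π`, the conditional law of `ωⁱ_{t+1}` given `ω̄_{1:t}` is `κ i t ωⁱ_{1:t}`. -/
def IsStepwiseCoupling (κ : ∀ i, ∀ t : Fin T, Kernel (Prefix (Ω i) t.castSucc) (Ω i t))
    (π : Measure (∀ i t, Ω i t)) : Prop :=
  ∀ t i, π.map (fun ω => (prefixes Ω t.castSucc ω, ω i t)) =
    π.map (prefixes Ω t.castSucc) ⊗ₘ liftKernel κ i t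

variable {κ : ∀ i, ∀ t : Fin T, Kernel (Prefix (Ω i) t.castSucc) (Ω i t)}
  {π : Measure (∀ i t, Ω i t)}

theorem isMarkovKernel_liftKernel (hκ : ∀ i t, IsMarkovKernel (κ i t)) (i : Fin N) (t : Fin T) :
    IsMarkovKernel (liftKernel κ i t) := by
  have := hκ i t
  unfold liftKernel
  infer_instance

theorem IsStepwiseCoupling.lintegral [IsFiniteMeasure π] (h : IsStepwiseCoupling κ π)
    (hκ : ∀ i t, IsMarkovKernel (κ i t)) {t : Fin T} {i : Fin N}
    {f : (∀ j, Prefix (Ω j) t.castSucc) → Ω i t → ℝ≥0∞} (hf : Measurable (Function.uncurry f)) :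
    ∫⁻ ω, f (prefixes Ω t.castSucc ω) (ω i t) ∂π =
      ∫⁻ ω, ∫⁻ y, f (prefixes Ω t.castSucc ω) y ∂(κ i t (toPrefix (Ω i) t.castSucc (ω i))) ∂π := by
  have := isMarkovKernel_liftKernel hκ i t
  have h1 : ∫⁻ q, Function.uncurry f q ∂(π.map fun ω => (prefixes Ω t.castSucc ω, ω i t)) =
      ∫⁻ ω, f (prefixes Ω t.castSucc ω) (ω i t) ∂π :=
    lintegral_map hf (measurable_prefixes_prodMk t i)
  rw [← h1, h t i, Measure.lintegral_compProd hf,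
    lintegral_map hf.lintegral_kernel_prod_right' (measurable_prefixes _)]
  rfl

/-- The stepwise identity is applied to functions of the $i$-th past only. The marginals of a
stepwise coupling are therefore determined by the kernels. -/
theorem IsStepwiseCoupling.isDisintegration_map [IsFiniteMeasure π] (h : IsStepwiseCoupling κ π)
    (hκ : ∀ i t, IsMarkovKernel (κ i t)) (i : Fin N) :
    IsDisintegration (π.map fun ω => ω i) (κ i) where
  markov := hκ i
  law_eq t := by
    have := hκ i t
    have hm : Measurable fun ω : ∀ t, Ω i t => (toPrefix (Ω i) t.castSucc ω, ω t) :=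
      (measurable_toPrefix _).prodMk (measurable_pi_apply t)
    rw [Measure.map_map hm (measurable_pi_apply i),
      Measure.map_map (measurable_toPrefix _) (measurable_pi_apply i)]
    refine Measure.ext_of_lintegral _ fun f hf => ?_
    rw [lintegral_map hf (hm.comp (measurable_pi_apply i)), Measure.lintegral_compProd hf,
      lintegral_map hf.lintegral_kernel_prod_right'
        ((measurable_toPrefix _).comp (measurable_pi_apply i))]
    exact h.lintegral hκ (f := fun z y => f (z i, y)) (hf.comp
      (((measurable_pi_apply i).comp measurable_fst).prodMk measurable_snd))

theorem IsStepwiseCoupling.map_eq [IsProbabilityMeasure π] (h : IsStepwiseCoupling κ π)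
    {P : ∀ i, Measure (∀ t, Ω i t)} [∀ i, IsProbabilityMeasure (P i)]
    (hP : ∀ i, IsDisintegration (P i) (κ i)) (i : Fin N) : π.map (fun ω => ω i) = P i := by
  have : IsProbabilityMeasure (π.map fun ω => ω i) :=
    Measure.isProbabilityMeasure_map (measurable_pi_apply i).aemeasurable
  exact (h.isDisintegration_map (fun i => (hP i).markov) i).unique (hP i)

/-- The conditional expectation of a function of `ωⁱ` given `ω̄_{1:t}` is a function of
`ωⁱ_{1:t}`. -/
theorem IsStepwiseCoupling.exists_projection [IsFiniteMeasure π] (h : IsStepwiseCoupling κ π)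
    (hκ : ∀ i t, IsMarkovKernel (κ i t)) {i : Fin N} {f : (∀ t, Ω i t) → ℝ≥0∞}
    (hf : Measurable f) (t : Fin (T + 1)) :
    ∃ g : Prefix (Ω i) t → ℝ≥0∞, Measurable g ∧
      ∀ H : (∀ j, Prefix (Ω j) t) → ℝ≥0∞, Measurable H →
        ∫⁻ ω, f (ω i) * H (prefixes Ω t ω) ∂π =
          ∫⁻ ω, g (toPrefix (Ω i) t (ω i)) * H (prefixes Ω t ω) ∂π := by
  induction t using Fin.reverseInduction with
  | last => exact ⟨fun p => f p.toPath, hf.comp Prefix.measurable_toPath, fun H _ => rfl⟩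
  | cast t ih =>
    obtain ⟨g, hg, hgH⟩ := ih
    have := hκ i t
    have hga : Measurable fun q : Prefix (Ω i) t.castSucc × Ω i t => g (q.1.append q.2) :=
      hg.comp Prefix.measurable_append
    -- Tower property: the projection at time $t+1$ depends only on $\omega^i_{1:t+1}$, and the
    -- stepwise identity integrates out $\omega^i_{t+1}$ with a kernel that sees only
    -- $\omega^i_{1:t}$.
    refine ⟨fun p => ∫⁻ y, g (p.append y) ∂(κ i t p), hga.lintegral_kernel_prod_right',
      fun H hH => ?_⟩
    have hinit : Measurable fun z : ∀ j, Prefix (Ω j) t.succ => fun j => (z j).init :=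
      measurable_pi_lambda _ fun j => Prefix.measurable_init.comp (measurable_pi_apply j)
    refine (hgH (fun z => H fun j => (z j).init) (hH.comp hinit)).trans ?_
    have hF : Measurable (Function.uncurry fun (z : ∀ j, Prefix (Ω j) t.castSucc) (y : Ω i t) =>
        g ((z i).append y) * H z) :=
      (hga.comp (((measurable_pi_apply i).comp measurable_fst).prodMk measurable_snd)).mul
        (hH.comp measurable_fst)
    have h1 := h.lintegral hκ hF
    have h2 : ∀ ω : ∀ i t, Ω i t, ∫⁻ y, g ((prefixes Ω t.castSucc ω i).append y) *
        H (prefixes Ω t.castSucc ω) ∂(κ i t (toPrefix (Ω i) t.castSucc (ω i))) =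
        (∫⁻ y, g ((toPrefix (Ω i) t.castSucc (ω i)).append y)
          ∂(κ i t (toPrefix (Ω i) t.castSucc (ω i)))) * H (prefixes Ω t.castSucc ω) := fun ω =>
      lintegral_mul_const _ (hga.comp measurable_prodMk_left)
    rw [lintegral_congr h2] at h1
    rw [← h1]
    refine lintegral_congr fun ω => ?_
    rw [toPrefix_succ]
    rfl

end Stepwise

/-! ### Multicausal couplings are stepwise couplings -/

section Multicausal

variable {T N : ℕ} {𝒳 : Fin T → Type v} [∀ t, MetricSpace (𝒳 t)] [∀ t, MeasurableSpace (𝒳 t)]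

theorem canonicalFiltration_zero (Ω : Fin T → Type u) [∀ t, MeasurableSpace (Ω t)] :
    canonicalFiltration Ω 0 = ⊥ := by
  have : toPrefix Ω 0 = fun _ => (fun s : Fin ((0 : Fin (T + 1)) : ℕ) => s.elim0) := by
    ext ω s
    exact s.elim0
  rw [canonicalFiltration, this]
  exact MeasurableSpace.comap_const _

theorem prodFiltration_const (𝕏 : Fin N → FilteredProcess.{u} 𝒳) (t : Fin (T + 1)) :
    prodFiltration 𝕏 (fun _ => t) =
      MeasurableSpace.comap (prefixes (fun i => (𝕏 i).Ω) t) MeasurableSpace.pi := by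
  rw [MeasurableSpace.pi, MeasurableSpace.comap_iSup]
  simp only [prodFiltration, FilteredProcess.filtration, canonicalFiltration,
    MeasurableSpace.comap_comp]
  rfl

theorem prodFiltration_single (𝕏 : Fin N → FilteredProcess.{u} 𝒳) (i : Fin N) (t : Fin (T + 1)) :
    prodFiltration 𝕏 (Pi.single i t) =
      MeasurableSpace.comap (fun ω => toPrefix (𝕏 i).Ω t (ω i)) MeasurableSpace.pi := by
  refine le_antisymm (iSup_le fun j => ?_) (le_trans (le_of_eq ?_) (le_iSup _ i))
  · rcases eq_or_ne j i with rfl | hj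
    · rw [Pi.single_eq_same, FilteredProcess.filtration, canonicalFiltration,
        MeasurableSpace.comap_comp]
      rfl
    · rw [Pi.single_eq_of_ne hj, FilteredProcess.filtration, canonicalFiltration_zero,
        MeasurableSpace.comap_bot]
      exact bot_le
  · rw [Pi.single_eq_same, FilteredProcess.filtration, canonicalFiltration,
      MeasurableSpace.comap_comp]
    rfl

theorem prodFiltration_single_le_const (𝕏 : Fin N → FilteredProcess.{u} 𝒳) (i : Fin N)
    (t : Fin (T + 1)) : prodFiltration 𝕏 (Pi.single i t) ≤ prodFiltration 𝕏 (fun _ => t) := by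
  rw [prodFiltration_single, prodFiltration_const]
  have : (fun ω : ProdSpace 𝕏 => toPrefix (𝕏 i).Ω t (ω i)) =
      (fun z => z i) ∘ prefixes (fun i => (𝕏 i).Ω) t := rfl
  rw [this, ← MeasurableSpace.comap_comp]
  exact MeasurableSpace.comap_mono (measurable_pi_apply i).comap_le

variable {𝕏 : Fin N → FilteredProcess.{u} 𝒳}
  {κ : ∀ i, ∀ t : Fin T, Kernel (Prefix (𝕏 i).Ω t.castSucc) ((𝕏 i).Ω t)}

theorem condIndep_of_mem_multicausalCouplings {π : ProbabilityMeasure (ProdSpace 𝕏)}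
    (hπ : π ∈ multicausalCouplings 𝕏) (t : Fin (T + 1)) (i : Fin N) :
    CondIndep (prodFiltration 𝕏 (Pi.single i t))
        (prodFiltration 𝕏 (Pi.single i (Fin.last T))) (prodFiltration 𝕏 (fun _ => t))
        (prodFiltration_le 𝕏 _) (π : Measure (ProdSpace 𝕏)) := by
  refine Fin.cases ?_ (fun t => hπ.2 t i) t
  refine condIndep_of_le_right _ (prodFiltration_le 𝕏 _) ?_
  refine iSup_le fun j => ?_
  rw [FilteredProcess.filtration, canonicalFiltration_zero, MeasurableSpace.comap_bot]
  exact bot_le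

/-- By the disintegration of $\mathbb P^i$, the kernel is a version of the conditional probability
of $\{\omega^i_{t+1}\in B\}$ given the own past $\omega^i_{1:t}$. Multicausality upgrades it to a
version given the joint past. -/
theorem isStepwiseCoupling_of_mem_multicausalCouplings
    (hκ : ∀ i, IsDisintegration (𝕏 i).P (κ i)) {π : ProbabilityMeasure (ProdSpace 𝕏)}
    (hπ : π ∈ multicausalCouplings 𝕏) :
    IsStepwiseCoupling (Ω := fun i => (𝕏 i).Ω) κ (π : Measure (ProdSpace 𝕏)) := by
  intro t i
  have hmk := (hκ i).markov t
  have := isMarkovKernel_liftKernel (Ω := fun i => (𝕏 i).Ω) (fun i => (hκ i).markov) i t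
  rw [Measure.ext_prod_iff]
  intro D B hD hB
  rw [Measure.map_apply (measurable_prefixes_prodMk (Ω := fun i => (𝕏 i).Ω) t i) (hD.prod hB),
    Measure.compProd_apply_prod hD hB,
    setLIntegral_map hD (Kernel.measurable_coe _ hB) (measurable_prefixes _)]
  have hA : MeasurableSet[prodFiltration 𝕏 (Pi.single i (Fin.last T))]
      {ω : ProdSpace 𝕏 | ω i t ∈ B} := by
    rw [prodFiltration_single]
    exact ⟨{p | p t ∈ B}, (measurable_pi_apply t) hB, rfl⟩
  have hg : Measurable[prodFiltration 𝕏 (Pi.single i t.castSucc)]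
      fun ω : ProdSpace 𝕏 => κ i t (toPrefix (𝕏 i).Ω t.castSucc (ω i)) B := by
    rw [prodFiltration_single]
    exact (Kernel.measurable_coe (κ i t) hB).comp (comap_measurable _)
  have key := measure_inter_eq_of_condIndep (prodFiltration_le 𝕏 _) (prodFiltration_le 𝕏 _)
    (prodFiltration_le 𝕏 _) (condIndep_of_mem_multicausalCouplings hπ t.castSucc i) hA hg ?_
    MeasurableSet.univ (D := prefixes (fun i => (𝕏 i).Ω) t.castSucc ⁻¹' D)
    (by rw [prodFiltration_const]; exact ⟨D, hD, rfl⟩)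
  · rw [Set.univ_inter, Set.inter_comm] at key
    exact key
  · rw [prodFiltration_single]
    rintro _ ⟨C, hC, rfl⟩
    have hP : (π : Measure (ProdSpace 𝕏)).map (fun ω => ω i) = (𝕏 i).P := hπ.1.2 i
    have hset : MeasurableSet {ω : ∀ t, (𝕏 i).Ω t | ω t ∈ B} := (measurable_pi_apply t) hB
    have hset' : MeasurableSet (toPrefix (𝕏 i).Ω t.castSucc ⁻¹' C) := measurable_toPrefix _ hC
    have h1 : (π : Measure (ProdSpace 𝕏)) ({ω : ProdSpace 𝕏 | ω i t ∈ B} ∩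
        (fun ω => toPrefix (𝕏 i).Ω t.castSucc (ω i)) ⁻¹' C) =
        (𝕏 i).P ({ω | ω t ∈ B} ∩ toPrefix (𝕏 i).Ω t.castSucc ⁻¹' C) := by
      rw [← hP, Measure.map_apply (measurable_pi_apply i) (hset.inter hset')]
      rfl
    have h2 : ∫⁻ ω in (fun ω => toPrefix (𝕏 i).Ω t.castSucc (ω i)) ⁻¹' C,
          κ i t (toPrefix (𝕏 i).Ω t.castSucc (ω i)) B ∂(π : Measure (ProdSpace 𝕏)) =
        ∫⁻ ω in toPrefix (𝕏 i).Ω t.castSucc ⁻¹' C, κ i t (toPrefix (𝕏 i).Ω t.castSucc ω) B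
          ∂(𝕏 i).P := by
      rw [← hP]
      exact (setLIntegral_map (g := fun ω : ProdSpace 𝕏 => ω i) hset'
        ((Kernel.measurable_coe (κ i t) hB).comp (measurable_toPrefix _))
        (measurable_pi_apply i)).symm
    have h3 := congrArg (fun m => m (C ×ˢ B)) ((hκ i).law_eq t)
    simp only at h3
    rw [Measure.map_apply ((measurable_toPrefix _).prodMk (measurable_pi_apply t)) (hC.prod hB),
      Measure.compProd_apply_prod hC hB,
      setLIntegral_map hC (Kernel.measurable_coe _ hB) (measurable_toPrefix _)] at h3
    rw [h1, h2, ← h3, Set.inter_comm]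
    rfl

/-- The projection lemma supplies, for each event of the whole path $\omega^i$, a conditional
probability given the joint past that depends only on $\omega^i_{1:t}$. -/
theorem mem_multicausalCouplings_of_isStepwiseCoupling
    (hκ : ∀ i, IsDisintegration (𝕏 i).P (κ i)) {π : ProbabilityMeasure (ProdSpace 𝕏)}
    (hπ : IsStepwiseCoupling (Ω := fun i => (𝕏 i).Ω) κ (π : Measure (ProdSpace 𝕏))) :
    π ∈ multicausalCouplings 𝕏 := by
  refine ⟨⟨inferInstance, hπ.map_eq hκ⟩, fun t i => ?_⟩
  refine condIndep_of_forall_exists_version (prodFiltration_le 𝕏 _) (prodFiltration_le 𝕏 _)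
    (prodFiltration_le 𝕏 _) (prodFiltration_single_le_const 𝕏 i t.succ) ?_
  rw [prodFiltration_single, prodFiltration_single, prodFiltration_const]
  rintro _ ⟨A, hA, rfl⟩
  obtain ⟨g, hg, h⟩ := hπ.exists_projection (fun i => (hκ i).markov)
    (f := A.indicator fun _ => 1) (measurable_const.indicator hA) t.succ
  refine ⟨fun ω => g (toPrefix (𝕏 i).Ω t.succ (ω i)), hg.comp (comap_measurable _), ?_⟩
  rintro _ ⟨D, hD, rfl⟩
  have hD' : MeasurableSet (prefixes (fun i => (𝕏 i).Ω) t.succ ⁻¹' D) := measurable_prefixes _ hD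
  have hA' : MeasurableSet ((fun ω : ProdSpace 𝕏 => toPrefix (𝕏 i).Ω (Fin.last T) (ω i)) ⁻¹' A) :=
    ((measurable_toPrefix _).comp (measurable_pi_apply i)) hA
  have := h (D.indicator fun _ => 1) (measurable_const.indicator hD)
  rw [← lintegral_indicator hD', ← setLIntegral_one, ← lintegral_indicator (hA'.inter hD')]
  refine Eq.trans (lintegral_congr fun ω => ?_) (this.trans (lintegral_congr fun ω => ?_))
  · have h1 : ω i ∈ A ↔ toPrefix (𝕏 i).Ω (Fin.last T) (ω i) ∈ A := Iff.rfl
    by_cases h2 : prefixes (fun i => (𝕏 i).Ω) t.succ ω ∈ D <;>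
      by_cases h3 : toPrefix (𝕏 i).Ω (Fin.last T) (ω i) ∈ A <;>
      simp [Set.indicator, h1, h2, h3]
  · by_cases h2 : prefixes (fun i => (𝕏 i).Ω) t.succ ω ∈ D <;> simp [Set.indicator, h2]

end Multicausal

/-! ### Joint disintegrations -/

section Joint

variable {T N : ℕ} {Ω : Fin N → Fin T → Type u}

/-- The joint state space at one time. -/
abbrev StateAt (Ω : Fin N → Fin T → Type u) (t : Fin T) : Type u :=
  ∀ i, Ω i t

/-- Exchanging the order of process index and time. -/
def timeMajor (ω : ∀ i t, Ω i t) : ∀ t, StateAt Ω t :=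
  fun t i => ω i t

/-- `ω̄_{1:t} ↦ ωⁱ_{1:t}`. -/
def Prefix.component {t : Fin (T + 1)} (p : Prefix (StateAt Ω) t) (i : Fin N) : Prefix (Ω i) t :=
  fun s => p s i

variable [∀ i t, MeasurableSpace (Ω i t)]

theorem measurable_timeMajor : Measurable (timeMajor : (∀ i t, Ω i t) → _) :=
  measurable_pi_lambda _ fun t => measurable_pi_lambda _ fun i =>
    (measurable_pi_apply t).comp (measurable_pi_apply i)

theorem Prefix.measurable_component (t : Fin (T + 1)) (i : Fin N) :
    Measurable fun p : Prefix (StateAt Ω) t => p.component i :=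
  measurable_pi_lambda _ fun s => (measurable_pi_apply i).comp (measurable_pi_apply s)

variable {κ : ∀ i, ∀ t : Fin T, Kernel (Prefix (Ω i) t.castSucc) (Ω i t)}
  {K : ∀ t : Fin T, Kernel (Prefix (StateAt Ω) t.castSucc) (StateAt Ω t)}
  {π : Measure (∀ i t, Ω i t)}

/-- The one-step couplings given a joint prefix. -/
def kernelCouplings (κ : ∀ i, ∀ t : Fin T, Kernel (Prefix (Ω i) t.castSucc) (Ω i t)) (t : Fin T)
    (p : Prefix (StateAt Ω) t.castSucc) : Set (Measure (StateAt Ω t)) :=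
  couplings fun i => κ i t (p.component i)

theorem IsDisintegration.lintegral_timeMajor [IsFiniteMeasure π]
    (hK : IsDisintegration (π.map timeMajor) K) {t : Fin T}
    {f : Prefix (StateAt Ω) t.castSucc → StateAt Ω t → ℝ≥0∞}
    (hf : Measurable (Function.uncurry f)) :
    ∫⁻ ω, f (toPrefix _ t.castSucc (timeMajor ω)) (timeMajor ω t) ∂π =
      ∫⁻ ω, ∫⁻ y, f (toPrefix _ t.castSucc (timeMajor ω)) y
        ∂(K t (toPrefix _ t.castSucc (timeMajor ω))) ∂π := by
  have := hK.markov t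
  have h := hK.lintegral_toPrefix_succ hf
  have h1 : Measurable fun ω => f (toPrefix (StateAt Ω) t.castSucc ω) (ω t) :=
    hf.comp ((measurable_toPrefix _).prodMk (measurable_pi_apply t))
  have h2 : Measurable fun ω => ∫⁻ y, f (toPrefix (StateAt Ω) t.castSucc ω) y
      ∂(K t (toPrefix (StateAt Ω) t.castSucc ω)) :=
    hf.lintegral_kernel_prod_right'.comp (measurable_toPrefix _)
  rwa [lintegral_map h1 measurable_timeMajor, lintegral_map h2 measurable_timeMajor] at h

theorem isStepwiseCoupling_of_isDisintegration [IsFiniteMeasure π]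
    (hκ : ∀ i t, IsMarkovKernel (κ i t)) (hK : IsDisintegration (π.map timeMajor) K)
    (hc : ∀ t p, K t p ∈ kernelCouplings κ t p) : IsStepwiseCoupling κ π := by
  intro t i
  have := isMarkovKernel_liftKernel hκ i t
  have := hK.markov t
  refine Measure.ext_of_lintegral _ fun f hf => ?_
  rw [lintegral_map hf (measurable_prefixes_prodMk t i), Measure.lintegral_compProd hf,
    lintegral_map hf.lintegral_kernel_prod_right' (measurable_prefixes _)]
  have hcomp : Measurable fun p : Prefix (StateAt Ω) t.castSucc => fun j => p.component j :=
    measurable_pi_lambda _ fun j => Prefix.measurable_component _ j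
  refine (hK.lintegral_timeMajor (f := fun p y => f (fun j => p.component j, y i)) (hf.comp
    ((hcomp.comp measurable_fst).prodMk ((measurable_pi_apply i).comp measurable_snd)))).trans ?_
  refine lintegral_congr fun ω => ?_
  have h := (hc t (toPrefix _ t.castSucc (timeMajor ω))).2 i
  have h' : liftKernel κ i t (prefixes Ω t.castSucc ω) =
      (K t (toPrefix _ t.castSucc (timeMajor ω))).map fun x => x i := h.symm
  have hfω : Measurable fun y => f (prefixes Ω t.castSucc ω, y) := hf.comp measurable_prodMk_left
  rw [h', lintegral_map hfω (measurable_pi_apply i)]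
  rfl

/-- The $i$-th marginal of $K_t$ and the kernel $\kappa^i_t$ both disintegrate the joint law of
$\overline\omega_{1:t}$ and $\omega^i_{t+1}$, so they agree almost everywhere. -/
theorem ae_mem_kernelCouplings [∀ i t, StandardBorelSpace (Ω i t)] [IsFiniteMeasure π]
    (hκ : ∀ i t, IsMarkovKernel (κ i t)) (hK : IsDisintegration (π.map timeMajor) K)
    (hπ : IsStepwiseCoupling κ π) (t : Fin T) :
    ∀ᵐ p ∂((π.map timeMajor).map (toPrefix _ t.castSucc)), K t p ∈ kernelCouplings κ t p := by
  have := hK.markov t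
  have key : ∀ i, (K t).map (fun y => y i) =ᵐ[(π.map timeMajor).map (toPrefix _ t.castSucc)]
      (κ i t).comap (fun p => p.component i) (Prefix.measurable_component _ i) := by
    intro i
    have := hκ i t
    have : IsMarkovKernel ((K t).map fun y : StateAt Ω t => y i) :=
      Kernel.IsMarkovKernel.map _ (measurable_pi_apply i)
    refine Kernel.ae_eq_of_compProd_eq (Measure.ext_of_lintegral _ fun f hf => ?_)
    have hm : Measurable (toPrefix (StateAt Ω) t.castSucc ∘ timeMajor) :=
      (measurable_toPrefix _).comp measurable_timeMajor
    rw [Measure.lintegral_compProd hf, Measure.lintegral_compProd hf,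
      Measure.map_map (measurable_toPrefix _) measurable_timeMajor,
      lintegral_map hf.lintegral_kernel_prod_right' hm,
      lintegral_map hf.lintegral_kernel_prod_right' hm]
    have hjoin : Measurable fun z : ∀ j, Prefix (Ω j) t.castSucc =>
        (fun s j => z j s : Prefix (StateAt Ω) t.castSucc) :=
      measurable_pi_lambda _ fun s => measurable_pi_lambda _ fun j =>
        (measurable_pi_apply s).comp (measurable_pi_apply j)
    have h1 := hπ.lintegral hκ (t := t) (i := i)
      (f := fun z y => f ((fun s j => z j s : Prefix (StateAt Ω) t.castSucc), y))
      (hf.comp ((hjoin.comp measurable_fst).prodMk measurable_snd))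
    have h2 := hK.lintegral_timeMajor (t := t) (f := fun p y => f (p, y i))
      (hf.comp (measurable_fst.prodMk ((measurable_pi_apply i).comp measurable_snd)))
    refine Eq.trans (lintegral_congr fun ω => ?_) (h2.symm.trans h1)
    have hfω : Measurable fun y => f (toPrefix (StateAt Ω) t.castSucc (timeMajor ω), y) :=
      hf.comp measurable_prodMk_left
    rw [Kernel.map_apply _ (measurable_pi_apply i)]
    exact lintegral_map hfω (measurable_pi_apply i)
  filter_upwards [ae_all_iff.2 key] with p hp
  refine ⟨(hK.markov t).isProbabilityMeasure p, fun i => ?_⟩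
  have := hp i
  rwa [Kernel.map_apply _ (measurable_pi_apply i)] at this

end Joint

/-! ### Dynamic programming -/

section DynamicProgramming

variable {T N : ℕ} {Ω : Fin N → Fin T → Type u} [∀ i t, MeasurableSpace (Ω i t)]

/-- The value process of a nonnegative cost. -/
def costToGo (c : (∀ i t, Ω i t) → ℝ≥0∞)
    (κ : ∀ i, ∀ t : Fin T, Kernel (Prefix (Ω i) t.castSucc) (Ω i t)) (t : Fin (T + 1)) :
    Prefix (StateAt Ω) t → ℝ≥0∞ :=
  Fin.reverseInduction (motive := fun t => Prefix (StateAt Ω) t → ℝ≥0∞)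
    (fun p => c fun i s => p.toPath s i)
    (fun t W p => ⨅ ρ ∈ kernelCouplings κ t p, ∫⁻ y, W (p.append y) ∂ρ) t

variable {c : (∀ i t, Ω i t) → ℝ≥0∞}
  {κ : ∀ i, ∀ t : Fin T, Kernel (Prefix (Ω i) t.castSucc) (Ω i t)}

theorem costToGo_last : costToGo c κ (Fin.last T) = fun p => c fun i s => p.toPath s i :=
  Fin.reverseInduction_last ..

theorem costToGo_castSucc (t : Fin T) :
    costToGo c κ t.castSucc = fun p => ⨅ ρ ∈ kernelCouplings κ t p,
      ∫⁻ y, costToGo c κ t.succ (p.append y) ∂ρ :=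
  Fin.reverseInduction_castSucc ..

theorem costToGo_castSucc_le {t : Fin T} {p : Prefix (StateAt Ω) t.castSucc}
    {ρ : Measure (StateAt Ω t)} (hρ : ρ ∈ kernelCouplings κ t p) :
    costToGo c κ t.castSucc p ≤ ∫⁻ y, costToGo c κ t.succ (p.append y) ∂ρ := by
  rw [costToGo_castSucc]
  exact iInf₂_le (f := fun ρ (_ : ρ ∈ kernelCouplings κ t p) =>
    ∫⁻ y, costToGo c κ t.succ (p.append y) ∂ρ) ρ hρ

variable [∀ i t, TopologicalSpace (Ω i t)] [∀ i t, PolishSpace (Ω i t)]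
  [∀ i t, BorelSpace (Ω i t)] {P : ∀ i, Measure (∀ t, Ω i t)}

theorem exists_continuous_kernel (hκ : ∀ i, IsContinuousDisintegration (P i) (κ i)) (t : Fin T) :
    ∃ k : ∀ i, Prefix (StateAt Ω) t.castSucc → ProbabilityMeasure (Ω i t),
      (∀ i, Continuous (k i)) ∧ ∀ i p, (k i p : Measure (Ω i t)) = κ i t (p.component i) := by
  refine ⟨fun i p => ⟨κ i t (p.component i), ((hκ i).markov t).isProbabilityMeasure _⟩,
    fun i => ?_, fun i p => rfl⟩
  have : Continuous fun p : Prefix (StateAt Ω) t.castSucc => p.component i :=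
    continuous_pi fun s => (continuous_apply i).comp (continuous_apply s)
  exact ((hκ i).continuous t).comp this

/-- Each backward step is a transport problem whose marginals depend continuously on the prefix, and
such problems preserve lower semicontinuity. -/
theorem lowerSemicontinuous_costToGo (hκ : ∀ i, IsContinuousDisintegration (P i) (κ i))
    (hc : LowerSemicontinuous c) (t : Fin (T + 1)) : LowerSemicontinuous (costToGo c κ t) := by
  induction t using Fin.reverseInduction with
  | last =>
    rw [costToGo_last]
    have : Continuous fun p : Prefix (StateAt Ω) (Fin.last T) => fun i s => p.toPath s i :=
      continuous_pi fun i => continuous_pi fun s => (continuous_apply i).comp (continuous_apply s)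
    intro p a ha
    exact this.continuousAt.eventually (hc _ a ha)
  | cast t ih =>
    obtain ⟨k, hk, hkκ⟩ := exists_continuous_kernel hκ t
    have hW : LowerSemicontinuous fun q : Prefix (StateAt Ω) t.castSucc × StateAt Ω t =>
        costToGo c κ t.succ (q.1.append q.2) := by
      intro q a ha
      exact Prefix.continuous_append.continuousAt.eventually (ih _ a ha)
    convert lowerSemicontinuous_transportValue hk hW using 1
    ext p
    simp only [costToGo_castSucc, transportValue, kernelCouplings, hkκ]

/-- A measurable choice of one-step optimal couplings. -/
theorem exists_optimal_kernels (hκ : ∀ i, IsContinuousDisintegration (P i) (κ i))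
    (hc : LowerSemicontinuous c) :
    ∃ K : ∀ t : Fin T, Kernel (Prefix (StateAt Ω) t.castSucc) (StateAt Ω t),
      (∀ t, IsMarkovKernel (K t)) ∧ (∀ t p, K t p ∈ kernelCouplings κ t p) ∧
      ∀ t p, ∫⁻ y, costToGo c κ t.succ (p.append y) ∂(K t p) = costToGo c κ t.castSucc p := by
  have : ∀ t : Fin T, ∃ K : Kernel (Prefix (StateAt Ω) t.castSucc) (StateAt Ω t),
      IsMarkovKernel K ∧ (∀ p, K p ∈ kernelCouplings κ t p) ∧
      ∀ p, ∫⁻ y, costToGo c κ t.succ (p.append y) ∂(K p) = costToGo c κ t.castSucc p := by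
    intro t
    obtain ⟨k, hk, hkκ⟩ := exists_continuous_kernel hκ t
    have hW : LowerSemicontinuous fun q : Prefix (StateAt Ω) t.castSucc × StateAt Ω t =>
        costToGo c κ t.succ (q.1.append q.2) := by
      intro q a ha
      exact Prefix.continuous_append.continuousAt.eventually
        (lowerSemicontinuous_costToGo hκ hc t.succ _ a ha)
    obtain ⟨K, h1, h2, h3⟩ := exists_optimal_kernel hk hW
    refine ⟨K, h1, fun p => ?_, fun p => (h3 p).trans ?_⟩
    · simpa only [kernelCouplings, hkκ] using h2 p
    · simp only [costToGo_castSucc, transportValue, kernelCouplings, hkκ]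
  choose K h1 h2 h3 using this
  exact ⟨K, h1, h2, h3⟩

variable {π : Measure (∀ i t, Ω i t)}
  {K : ∀ t : Fin T, Kernel (Prefix (StateAt Ω) t.castSucc) (StateAt Ω t)}

/-- The expected value process. -/
def expectedCostToGo (c : (∀ i t, Ω i t) → ℝ≥0∞)
    (κ : ∀ i, ∀ t : Fin T, Kernel (Prefix (Ω i) t.castSucc) (Ω i t)) (π : Measure (∀ i t, Ω i t))
    (t : Fin (T + 1)) : ℝ≥0∞ :=
  ∫⁻ p, costToGo c κ t p ∂((π.map timeMajor).map (toPrefix _ t))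

theorem expectedCostToGo_zero [IsProbabilityMeasure π] :
    expectedCostToGo c κ π 0 = costToGo c κ 0 fun s => s.elim0 := by
  have : IsProbabilityMeasure (π.map timeMajor) :=
    Measure.isProbabilityMeasure_map measurable_timeMajor.aemeasurable
  have : IsProbabilityMeasure ((π.map timeMajor).map (toPrefix (StateAt Ω) 0)) :=
    Measure.isProbabilityMeasure_map (measurable_toPrefix _).aemeasurable
  have h : ∀ p : Prefix (StateAt Ω) 0, costToGo c κ 0 p = costToGo c κ 0 fun s => s.elim0 := by
    intro p
    congr 1
    ext s
    exact s.elim0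
  rw [expectedCostToGo, lintegral_congr h, lintegral_const, measure_univ, mul_one]

theorem expectedCostToGo_last (hc : Measurable c) :
    expectedCostToGo c κ π (Fin.last T) = ∫⁻ ω, c ω ∂π := by
  have hm : Measurable fun p : Prefix (StateAt Ω) (Fin.last T) => c fun i s => p.toPath s i :=
    hc.comp (measurable_pi_lambda _ fun i => measurable_pi_lambda _ fun s =>
      (measurable_pi_apply i).comp (measurable_pi_apply s))
  rw [expectedCostToGo, costToGo_last, Measure.map_map (measurable_toPrefix _) measurable_timeMajor,
    lintegral_map hm ((measurable_toPrefix _).comp measurable_timeMajor)]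
  rfl

theorem expectedCostToGo_succ (hκ : ∀ i, IsContinuousDisintegration (P i) (κ i))
    (hc : LowerSemicontinuous c) [IsFiniteMeasure π]
    (hK : IsDisintegration (π.map timeMajor) K) (t : Fin T) :
    expectedCostToGo c κ π t.succ = ∫⁻ p, ∫⁻ y, costToGo c κ t.succ (p.append y) ∂(K t p)
      ∂((π.map timeMajor).map (toPrefix _ t.castSucc)) := by
  have := hK.markov t
  have hm : Measurable (costToGo c κ t.succ) := (lowerSemicontinuous_costToGo hκ hc _).measurable
  have hm' : Measurable fun q : Prefix (StateAt Ω) t.castSucc × StateAt Ω t =>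
      costToGo c κ t.succ (q.1.append q.2) := hm.comp Prefix.measurable_append
  rw [expectedCostToGo, hK.map_toPrefix_succ, lintegral_map hm Prefix.measurable_append,
    Measure.lintegral_compProd hm']

/-- The kernels of $\pi$ are almost surely admissible in the one-step problems, so averaging the
next value cannot go below the current one: the submartingale property of the value process. -/
theorem monotone_expectedCostToGo (hκ : ∀ i, IsContinuousDisintegration (P i) (κ i))
    (hc : LowerSemicontinuous c) [IsProbabilityMeasure π] (hπ : IsStepwiseCoupling κ π) :
    Monotone (expectedCostToGo c κ π) := by
  have : IsProbabilityMeasure (π.map timeMajor) :=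
    Measure.isProbabilityMeasure_map measurable_timeMajor.aemeasurable
  obtain ⟨K, hK⟩ := exists_isDisintegration_of_isProbabilityMeasure (π.map timeMajor)
  refine Fin.monotone_iff_le_succ.2 fun t => ?_
  rw [expectedCostToGo_succ hκ hc hK]
  refine lintegral_mono_ae ?_
  filter_upwards [ae_mem_kernelCouplings (fun i => (hκ i).markov) hK hπ t] with p hp
  exact costToGo_castSucc_le hp

/-- The value at time zero bounds the cost of each coupling from below. -/
theorem costToGo_zero_le (hκ : ∀ i, IsContinuousDisintegration (P i) (κ i))
    (hc : LowerSemicontinuous c) [IsProbabilityMeasure π] (hπ : IsStepwiseCoupling κ π) :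
    costToGo c κ 0 (fun s => s.elim0) ≤ ∫⁻ ω, c ω ∂π := by
  rw [← expectedCostToGo_zero (π := π), ← expectedCostToGo_last (κ := κ) hc.measurable]
  exact monotone_expectedCostToGo hκ hc hπ (Fin.zero_le _)

/-- Kernels that are one-step optimal attain the value at time zero. -/
theorem lintegral_eq_costToGo_zero (hκ : ∀ i, IsContinuousDisintegration (P i) (κ i))
    (hc : LowerSemicontinuous c) [IsProbabilityMeasure π]
    (hK : IsDisintegration (π.map timeMajor) K)
    (hopt : ∀ t p, ∫⁻ y, costToGo c κ t.succ (p.append y) ∂(K t p) = costToGo c κ t.castSucc p) :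
    ∫⁻ ω, c ω ∂π = costToGo c κ 0 fun s => s.elim0 := by
  rw [← expectedCostToGo_zero (π := π), ← expectedCostToGo_last (κ := κ) hc.measurable]
  have : ∀ t, expectedCostToGo c κ π t = expectedCostToGo c κ π 0 := by
    intro t
    induction t using Fin.induction with
    | zero => rfl
    | succ t ih =>
      rw [← ih, expectedCostToGo_succ hκ hc hK]
      exact lintegral_congr fun p => hopt t p
  exact this _

theorem exists_optimal_coupling (hκ : ∀ i, IsContinuousDisintegration (P i) (κ i))
    (hc : LowerSemicontinuous c) :
    ∃ π : Measure (∀ i t, Ω i t), IsProbabilityMeasure π ∧ IsStepwiseCoupling κ π ∧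
      ∫⁻ ω, c ω ∂π = costToGo c κ 0 fun s => s.elim0 := by
  obtain ⟨K, hK1, hK2, hK3⟩ := exists_optimal_kernels hκ hc
  obtain ⟨Q, hQ, hQK⟩ := exists_isDisintegration hK1
  have hm : Measurable fun (ω : ∀ t, StateAt Ω t) i t => ω t i :=
    measurable_pi_lambda _ fun i => measurable_pi_lambda _ fun t =>
      (measurable_pi_apply i).comp (measurable_pi_apply t)
  have hprob : IsProbabilityMeasure (Q.map fun (ω : ∀ t, StateAt Ω t) i t => ω t i) :=
    Measure.isProbabilityMeasure_map hm.aemeasurable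
  have hQ' : (Q.map fun (ω : ∀ t, StateAt Ω t) i t => ω t i).map timeMajor = Q := by
    rw [Measure.map_map measurable_timeMajor hm]
    exact Measure.map_id
  rw [← hQ'] at hQK
  exact ⟨_, hprob, isStepwiseCoupling_of_isDisintegration (fun i => (hκ i).markov) hQK hK2,
    lintegral_eq_costToGo_zero hκ hc hQK hK3⟩

/-- Optimal couplings of finite cost have kernels that are one-step optimal. -/
theorem exists_optimal_disintegration (hκ : ∀ i, IsContinuousDisintegration (P i) (κ i))
    (hc : LowerSemicontinuous c) [IsProbabilityMeasure π] (hπ : IsStepwiseCoupling κ π)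
    (hopt : ∫⁻ ω, c ω ∂π = costToGo c κ 0 fun s => s.elim0) (hfin : ∫⁻ ω, c ω ∂π ≠ ∞) :
    ∃ K : ∀ t : Fin T, Kernel (Prefix (StateAt Ω) t.castSucc) (StateAt Ω t),
      IsDisintegration (π.map timeMajor) K ∧ (∀ t p, K t p ∈ kernelCouplings κ t p) ∧
      ∀ t p, ∫⁻ y, costToGo c κ t.succ (p.append y) ∂(K t p) = costToGo c κ t.castSucc p := by
  classical
  have : IsProbabilityMeasure (π.map timeMajor) :=
    Measure.isProbabilityMeasure_map measurable_timeMajor.aemeasurable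
  obtain ⟨K, hK⟩ := exists_isDisintegration_of_isProbabilityMeasure (π.map timeMajor)
  obtain ⟨K', hK'1, hK'2, hK'3⟩ := exists_optimal_kernels hκ hc
  rw [← expectedCostToGo_zero (π := π), ← expectedCostToGo_last (κ := κ) hc.measurable] at hopt
  rw [← expectedCostToGo_last (κ := κ) hc.measurable] at hfin
  have hmono := monotone_expectedCostToGo hκ hc hπ
  have hconst : ∀ t, expectedCostToGo c κ π t = expectedCostToGo c κ π (Fin.last T) := fun t =>
    le_antisymm (hmono (Fin.le_last t)) (hopt.le.trans (hmono (Fin.zero_le t)))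
  have hae : ∀ t, ∀ᵐ p ∂((π.map timeMajor).map (toPrefix _ t.castSucc)),
      K t p ∈ kernelCouplings κ t p ∧
        ∫⁻ y, costToGo c κ t.succ (p.append y) ∂(K t p) = costToGo c κ t.castSucc p := by
    intro t
    have := hK.markov t
    have hcpl := ae_mem_kernelCouplings (fun i => (hκ i).markov) hK hπ t
    have hle : ∀ᵐ p ∂((π.map timeMajor).map (toPrefix _ t.castSucc)),
        costToGo c κ t.castSucc p ≤ ∫⁻ y, costToGo c κ t.succ (p.append y) ∂(K t p) :=
      hcpl.mono fun p hp => costToGo_castSucc_le hp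
    have hm : Measurable fun p => ∫⁻ y, costToGo c κ t.succ (p.append y) ∂(K t p) :=
      ((lowerSemicontinuous_costToGo hκ hc _).measurable.comp
        Prefix.measurable_append).lintegral_kernel_prod_right'
    -- Two ordered functions with the same integral agree almost everywhere provided the integral is
    -- finite; this is where finite cost enters.
    have heq := ae_eq_of_ae_le_of_lintegral_le hle
      (by change expectedCostToGo c κ π t.castSucc ≠ ∞; rwa [hconst]) hm.aemeasurable
      (by
        rw [← expectedCostToGo_succ hκ hc hK, hconst, ← hconst t.castSucc]
        exact le_rfl)
    filter_upwards [hcpl, heq] with p h1 h2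
    exact ⟨h1, h2.symm⟩
  -- A measurable null set containing all prefixes at which the kernel fails to be admissible or
  -- optimal. Replacing the kernel there by a selected optimal one leaves the disintegration valid
  -- and gives optimality everywhere.
  let bad : ∀ t : Fin T, Set (Prefix (StateAt Ω) t.castSucc) := fun t =>
    toMeasurable ((π.map timeMajor).map (toPrefix _ t.castSucc))
      {p | ¬ (K t p ∈ kernelCouplings κ t p ∧
        ∫⁻ y, costToGo c κ t.succ (p.append y) ∂(K t p) = costToGo c κ t.castSucc p)}
  have hbad : ∀ t, MeasurableSet (bad t) := fun t => measurableSet_toMeasurable _ _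
  have hgood : ∀ t p, p ∉ bad t → K t p ∈ kernelCouplings κ t p ∧
      ∫⁻ y, costToGo c κ t.succ (p.append y) ∂(K t p) = costToGo c κ t.castSucc p := by
    intro t p hp
    by_contra h
    exact hp (subset_toMeasurable _ _ h)
  refine ⟨fun t => Kernel.piecewise (hbad t) (K' t) (K t), ⟨fun t => ?_, fun t => ?_⟩,
    fun t p => ?_, fun t p => ?_⟩
  · have := hK.markov t
    have := hK'1 t
    infer_instance
  · have := hK.markov t
    have := hK'1 t
    rw [hK.law_eq t]
    refine Measure.compProd_congr ?_
    have h0 : ((π.map timeMajor).map (toPrefix _ t.castSucc)) (bad t) = 0 := by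
      rw [measure_toMeasurable]
      exact hae t
    filter_upwards [compl_mem_ae_iff.2 h0] with p hp
    rw [Kernel.piecewise_apply, if_neg hp]
  · rw [Kernel.piecewise_apply]
    split_ifs with hp
    · exact hK'2 t p
    · exact (hgood t p hp).1
  · rw [Kernel.piecewise_apply]
    split_ifs with hp
    · exact hK'3 t p
    · exact (hgood t p hp).2

end DynamicProgramming

/-! ### Products of kernels -/

section PiKernel

variable {ι : Type*} [Fintype ι] {α β : ι → Type*} [∀ i, MeasurableSpace (α i)]
  [∀ i, MeasurableSpace (β i)]

theorem lintegral_prod_pi {μ : ∀ i, Measure (β i)} [∀ i, IsProbabilityMeasure (μ i)]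
    {f : ∀ i, β i → ℝ≥0∞} (hf : ∀ i, Measurable (f i)) :
    ∫⁻ x, ∏ i, f i (x i) ∂(Measure.pi μ) = ∏ i, ∫⁻ x, f i x ∂(μ i) := by
  have h := lintegral_prod_eq_prod_lintegral_of_indepFun Finset.univ
    (fun i (x : ∀ i, β i) => f i (x i)) (iIndepFun_pi (μ := μ) fun i => (hf i).aemeasurable)
    fun i => (hf i).comp (measurable_pi_apply i)
  rw [h]
  refine Finset.prod_congr rfl fun i _ => ?_
  conv_rhs => rw [← (measurePreserving_eval μ i).map_eq]
  exact (lintegral_map (hf i) (measurable_pi_apply i)).symm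

theorem measurable_measure_pi (G : ∀ i, Kernel (α i) (β i)) [∀ i, IsMarkovKernel (G i)] :
    Measurable fun x : ∀ i, α i => Measure.pi fun i => G i (x i) := by
  refine Measurable.measure_of_isPiSystem_of_isProbabilityMeasure generateFrom_pi.symm isPiSystem_pi
    ?_
  rintro _ ⟨S, hS, rfl⟩
  simp only [Measure.pi_pi]
  exact Finset.measurable_prod _ fun i _ =>
    (Kernel.measurable_coe (G i) (hS i (Set.mem_univ i))).comp (measurable_pi_apply i)

/-- The product of finitely many Markov kernels. -/
def piKernel (G : ∀ i, Kernel (α i) (β i)) [∀ i, IsMarkovKernel (G i)] :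
    Kernel (∀ i, α i) (∀ i, β i) :=
  ⟨fun x => Measure.pi fun i => G i (x i), measurable_measure_pi G⟩

variable (G : ∀ i, Kernel (α i) (β i)) [∀ i, IsMarkovKernel (G i)]

theorem piKernel_apply (x : ∀ i, α i) : piKernel G x = Measure.pi fun i => G i (x i) :=
  rfl

instance : IsMarkovKernel (piKernel G) :=
  ⟨fun x => by rw [piKernel_apply]; infer_instance⟩

theorem map_compProd_piKernel (π : Measure (∀ i, α i)) [IsFiniteMeasure π] (i : ι) :
    (π ⊗ₘ piKernel G).map (fun q => (q.1 i, q.2 i)) = π.map (fun x => x i) ⊗ₘ G i := by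
  have hm : Measurable fun q : (∀ i, α i) × (∀ i, β i) => (q.1 i, q.2 i) :=
    ((measurable_pi_apply i).comp measurable_fst).prodMk
      ((measurable_pi_apply i).comp measurable_snd)
  rw [Measure.ext_prod_iff]
  intro A B hA hB
  rw [Measure.map_apply hm (hA.prod hB), Measure.compProd_apply_prod hA hB,
    setLIntegral_map hA (Kernel.measurable_coe _ hB) (measurable_pi_apply i)]
  have : (fun q : (∀ i, α i) × (∀ i, β i) => (q.1 i, q.2 i)) ⁻¹' (A ×ˢ B) =
      ((fun x => x i) ⁻¹' A) ×ˢ ((fun x => x i) ⁻¹' B) := rfl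
  rw [this, Measure.compProd_apply_prod (measurable_pi_apply i hA) (measurable_pi_apply i hB)]
  refine lintegral_congr fun x => ?_
  rw [piKernel_apply, ← Measure.map_apply (measurable_pi_apply i) hB,
    (measurePreserving_eval (fun i => G i (x i)) i).map_eq]

/-- For a fixed $B$ the masses of $D\times B$ form finite measures in $D$, so the π-system of boxes
determines them. -/
theorem ext_of_pi_prod {F : Type*} [MeasurableSpace F] {μ ν : Measure ((∀ i, β i) × F)}
    [IsFiniteMeasure μ] [IsFiniteMeasure ν]
    (h : ∀ (A : ∀ i, Set (β i)) (B : Set F), (∀ i, MeasurableSet (A i)) → MeasurableSet B →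
      μ (Set.univ.pi A ×ˢ B) = ν (Set.univ.pi A ×ˢ B)) : μ = ν := by
  rw [Measure.ext_prod_iff]
  intro D B hD hB
  have key : ∀ (m : Measure ((∀ i, β i) × F)) {D : Set (∀ i, β i)}, MeasurableSet D →
      (m.restrict (Set.univ ×ˢ B)).map Prod.fst D = m (D ×ˢ B) := by
    intro m D hD
    rw [Measure.map_apply measurable_fst hD, Measure.restrict_apply (measurable_fst hD)]
    congr 1
    ext q
    simp
  rw [← key μ hD, ← key ν hD]
  congr 1
  refine ext_of_generate_finite _ generateFrom_pi.symm isPiSystem_pi ?_ ?_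
  · rintro _ ⟨A, hA, rfl⟩
    have hA' : ∀ i, MeasurableSet (A i) := fun i => hA i (Set.mem_univ i)
    rw [key μ (MeasurableSet.univ_pi hA'), key ν (MeasurableSet.univ_pi hA')]
    exact h A B hA' hB
  · rw [key μ MeasurableSet.univ, key ν MeasurableSet.univ]
    simpa using h (fun _ => Set.univ) B (fun _ => MeasurableSet.univ) hB

end PiKernel

/-! ### Gluing a stepwise coupling with bicausal kernels -/

section Gluing

variable {T N : ℕ} {Ω Ω' : Fin N → Fin T → Type u} [∀ i t, MeasurableSpace (Ω i t)]
  [∀ i t, MeasurableSpace (Ω' i t)]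

theorem lintegral_comp_piKernel {π : Measure (∀ i t, Ω' i t)}
    (G : ∀ i, Kernel (∀ t, Ω' i t) (∀ t, Ω i t)) [∀ i, IsMarkovKernel (G i)]
    {f : ∀ i, (∀ t, Ω i t) → ℝ≥0∞} (hf : ∀ i, Measurable (f i)) :
    ∫⁻ x, ∏ i, f i (x i) ∂(π.bind (piKernel G)) = ∫⁻ y, ∏ i, ∫⁻ x, f i x ∂(G i (y i)) ∂π := by
  have hm : Measurable fun x : ∀ i t, Ω i t => ∏ i, f i (x i) :=
    Finset.measurable_prod _ fun i _ => (hf i).comp (measurable_pi_apply i)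
  rw [Measure.lintegral_bind (piKernel G).measurable.aemeasurable hm.aemeasurable]
  refine lintegral_congr fun y => ?_
  rw [piKernel_apply, lintegral_prod_pi hf]

/-- The hypotheses are the two halves of bicausality: by `hG` the law of the $\Omega_i$-prefix under
$G_i(y)$ depends only on the prefix of $y$, and by `hG'` the kernel $\kappa^i$ remains the
conditional law of the next state once the prefix of $y$ is also known. When tested on a box of
prefixes, the product kernel factorizes: the factors $j\ne i$ become functions of the past of $y$,
and only the $i$-th factor involves the next state. -/
theorem IsStepwiseCoupling.bind_piKernel
    {κ : ∀ i, ∀ t : Fin T, Kernel (Prefix (Ω i) t.castSucc) (Ω i t)}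
    {κ' : ∀ i, ∀ t : Fin T, Kernel (Prefix (Ω' i) t.castSucc) (Ω' i t)}
    (hκ : ∀ i t, IsMarkovKernel (κ i t)) (hκ' : ∀ i t, IsMarkovKernel (κ' i t))
    {π : Measure (∀ i t, Ω' i t)} [IsProbabilityMeasure π] (hπ : IsStepwiseCoupling κ' π)
    (G : ∀ i, Kernel (∀ t, Ω' i t) (∀ t, Ω i t)) [∀ i, IsMarkovKernel (G i)]
    (hG : ∀ i (t : Fin T) (A : Set (Prefix (Ω i) t.castSucc)), MeasurableSet A →
      ∃ H : Prefix (Ω' i) t.castSucc → ℝ≥0∞, Measurable H ∧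
        ∀ᵐ y ∂(π.map fun ω => ω i), G i y (toPrefix (Ω i) t.castSucc ⁻¹' A) =
          H (toPrefix (Ω' i) t.castSucc y))
    (hG' : ∀ i (t : Fin T) (A : Set (Prefix (Ω i) t.castSucc)) (B : Set (Ω i t))
      (C : Set (Prefix (Ω' i) t.castSucc)), MeasurableSet A → MeasurableSet B → MeasurableSet C →
      ∫⁻ y in toPrefix (Ω' i) t.castSucc ⁻¹' C,
          G i y (toPrefix (Ω i) t.castSucc ⁻¹' A ∩ {x | x t ∈ B}) ∂(π.map fun ω => ω i) =
        ∫⁻ y in toPrefix (Ω' i) t.castSucc ⁻¹' C, ∫⁻ x in toPrefix (Ω i) t.castSucc ⁻¹' A,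
          κ i t (toPrefix (Ω i) t.castSucc x) B ∂(G i y) ∂(π.map fun ω => ω i)) :
    IsStepwiseCoupling κ (π.bind (piKernel G)) := by
  intro t i
  have := isMarkovKernel_liftKernel hκ i t
  have : IsProbabilityMeasure (π.bind (piKernel G)) :=
    inferInstanceAs (IsProbabilityMeasure (piKernel G ∘ₘ π))
  have : IsProbabilityMeasure (π.map fun ω => ω i) :=
    Measure.isProbabilityMeasure_map (measurable_pi_apply i).aemeasurable
  refine ext_of_pi_prod fun A B hA hB => ?_
  have hpre : ∀ j, MeasurableSet (toPrefix (Ω j) t.castSucc ⁻¹' A j) := fun j =>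
    measurable_toPrefix _ (hA j)
  have hBt : MeasurableSet {x : ∀ t, Ω i t | x t ∈ B} := measurable_pi_apply t hB
  have hκB : Measurable fun x : ∀ t, Ω i t => κ i t (toPrefix (Ω i) t.castSucc x) B :=
    (Kernel.measurable_coe (κ i t) hB).comp (measurable_toPrefix _)
  let S : ∀ j, Set (∀ t, Ω j t) := fun j => toPrefix (Ω j) t.castSucc ⁻¹' A j
  let φ₁ : (∀ t, Ω' i t) → ℝ≥0∞ := fun y => G i y (S i ∩ {x | x t ∈ B})
  let φ₂ : (∀ t, Ω' i t) → ℝ≥0∞ := fun y =>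
    ∫⁻ x in S i, κ i t (toPrefix (Ω i) t.castSucc x) B ∂(G i y)
  have hφ₁ : Measurable φ₁ := Kernel.measurable_coe (G i) ((hpre i).inter hBt)
  have hφ₂ : Measurable φ₂ := hκB.setLIntegral_kernel (hpre i)
  choose H hHm hH using fun j => hG j t (A j) (hA j)
  let W : (∀ j, Prefix (Ω' j) t.castSucc) → ℝ≥0∞ := fun z => ∏ j ∈ Finset.univ.erase i, H j (z j)
  have hW : Measurable W :=
    Finset.measurable_prod _ fun j _ => (hHm j).comp (measurable_pi_apply j)
  have hWae : ∀ᵐ y ∂π, ∏ j ∈ Finset.univ.erase i, G j (y j) (S j) =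
      W (prefixes Ω' t.castSucc y) := by
    have : ∀ᵐ y ∂π, ∀ j, G j (y j) (S j) = H j (toPrefix (Ω' j) t.castSucc (y j)) :=
      ae_all_iff.2 fun j => ae_of_ae_map (measurable_pi_apply j).aemeasurable (hH j)
    filter_upwards [this] with y hy
    exact Finset.prod_congr rfl fun j _ => hy j
  obtain ⟨g₁, hg₁, h₁⟩ := hπ.exists_projection hκ' hφ₁ t.castSucc
  obtain ⟨g₂, hg₂, h₂⟩ := hπ.exists_projection hκ' hφ₂ t.castSucc
  have hcond : ∀ (φ : (∀ t, Ω' i t) → ℝ≥0∞) (g : Prefix (Ω' i) t.castSucc → ℝ≥0∞),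
      Measurable φ → Measurable g →
      (∀ H : (∀ j, Prefix (Ω' j) t.castSucc) → ℝ≥0∞, Measurable H →
        ∫⁻ ω, φ (ω i) * H (prefixes Ω' t.castSucc ω) ∂π =
          ∫⁻ ω, g (toPrefix (Ω' i) t.castSucc (ω i)) * H (prefixes Ω' t.castSucc ω) ∂π) →
      ∀ C, MeasurableSet C →
        ∫⁻ p in C, g p ∂((π.map fun ω => ω i).map (toPrefix (Ω' i) t.castSucc)) =
          ∫⁻ y in toPrefix (Ω' i) t.castSucc ⁻¹' C, φ y ∂(π.map fun ω => ω i) := by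
    intro φ g hφ hg h C hC
    have hC' : MeasurableSet (toPrefix (Ω' i) t.castSucc ⁻¹' C) := measurable_toPrefix _ hC
    have := h (fun z => C.indicator (fun _ => 1) (z i))
      ((measurable_const.indicator hC).comp (measurable_pi_apply i))
    rw [← lintegral_indicator hC, ← lintegral_indicator hC',
      lintegral_map (hg.indicator hC) (measurable_toPrefix _),
      lintegral_map (g := fun ω : ∀ i t, Ω' i t => ω i)
        (f := fun y => C.indicator g (toPrefix (Ω' i) t.castSucc y)) ((hg.indicator hC).comp (measurable_toPrefix _)) (measurable_pi_apply i),
      lintegral_map (hφ.indicator hC') (measurable_pi_apply i)]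
    refine Eq.trans (lintegral_congr fun ω => ?_) (this.symm.trans (lintegral_congr fun ω => ?_))
    · by_cases hω : toPrefix (Ω' i) t.castSucc (ω i) ∈ C <;> simp [Set.indicator, hω, prefixes]
    · by_cases hω : toPrefix (Ω' i) t.castSucc (ω i) ∈ C <;> simp [Set.indicator, hω, prefixes]
  -- The functions `φ₁` and `φ₂` have the same integrals over events of the $i$-th $\Omega'$-past,
  -- by `hG'`. Their projections therefore agree, and stepwise coupling under $\pi$ allows
  -- multiplication by a function of the joint past.
  have hg : g₁ =ᵐ[(π.map fun ω => ω i).map (toPrefix (Ω' i) t.castSucc)] g₂ := by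
    refine ae_eq_of_forall_setLIntegral_eq_of_sigmaFinite hg₁ hg₂ fun C hC _ => ?_
    rw [hcond φ₁ g₁ hφ₁ hg₁ h₁ C hC, hcond φ₂ g₂ hφ₂ hg₂ h₂ C hC]
    exact hG' i t (A i) B C (hA i) hB hC
  have hg' : ∀ᵐ ω ∂π, g₁ (toPrefix (Ω' i) t.castSucc (ω i)) =
      g₂ (toPrefix (Ω' i) t.castSucc (ω i)) :=
    ae_of_ae_map (measurable_pi_apply i).aemeasurable
      (ae_of_ae_map (measurable_toPrefix _).aemeasurable hg)
  have hmid : ∫⁻ y, φ₁ (y i) * W (prefixes Ω' t.castSucc y) ∂π =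
      ∫⁻ y, φ₂ (y i) * W (prefixes Ω' t.castSucc y) ∂π := by
    rw [h₁ W hW, h₂ W hW]
    refine lintegral_congr_ae ?_
    filter_upwards [hg'] with ω hω
    rw [hω]
  have hprod : ∀ (f : (∀ t, Ω i t) → ℝ≥0∞), Measurable f →
      ∫⁻ x, f (x i) * ∏ j ∈ Finset.univ.erase i, (S j).indicator (fun _ => 1) (x j)
        ∂(π.bind (piKernel G)) =
      ∫⁻ y, (∫⁻ x, f x ∂(G i (y i))) * W (prefixes Ω' t.castSucc y) ∂π := by
    intro f hf
    have hupd : ∀ j, Measurable (Function.update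
        (fun j => (S j).indicator fun _ => (1 : ℝ≥0∞)) i f j) := by
      intro j
      rcases eq_or_ne j i with rfl | hj
      · rwa [Function.update_self]
      · rw [Function.update_of_ne hj]
        exact measurable_const.indicator (hpre j)
    have := lintegral_comp_piKernel (π := π) G hupd
    refine Eq.trans (lintegral_congr fun x => ?_) (this.trans (lintegral_congr_ae ?_))
    · rw [← Finset.mul_prod_erase Finset.univ _ (Finset.mem_univ i), Function.update_self]
      congr 1
      refine Finset.prod_congr rfl fun j hj => ?_
      rw [Function.update_of_ne (Finset.ne_of_mem_erase hj)]
    · filter_upwards [hWae] with y hy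
      rw [← Finset.mul_prod_erase Finset.univ _ (Finset.mem_univ i), Function.update_self, ← hy]
      congr 1
      refine Finset.prod_congr rfl fun j hj => ?_
      rw [Function.update_of_ne (Finset.ne_of_mem_erase hj), lintegral_indicator_const (hpre j),
        one_mul]
  -- The indicator of a box is the product of its coordinate indicators, with the $i$-th factor kept
  -- apart.
  have hin : ∀ x ∈ prefixes Ω t.castSucc ⁻¹' Set.univ.pi A, x i ∈ S i ∧
      ∏ j ∈ Finset.univ.erase i, (S j).indicator (fun _ => (1 : ℝ≥0∞)) (x j) = 1 := by
    intro x hx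
    have hx' : ∀ j, x j ∈ S j := fun j => (Set.mem_pi.1 hx) j (Set.mem_univ j)
    exact ⟨hx' i, Finset.prod_eq_one fun j _ => Set.indicator_of_mem (hx' j) _⟩
  have hout : ∀ x ∉ prefixes Ω t.castSucc ⁻¹' Set.univ.pi A, x i ∉ S i ∨
      ∏ j ∈ Finset.univ.erase i, (S j).indicator (fun _ => (1 : ℝ≥0∞)) (x j) = 0 := by
    intro x hx
    by_contra! h
    refine hx (Set.mem_pi.2 fun j _ => ?_)
    rcases eq_or_ne j i with rfl | hj
    · exact h.1
    · by_contra hjS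
      have hjS : x j ∉ S j := hjS
      exact h.2 (Finset.prod_eq_zero (Finset.mem_erase.2 ⟨hj, Finset.mem_univ j⟩)
        (Set.indicator_of_notMem hjS _))
  have hpi : MeasurableSet (Set.univ.pi A) := MeasurableSet.univ_pi hA
  have hpi' : MeasurableSet (prefixes Ω t.castSucc ⁻¹' Set.univ.pi A) := measurable_prefixes _ hpi
  rw [Measure.map_apply (measurable_prefixes_prodMk t i) (hpi.prod hB),
    Measure.compProd_apply_prod hpi hB,
    setLIntegral_map hpi (Kernel.measurable_coe _ hB) (measurable_prefixes _)]
  have hL := hprod ((S i ∩ {x | x t ∈ B}).indicator fun _ => 1)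
    (measurable_const.indicator ((hpre i).inter hBt))
  have hR := hprod ((S i).indicator fun x => κ i t (toPrefix (Ω i) t.castSucc x) B)
    (hκB.indicator (hpre i))
  have hL' : ∀ y, ∫⁻ x, (S i ∩ {x | x t ∈ B}).indicator (fun _ => 1) x ∂(G i y) = φ₁ y := fun y => by
    rw [lintegral_indicator_const ((hpre i).inter hBt), one_mul]
  have hR' : ∀ y, ∫⁻ x, (S i).indicator (fun x => κ i t (toPrefix (Ω i) t.castSucc x) B) x
      ∂(G i y) = φ₂ y := fun y => lintegral_indicator (hpre i) _
  simp only [hL'] at hL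
  simp only [hR'] at hR
  have hm : MeasurableSet ((fun ω : ∀ i t, Ω i t => (prefixes Ω t.castSucc ω, ω i t)) ⁻¹'
      (Set.univ.pi A ×ˢ B)) := measurable_prefixes_prodMk t i (hpi.prod hB)
  rw [← setLIntegral_one, ← lintegral_indicator hm, ← lintegral_indicator hpi']
  refine Eq.trans (lintegral_congr fun x => ?_) (hL.trans (hmid.trans (hR.symm.trans
    (lintegral_congr fun x => ?_))))
  · have : (fun ω : ∀ i t, Ω i t => (prefixes Ω t.castSucc ω, ω i t)) ⁻¹' (Set.univ.pi A ×ˢ B) =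
        prefixes Ω t.castSucc ⁻¹' Set.univ.pi A ∩ {x | x i t ∈ B} := rfl
    rw [this]
    by_cases h1 : x i t ∈ B <;> by_cases h2 : x ∈ prefixes Ω t.castSucc ⁻¹' Set.univ.pi A
    · rw [Set.indicator_of_mem (by exact ⟨h2, h1⟩),
        Set.indicator_of_mem (by exact ⟨(hin x h2).1, h1⟩), (hin x h2).2, one_mul]
    · rw [Set.indicator_of_notMem fun h => h2 h.1]
      rcases hout x h2 with h | h
      · rw [Set.indicator_of_notMem fun h' => h h'.1, zero_mul]
      · rw [h, mul_zero]
    all_goals rw [Set.indicator_of_notMem fun h => h1 h.2, Set.indicator_of_notMem fun h => h1 h.2,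
      zero_mul]
  · by_cases h2 : x ∈ prefixes Ω t.castSucc ⁻¹' Set.univ.pi A
    · rw [Set.indicator_of_mem h2, Set.indicator_of_mem (hin x h2).1, (hin x h2).2, mul_one]
      rfl
    · rw [Set.indicator_of_notMem h2]
      rcases hout x h2 with h | h
      · rw [Set.indicator_of_notMem h, zero_mul]
      · rw [h, mul_zero]

end Gluing

/-! ### Kernels of bicausal couplings -/

section Bicausal

variable {T : ℕ} {𝒳 : Fin T → Type v} [∀ t, MetricSpace (𝒳 t)] [∀ t, MeasurableSpace (𝒳 t)]

theorem pairFiltration_zero_right (𝕏 : FilteredProcess.{u} 𝒳) (𝕐 : FilteredProcess.{w} 𝒳)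
    (s : Fin (T + 1)) : pairFiltration 𝕏 𝕐 s 0 =
      MeasurableSpace.comap (fun q => toPrefix 𝕏.Ω s q.1) MeasurableSpace.pi := by
  rw [pairFiltration, MeasurableSpace.prod, FilteredProcess.filtration, FilteredProcess.filtration,
    canonicalFiltration_zero, MeasurableSpace.comap_bot, sup_bot_eq, MeasurableSpace.comap_comp]
  rfl

theorem pairFiltration_zero_left (𝕏 : FilteredProcess.{u} 𝒳) (𝕐 : FilteredProcess.{w} 𝒳)
    (t : Fin (T + 1)) : pairFiltration 𝕏 𝕐 0 t =
      MeasurableSpace.comap (fun q => toPrefix 𝕐.Ω t q.2) MeasurableSpace.pi := by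
  rw [pairFiltration, MeasurableSpace.prod, FilteredProcess.filtration, FilteredProcess.filtration,
    canonicalFiltration_zero, MeasurableSpace.comap_bot, bot_sup_eq, MeasurableSpace.comap_comp]
  rfl

theorem IsCausal.condIndep {𝕏 : FilteredProcess.{u} 𝒳} {𝕐 : FilteredProcess.{w} 𝒳}
    {π : Measure ((∀ t, 𝕏.Ω t) × (∀ t, 𝕐.Ω t))} [IsProbabilityMeasure π] (h : IsCausal 𝕏 𝕐 π)
    (t : Fin (T + 1)) : CondIndep (pairFiltration 𝕏 𝕐 t 0) (pairFiltration 𝕏 𝕐 (Fin.last T) 0)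
      (pairFiltration 𝕏 𝕐 0 t) (pairFiltration_le 𝕏 𝕐 _ _) π := by
  refine Fin.cases ?_ (fun t => h t) t
  exact condIndep_of_le_right _ (pairFiltration_le 𝕏 𝕐 _ _) le_rfl

/-- Causality in terms of the kernels of the source process. -/
theorem IsCausal.measure_eq {𝕏 : FilteredProcess.{u} 𝒳} {𝕐 : FilteredProcess.{w} 𝒳}
    {π : Measure ((∀ t, 𝕏.Ω t) × (∀ t, 𝕐.Ω t))} [IsProbabilityMeasure π] (h : IsCausal 𝕏 𝕐 π)
    (hfst : π.map Prod.fst = 𝕏.P) {κ : ∀ t : Fin T, Kernel (Prefix 𝕏.Ω t.castSucc) (𝕏.Ω t)}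
    (hκ : IsDisintegration 𝕏.P κ) {t : Fin T} {A : Set (Prefix 𝕏.Ω t.castSucc)} {B : Set (𝕏.Ω t)}
    {C : Set (Prefix 𝕐.Ω t.castSucc)} (hA : MeasurableSet A) (hB : MeasurableSet B)
    (hC : MeasurableSet C) :
    π ((toPrefix 𝕏.Ω t.castSucc ⁻¹' A ∩ {x | x t ∈ B}) ×ˢ (toPrefix 𝕐.Ω t.castSucc ⁻¹' C)) =
      ∫⁻ q in (toPrefix 𝕏.Ω t.castSucc ⁻¹' A) ×ˢ (toPrefix 𝕐.Ω t.castSucc ⁻¹' C),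
        κ t (toPrefix 𝕏.Ω t.castSucc q.1) B ∂π := by
  have := hκ.markov t
  have hBm : MeasurableSet[pairFiltration 𝕏 𝕐 (Fin.last T) 0]
      {q : (∀ t, 𝕏.Ω t) × (∀ t, 𝕐.Ω t) | q.1 t ∈ B} := by
    rw [pairFiltration_zero_right]
    exact ⟨{p | p t ∈ B}, (measurable_pi_apply t) hB, rfl⟩
  have hg : Measurable[pairFiltration 𝕏 𝕐 t.castSucc 0]
      fun q : (∀ t, 𝕏.Ω t) × (∀ t, 𝕐.Ω t) => κ t (toPrefix 𝕏.Ω t.castSucc q.1) B := by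
    rw [pairFiltration_zero_right]
    exact (Kernel.measurable_coe (κ t) hB).comp (comap_measurable _)
  have key := measure_inter_eq_of_condIndep (pairFiltration_le 𝕏 𝕐 _ _)
    (pairFiltration_le 𝕏 𝕐 _ _) (pairFiltration_le 𝕏 𝕐 _ _) (h.condIndep t.castSucc) hBm hg ?_
    (C := (fun q => toPrefix 𝕏.Ω t.castSucc q.1) ⁻¹' A)
    (D := (fun q => toPrefix 𝕐.Ω t.castSucc q.2) ⁻¹' C)
    (by rw [pairFiltration_zero_right]; exact ⟨A, hA, rfl⟩)
    (by rw [pairFiltration_zero_left]; exact ⟨C, hC, rfl⟩)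
  · have hset : (toPrefix 𝕏.Ω t.castSucc ⁻¹' A ∩ {x | x t ∈ B}) ×ˢ
        (toPrefix 𝕐.Ω t.castSucc ⁻¹' C) = {q : (∀ t, 𝕏.Ω t) × (∀ t, 𝕐.Ω t) | q.1 t ∈ B} ∩
        ((fun q => toPrefix 𝕏.Ω t.castSucc q.1) ⁻¹' A ∩
          (fun q => toPrefix 𝕐.Ω t.castSucc q.2) ⁻¹' C) := by
      ext q
      simp only [Set.mem_prod, Set.mem_inter_iff, Set.mem_preimage, Set.mem_ofPred_eq]
      tauto
    rw [hset]
    exact key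
  · rw [pairFiltration_zero_right]
    rintro _ ⟨C, hC, rfl⟩
    have hset : MeasurableSet (toPrefix 𝕏.Ω t.castSucc ⁻¹' C) := measurable_toPrefix _ hC
    have h3 := DFunLike.congr_fun (hκ.law_eq t) (C ×ˢ B)
    have hprod : MeasurableSet ((fun ω => (toPrefix 𝕏.Ω t.castSucc ω, ω t)) ⁻¹' (C ×ˢ B)) :=
      ((measurable_toPrefix _).prodMk (measurable_pi_apply t)) (hC.prod hB)
    rw [Measure.map_apply ((measurable_toPrefix _).prodMk (measurable_pi_apply t)) (hC.prod hB),
      Measure.compProd_apply_prod hC hB,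
      setLIntegral_map hC (Kernel.measurable_coe _ hB) (measurable_toPrefix _), ← hfst,
      Measure.map_apply measurable_fst hprod] at h3
    have hκB : Measurable fun x : ∀ t, 𝕏.Ω t => κ t (toPrefix 𝕏.Ω t.castSucc x) B :=
      (Kernel.measurable_coe (κ t) hB).comp (measurable_toPrefix _)
    rw [setLIntegral_map hset hκB measurable_fst] at h3
    rw [Set.inter_comm]
    exact h3

variable {𝕏 𝕐 : FilteredProcess.{u} 𝒳}

/-- The kernel is the conditional law of the $\mathbb X$-path given the $\mathbb Y$-path. Causality
from $\mathbb Y$ to $\mathbb X$ makes its prefix laws nonanticipative, and causality from $\mathbb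
X$ to $\mathbb Y$ preserves the transition kernels of $\mathbb X$. -/
theorem exists_bicausal_kernel {κ : ∀ t : Fin T, Kernel (Prefix 𝕏.Ω t.castSucc) (𝕏.Ω t)}
    (hκ : IsDisintegration 𝕏.P κ) {γ : ProbabilityMeasure ((∀ t, 𝕏.Ω t) × (∀ t, 𝕐.Ω t))}
    (hγ : γ ∈ bicausalCouplings 𝕏 𝕐) :
    ∃ G : Kernel (∀ t, 𝕐.Ω t) (∀ t, 𝕏.Ω t), IsMarkovKernel G ∧
      γ.toMeasure.map Prod.swap = 𝕐.P ⊗ₘ G ∧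
      (∀ (t : Fin T) (A : Set (Prefix 𝕏.Ω t.castSucc)), MeasurableSet A →
        ∃ H : Prefix 𝕐.Ω t.castSucc → ℝ≥0∞, Measurable H ∧
          ∀ᵐ y ∂𝕐.P, G y (toPrefix 𝕏.Ω t.castSucc ⁻¹' A) = H (toPrefix 𝕐.Ω t.castSucc y)) ∧
      ∀ (t : Fin T) (A : Set (Prefix 𝕏.Ω t.castSucc)) (B : Set (𝕏.Ω t))
        (C : Set (Prefix 𝕐.Ω t.castSucc)), MeasurableSet A → MeasurableSet B → MeasurableSet C →
        ∫⁻ y in toPrefix 𝕐.Ω t.castSucc ⁻¹' C,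
            G y (toPrefix 𝕏.Ω t.castSucc ⁻¹' A ∩ {x | x t ∈ B}) ∂𝕐.P =
          ∫⁻ y in toPrefix 𝕐.Ω t.castSucc ⁻¹' C, ∫⁻ x in toPrefix 𝕏.Ω t.castSucc ⁻¹' A,
            κ t (toPrefix 𝕏.Ω t.castSucc x) B ∂(G y) ∂𝕐.P := by
  obtain ⟨hfst, hsnd, hc1, hc2⟩ := hγ
  let γ' : Measure ((∀ t, 𝕐.Ω t) × (∀ t, 𝕏.Ω t)) := γ.toMeasure.map Prod.swap
  have hγ'prob : IsProbabilityMeasure γ' :=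
    Measure.isProbabilityMeasure_map measurable_swap.aemeasurable
  have hne : Nonempty (∀ t, 𝕏.Ω t) := nonempty_of_isProbabilityMeasure 𝕏.P
  have hγ'fst : γ'.fst = 𝕐.P := by
    rw [← hsnd, Measure.fst, Measure.map_map measurable_fst measurable_swap]
    rfl
  have hdis : γ' = 𝕐.P ⊗ₘ γ'.condKernel := by
    rw [← hγ'fst]
    exact (γ'.disintegrate γ'.condKernel).symm
  refine ⟨γ'.condKernel, inferInstance, hdis, fun t A hA => ?_, fun t A B C hA hB hC => ?_⟩
  · have hneA : Nonempty (Prefix 𝕏.Ω t.castSucc) := ⟨toPrefix _ _ hne.some⟩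
    have hU : Measurable fun q : (∀ t, 𝕐.Ω t) × (∀ t, 𝕏.Ω t) => toPrefix 𝕐.Ω t.castSucc q.1 :=
      (measurable_toPrefix _).comp measurable_fst
    have hV : Measurable fun q : (∀ t, 𝕐.Ω t) × (∀ t, 𝕏.Ω t) => toPrefix 𝕏.Ω t.castSucc q.2 :=
      (measurable_toPrefix _).comp measurable_snd
    -- The candidate for `H` is the conditional law of the $\mathbb X$-prefix given the $\mathbb
    -- Y$-prefix alone; causality shows that the rest of the $\mathbb Y$-path adds no information.
    let R := condDistrib (fun q : (∀ t, 𝕐.Ω t) × (∀ t, 𝕏.Ω t) => toPrefix 𝕏.Ω t.castSucc q.2)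
      (fun q => toPrefix 𝕐.Ω t.castSucc q.1) γ'
    have hRm : Measurable fun p => R p A := Kernel.measurable_coe R hA
    refine ⟨fun p => R p A, hRm, ?_⟩
    have hpre : MeasurableSet (toPrefix 𝕏.Ω t.castSucc ⁻¹' A) := measurable_toPrefix _ hA
    refine ae_eq_of_forall_setLIntegral_eq_of_sigmaFinite
      (Kernel.measurable_coe _ hpre) (hRm.comp (measurable_toPrefix _)) fun D hD _ => ?_
    have h1 : ∫⁻ y in D, γ'.condKernel y (toPrefix 𝕏.Ω t.castSucc ⁻¹' A) ∂𝕐.P =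
        γ' (D ×ˢ (toPrefix 𝕏.Ω t.castSucc ⁻¹' A)) := by
      conv_rhs => rw [hdis]
      rw [Measure.compProd_apply_prod hD hpre]
    have hAm : MeasurableSet[pairFiltration 𝕐 𝕏 0 t.castSucc]
        ((fun q : (∀ t, 𝕐.Ω t) × (∀ t, 𝕏.Ω t) => toPrefix 𝕏.Ω t.castSucc q.2) ⁻¹' A) := by
      rw [pairFiltration_zero_left]
      exact ⟨A, hA, rfl⟩
    have hg : Measurable[pairFiltration 𝕐 𝕏 t.castSucc 0]
        fun q : (∀ t, 𝕐.Ω t) × (∀ t, 𝕏.Ω t) => R (toPrefix 𝕐.Ω t.castSucc q.1) A := by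
      rw [pairFiltration_zero_right]
      exact hRm.comp (comap_measurable _)
    have hci : IsCausal 𝕐 𝕏 γ' := hc2
    have key := measure_inter_eq_of_condIndep (pairFiltration_le 𝕐 𝕏 _ _)
      (pairFiltration_le 𝕐 𝕏 _ _) (pairFiltration_le 𝕐 𝕏 _ _) (hci.condIndep t.castSucc).symm
      hAm hg ?_ MeasurableSet.univ (D := Prod.fst ⁻¹' D)
      (by rw [pairFiltration_zero_right]; exact ⟨D, hD, rfl⟩)
    · have hset : D ×ˢ (toPrefix 𝕏.Ω t.castSucc ⁻¹' A) =
          (fun q : (∀ t, 𝕐.Ω t) × (∀ t, 𝕏.Ω t) => toPrefix 𝕏.Ω t.castSucc q.2) ⁻¹' A ∩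
            (Set.univ ∩ Prod.fst ⁻¹' D) := by
        ext q
        simp only [Set.mem_prod, Set.mem_inter_iff, Set.mem_preimage, Set.mem_univ]
        tauto
      rw [h1, hset, key, Set.univ_inter, ← hγ'fst]
      exact (setLIntegral_map (g := Prod.fst) hD (hRm.comp (measurable_toPrefix _))
        measurable_fst).symm
    · rw [pairFiltration_zero_right]
      rintro _ ⟨C, hC, rfl⟩
      have h3 := DFunLike.congr_fun (compProd_map_condDistrib (μ := γ')
        (mβ := MeasurableSpace.pi) (X := fun q => toPrefix 𝕐.Ω t.castSucc q.1) hV.aemeasurable)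
        (C ×ˢ A)
      rw [Measure.map_apply (hU.prodMk hV) (hC.prod hA), Measure.compProd_apply_prod hC hA,
        setLIntegral_map hC hRm hU] at h3
      rw [Set.inter_comm]
      exact h3.symm
  · have hpreA : MeasurableSet (toPrefix 𝕏.Ω t.castSucc ⁻¹' A) := measurable_toPrefix _ hA
    have hpreC : MeasurableSet (toPrefix 𝕐.Ω t.castSucc ⁻¹' C) := measurable_toPrefix _ hC
    have hBt : MeasurableSet {x : ∀ t, 𝕏.Ω t | x t ∈ B} := measurable_pi_apply t hB
    have hκB : Measurable fun x : ∀ t, 𝕏.Ω t => κ t (toPrefix 𝕏.Ω t.castSucc x) B :=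
      (Kernel.measurable_coe (κ t) hB).comp (measurable_toPrefix _)
    have hκB' : Measurable fun q : (∀ t, 𝕐.Ω t) × (∀ t, 𝕏.Ω t) =>
        κ t (toPrefix 𝕏.Ω t.castSucc q.2) B := hκB.comp measurable_snd
    have key := hc1.measure_eq hfst hκ hA hB hC
    have h1 : ∀ S : Set (∀ t, 𝕏.Ω t), MeasurableSet S →
        γ.toMeasure (S ×ˢ (toPrefix 𝕐.Ω t.castSucc ⁻¹' C)) =
          γ' ((toPrefix 𝕐.Ω t.castSucc ⁻¹' C) ×ˢ S) := by
      intro S hS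
      rw [Measure.map_apply measurable_swap (hpreC.prod hS), Set.preimage_swap_prod]
    have h2 : ∫⁻ q in (toPrefix 𝕏.Ω t.castSucc ⁻¹' A) ×ˢ (toPrefix 𝕐.Ω t.castSucc ⁻¹' C),
        κ t (toPrefix 𝕏.Ω t.castSucc q.1) B ∂γ.toMeasure =
        ∫⁻ q in (toPrefix 𝕐.Ω t.castSucc ⁻¹' C) ×ˢ (toPrefix 𝕏.Ω t.castSucc ⁻¹' A),
          κ t (toPrefix 𝕏.Ω t.castSucc q.2) B ∂γ' := by
      rw [setLIntegral_map (hpreC.prod hpreA) hκB' measurable_swap,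
        Set.preimage_swap_prod]
      rfl
    rw [h1 _ (hpreA.inter hBt), h2, hdis, Measure.compProd_apply_prod hpreC (hpreA.inter hBt),
      Measure.setLIntegral_compProd hκB' hpreC hpreA] at key
    exact key

end Bicausal

/-! ### Stability of multicausal transport under the adapted distance -/

section Transfer

/-- The pointwise bound is integrated over the joint law of $(y,x)$, in which each pair $(y_i,x_i)$
has the law of the swapped $\gamma_i$. -/
theorem lintegral_bind_piKernel_le {ι : Type*} [Fintype ι] {α β : ι → Type*}
    [∀ i, MeasurableSpace (α i)] [∀ i, MeasurableSpace (β i)]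
    (G : ∀ i, Kernel (α i) (β i)) [∀ i, IsMarkovKernel (G i)]
    (π : Measure (∀ i, α i)) [IsProbabilityMeasure π]
    {f : (∀ i, β i) → ℝ≥0∞} {g : (∀ i, α i) → ℝ≥0∞} {d : ∀ i, β i × α i → ℝ≥0∞}
    (hf : Measurable f) (hg : Measurable g) (hd : ∀ i, Measurable (d i)) (k : ℝ≥0∞)
    (hle : ∀ x y, f x ≤ g y + k * ∑ i, d i (x i, y i)) {γ : ∀ i, Measure (β i × α i)}
    (hγ : ∀ i, (γ i).map Prod.swap = π.map (fun x => x i) ⊗ₘ G i) :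
    ∫⁻ x, f x ∂(π.bind (piKernel G)) ≤ ∫⁻ y, g y ∂π + k * ∑ i, ∫⁻ q, d i q ∂(γ i) := by
  have hf2 : Measurable fun q : (∀ i, α i) × (∀ i, β i) => f q.2 := hf.comp measurable_snd
  have hg1 : Measurable fun q : (∀ i, α i) × (∀ i, β i) => g q.1 := hg.comp measurable_fst
  have hds : ∀ i, Measurable fun q : α i × β i => d i q.swap := fun i =>
    (hd i).comp measurable_swap
  have hproj : ∀ i, Measurable fun q : (∀ i, α i) × (∀ i, β i) => (q.1 i, q.2 i) := fun i =>
    ((measurable_pi_apply i).comp measurable_fst).prodMk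
      ((measurable_pi_apply i).comp measurable_snd)
  have hdq : ∀ i, Measurable fun q : (∀ i, α i) × (∀ i, β i) => d i (q.2 i, q.1 i) := fun i =>
    (hds i).comp (hproj i)
  have h1 : ∫⁻ x, f x ∂(π.bind (piKernel G)) = ∫⁻ q, f q.2 ∂(π ⊗ₘ piKernel G) := by
    rw [Measure.lintegral_bind (piKernel G).measurable.aemeasurable hf.aemeasurable,
      Measure.lintegral_compProd hf2]
  have h2 : ∫⁻ q, g q.1 ∂(π ⊗ₘ piKernel G) = ∫⁻ y, g y ∂π := by
    rw [Measure.lintegral_compProd hg1]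
    simp
  have h3 : ∀ i, ∫⁻ q, d i q ∂(γ i) = ∫⁻ q, d i (q.2 i, q.1 i) ∂(π ⊗ₘ piKernel G) := by
    intro i
    have h4 := map_compProd_piKernel G π i
    rw [← hγ i] at h4
    have h5 := lintegral_map (μ := π ⊗ₘ piKernel G) (hds i) (hproj i)
    rw [h4, lintegral_map (hds i) measurable_swap] at h5
    exact h5
  rw [h1, ← h2]
  simp_rw [h3]
  rw [← lintegral_finsetSum _ fun i _ => hdq i,
    ← lintegral_const_mul _ (Finset.measurable_fun_sum _ fun i _ => hdq i),
    ← lintegral_add_left hg1]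
  exact lintegral_mono fun q => hle _ _

variable {T N : ℕ} {𝒳 : Fin T → Type v} [∀ t, MetricSpace (𝒳 t)]

theorem continuous_truncDist :
    Continuous fun q : (∀ t, 𝒳 t) × (∀ t, 𝒳 t) => truncDist q.1 q.2 := by
  unfold truncDist
  fun_prop

theorem truncDist_self (x : ∀ t, 𝒳 t) : truncDist x x = 0 := by
  simp [truncDist]

theorem truncDist_comm (x y : ∀ t, 𝒳 t) : truncDist x y = truncDist y x := by
  simp [truncDist, dist_comm]

/-- If some path distance is at least $1$, the truncation of the envelope at $k$ suffices. Otherwise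
the truncation of the distances is inactive and the Lipschitz bound applies, the supremum metric
being dominated by the sums. -/
theorem lipschitzEnvelope_le_add_truncDist (W : (Fin N → ∀ t, 𝒳 t) → ℝ≥0∞) (k : ℕ)
    (x y : Fin N → ∀ t, 𝒳 t) : lipschitzEnvelope W k x ≤
      lipschitzEnvelope W k y + k * ∑ i, ENNReal.ofReal (truncDist (x i) (y i)) := by
  by_cases h : ∃ i, 1 ≤ ∑ t, dist (x i t) (y i t)
  · obtain ⟨i, hi⟩ := h
    have h1 : (1 : ℝ≥0∞) ≤ ∑ i, ENNReal.ofReal (truncDist (x i) (y i)) := by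
      refine le_trans ?_ (Finset.single_le_sum (fun _ _ => zero_le) (Finset.mem_univ i))
      rw [truncDist, min_eq_right hi, ENNReal.ofReal_one]
    calc lipschitzEnvelope W k x ≤ k * 1 := by
          rw [mul_one]; exact lipschitzEnvelope_le_natCast W k x
      _ ≤ _ := (mul_le_mul_right h1 _).trans le_add_self
  · push Not at h
    refine (lipschitzEnvelope_le_add W k x y).trans ?_
    gcongr
    refine edist_pi_le_iff.2 fun i => ?_
    refine le_trans ?_ (Finset.single_le_sum (fun _ _ => zero_le) (Finset.mem_univ i))
    rw [truncDist, min_eq_left (h i).le]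
    refine edist_pi_le_iff.2 fun t => ?_
    rw [edist_dist]
    exact ENNReal.ofReal_le_ofReal
      (Finset.single_le_sum (f := fun t => dist (x i t) (y i t)) (fun _ _ => dist_nonneg)
        (Finset.mem_univ t))

variable [∀ t, MeasurableSpace (𝒳 t)]

theorem continuous_values (𝕏 : Fin N → FilteredProcess.{u} 𝒳) :
    Continuous fun ω : ProdSpace 𝕏 => fun i => (𝕏 i).X (ω i) :=
  continuous_pi fun i => (𝕏 i).continuous_X.comp (continuous_apply i)

variable [∀ t, SecondCountableTopology (𝒳 t)] [∀ t, BorelSpace (𝒳 t)]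

theorem measurable_ofReal_truncDist (𝕏 𝕐 : FilteredProcess.{u} 𝒳) :
    Measurable fun q : (∀ t, 𝕏.Ω t) × (∀ t, 𝕐.Ω t) =>
      ENNReal.ofReal (truncDist (𝕏.X q.1) (𝕐.X q.2)) := by
  have h1 : Measurable fun q : (∀ t, 𝕏.Ω t) × (∀ t, 𝕐.Ω t) => (𝕏.X q.1, 𝕐.X q.2) :=
    (𝕏.continuous_X.measurable.comp measurable_fst).prodMk
      (𝕐.continuous_X.measurable.comp measurable_snd)
  exact (continuous_truncDist.measurable.comp h1).ennreal_ofReal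

theorem exists_multicausalCoupling_lintegral_le {𝕏 𝕐 : Fin N → FilteredProcess.{u} 𝒳}
    (W : (Fin N → ∀ t, 𝒳 t) → ℝ≥0∞) (k : ℕ)
    {π : ProbabilityMeasure (ProdSpace 𝕐)} (hπ : π ∈ multicausalCouplings 𝕐)
    {γ : ∀ i, ProbabilityMeasure ((∀ t, (𝕏 i).Ω t) × (∀ t, (𝕐 i).Ω t))}
    (hγ : ∀ i, γ i ∈ bicausalCouplings (𝕏 i) (𝕐 i)) :
    ∃ π' ∈ multicausalCouplings 𝕏,
      ∫⁻ ω, lipschitzEnvelope W k (fun i => (𝕏 i).X (ω i)) ∂π'.toMeasure ≤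
        ∫⁻ ω, lipschitzEnvelope W k (fun i => (𝕐 i).X (ω i)) ∂π.toMeasure +
          k * ∑ i, ∫⁻ q, ENNReal.ofReal (truncDist ((𝕏 i).X q.1) ((𝕐 i).X q.2)) ∂(γ i).toMeasure
          := by
  choose κ hκ using fun i => (𝕏 i).exists_kernels
  choose κ' hκ' using fun i => (𝕐 i).exists_kernels
  choose G hGm hswap hG hG' using fun i =>
    exists_bicausal_kernel (hκ i).toIsDisintegration (hγ i)
  have hstep := isStepwiseCoupling_of_mem_multicausalCouplings
    (fun i => (hκ' i).toIsDisintegration) hπ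
  have hmarg : ∀ i, π.toMeasure.map (fun ω : ProdSpace 𝕐 => ω i) = (𝕐 i).P := hπ.1.2
  have hbind : IsStepwiseCoupling (Ω := fun i => (𝕏 i).Ω) κ (π.toMeasure.bind (piKernel G)) :=
    hstep.bind_piKernel (fun i => (hκ i).markov) (fun i => (hκ' i).markov) G
      (fun i t A hA => by rw [hmarg i]; exact hG i t A hA)
      (fun i t A B C hA hB hC => by rw [hmarg i]; exact hG' i t A B C hA hB hC)
  have hf := continuous_lipschitzEnvelope W k
  have hfX : Measurable fun ω : ProdSpace 𝕏 => lipschitzEnvelope W k (fun i => (𝕏 i).X (ω i)) :=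
    (hf.comp (continuous_values 𝕏)).measurable
  have hfY : Measurable fun ω : ProdSpace 𝕐 => lipschitzEnvelope W k (fun i => (𝕐 i).X (ω i)) :=
    (hf.comp (continuous_values 𝕐)).measurable
  exact ⟨⟨π.toMeasure.bind (piKernel G), inferInstance⟩,
    mem_multicausalCouplings_of_isStepwiseCoupling (fun i => (hκ i).toIsDisintegration) hbind,
    lintegral_bind_piKernel_le G π.toMeasure hfX hfY
      (fun i => measurable_ofReal_truncDist (𝕏 i) (𝕐 i)) k
      (fun x y => lipschitzEnvelope_le_add_truncDist W k _ _)
      fun i => by rw [hswap i, ← hmarg i]⟩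

/-- The multicausal value for a nonnegative extended cost. -/
def multicausalCost (W : (Fin N → ∀ t, 𝒳 t) → ℝ≥0∞) (𝕏 : Fin N → FilteredProcess.{u} 𝒳) : ℝ≥0∞ :=
  ⨅ π ∈ multicausalCouplings 𝕏,
    ∫⁻ ω, W (fun i => (𝕏 i).X (ω i)) ∂(π : Measure (ProdSpace 𝕏))

theorem multicausalCost_lipschitzEnvelope_le {𝕏 𝕐 : Fin N → FilteredProcess.{u} 𝒳}
    (W : (Fin N → ∀ t, 𝒳 t) → ℝ≥0∞) (k : ℕ) {ε : ℝ≥0∞}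
    (h : ∀ i, adaptedDist (𝕏 i) (𝕐 i) < ε) :
    multicausalCost (lipschitzEnvelope W k) 𝕏 ≤ multicausalCost W 𝕐 + ε * (k * N) := by
  simp only [adaptedDist, iInf_lt_iff] at h
  choose γ hγ hγε using h
  have key : ∀ π ∈ multicausalCouplings 𝕐, multicausalCost (lipschitzEnvelope W k) 𝕏 ≤
      ∫⁻ ω, W (fun i => (𝕐 i).X (ω i)) ∂(π : Measure (ProdSpace 𝕐)) + ε * (k * N) := by
    intro π hπ
    obtain ⟨π', hπ', hle⟩ := exists_multicausalCoupling_lintegral_le W k hπ hγ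
    refine (iInf₂_le π' hπ').trans (hle.trans ?_)
    refine add_le_add (lintegral_mono fun ω => lipschitzEnvelope_le W k _) ?_
    calc _ ≤ (k : ℝ≥0∞) * ∑ _i : Fin N, ε := by
          gcongr with i
          exact (hγε i).le
      _ = ε * (k * N) := by simp; ring
  rw [multicausalCost.eq_1 W 𝕐, ENNReal.iInf_add]
  refine le_iInf fun π => ?_
  by_cases hπ : π ∈ multicausalCouplings 𝕐
  · simpa [hπ] using key π hπ
  · simp [hπ]

end Transfer

/-! ### Compactness of the set of multicausal couplings -/

section Compact

/-- Testing with a bounded continuous $f$, the partial integral $a\mapsto\int f(a,b)\,\kappa(a,db)$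
is again bounded and continuous, as $\kappa$ is weakly continuous. -/
theorem continuous_compProd {α β : Type*} [TopologicalSpace α] [TopologicalSpace β]
    [MeasurableSpace α] [MeasurableSpace β]
    [TopologicalSpace.PseudoMetrizableSpace α] [TopologicalSpace.PseudoMetrizableSpace β]
    [SecondCountableTopology α] [SecondCountableTopology β]
    [OpensMeasurableSpace α] [OpensMeasurableSpace β] (κ : Kernel α β) [hκ : IsMarkovKernel κ]
    (h : @Continuous α (ProbabilityMeasure β) _ _ fun a => ⟨κ a, hκ.isProbabilityMeasure a⟩) :
    @Continuous (ProbabilityMeasure α) (ProbabilityMeasure (α × β)) _ _ fun μ =>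
      ⟨(μ : Measure α) ⊗ₘ κ, inferInstance⟩ := by
  refine continuous_iff_continuousAt.2 fun μ => ?_
  refine ProbabilityMeasure.tendsto_iff_forall_lintegral_tendsto.2 fun f => ?_
  have hf : Continuous fun q : α × β => (f q : ℝ≥0∞) := by fun_prop
  obtain ⟨k, hk⟩ := exists_nat_ge (nndist f 0)
  have hfk : ∀ q, (f q : ℝ≥0∞) ≤ k := fun q => by
    have h1 : f q ≤ nndist f 0 := by
      have := BoundedContinuousFunction.nndist_coe_le_nndist (f := f) (g := 0) q
      simpa using this
    exact_mod_cast h1.trans hk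
  have hc : Continuous fun a => ∫⁻ b, (f (a, b) : ℝ≥0∞) ∂(κ a) :=
    (continuous_lintegral_prodMk hf hfk).comp (continuous_id.prodMk h)
  have hck : ∀ a, ∫⁻ b, (f (a, b) : ℝ≥0∞) ∂(κ a) ≤ k := fun a => by
    refine (lintegral_mono fun b => hfk (a, b)).trans ?_
    simp
  have heq : ∀ ν : ProbabilityMeasure α, ∫⁻ q, (f q : ℝ≥0∞) ∂((ν : Measure α) ⊗ₘ κ) =
      ∫⁻ a, ∫⁻ b, (f (a, b) : ℝ≥0∞) ∂(κ a) ∂(ν : Measure α) := fun ν =>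
    Measure.lintegral_compProd hf.measurable
  have := (continuous_lintegral_of_continuous_of_le hc hck).tendsto μ
  simpa only [ProbabilityMeasure.coe_mk, heq] using this

variable {T N : ℕ} {𝒳 : Fin T → Type v} [∀ t, MetricSpace (𝒳 t)] [∀ t, MeasurableSpace (𝒳 t)]

/-- Couplings of fixed marginals form a compact set. Within it, the stepwise identities equate
weakly continuous functions of $\pi$, because the kernels are continuous, and so cut out a closed
set. -/
theorem isCompact_multicausalCouplings (𝕏 : Fin N → FilteredProcess.{u} 𝒳) :
    IsCompact (multicausalCouplings 𝕏) := by
  choose κ hκ using fun i => (𝕏 i).exists_kernels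
  have hmk : ∀ i t, IsMarkovKernel (κ i t) := fun i => (hκ i).markov
  let S : ∀ i, Set (ProbabilityMeasure (∀ t, (𝕏 i).Ω t)) := fun i => {⟨(𝕏 i).P, (𝕏 i).prob⟩}
  refine (isCompact_setOf_marginal_mem (S := S) fun i => isCompact_singleton).of_isClosed_subset
    ?_ fun π hπ i => Subtype.ext (hπ.1.2 i)
  have hset : multicausalCouplings 𝕏 = {π : ProbabilityMeasure (ProdSpace 𝕏) |
      IsStepwiseCoupling (Ω := fun i => (𝕏 i).Ω) κ (π : Measure (ProdSpace 𝕏))} := by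
    ext π
    exact ⟨isStepwiseCoupling_of_mem_multicausalCouplings fun i => (hκ i).toIsDisintegration,
      mem_multicausalCouplings_of_isStepwiseCoupling fun i => (hκ i).toIsDisintegration⟩
  rw [hset]
  unfold IsStepwiseCoupling
  simp only [Set.ofPred_forall]
  refine isClosed_iInter fun t => isClosed_iInter fun i => ?_
  have hmk' := isMarkovKernel_liftKernel hmk i t
  have hp : Continuous (prefixes (fun i => (𝕏 i).Ω) t.castSucc) :=
    continuous_pi fun j => (continuous_toPrefix _).comp (continuous_apply j)
  have hp' : Continuous fun ω : ProdSpace 𝕏 =>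
      (prefixes (fun i => (𝕏 i).Ω) t.castSucc ω, ω i t) := by
    exact hp.prodMk ((continuous_apply t).comp (continuous_apply i))
  have hproj : Continuous fun z : ∀ j, Prefix (𝕏 j).Ω t.castSucc => z i := continuous_apply i
  have hl := continuous_compProd (liftKernel κ i t) (((hκ i).continuous t).comp hproj)
  have h1 := ProbabilityMeasure.continuous_map hp'
  have h2 := hl.comp (ProbabilityMeasure.continuous_map hp)
  have := isClosed_eq h1 h2
  convert this using 1
  exact Set.ext fun π => ⟨fun h => Subtype.ext h, fun h => congrArg Subtype.val h⟩

/-- A Dini-type argument: the open sets of couplings whose $k$-th envelope cost exceeds $b$ increase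
with $k$ and cover the compact set of multicausal couplings, so one of them contains it. -/
theorem exists_lt_multicausalCost_lipschitzEnvelope {W : (Fin N → ∀ t, 𝒳 t) → ℝ≥0∞}
    (hW : LowerSemicontinuous W) {𝕏 : Fin N → FilteredProcess.{u} 𝒳} {a : ℝ≥0∞}
    (ha : a < multicausalCost W 𝕏) : ∃ k, a < multicausalCost (lipschitzEnvelope W k) 𝕏 := by
  obtain ⟨b, hab, hb⟩ := exists_between ha
  have hf : ∀ k, Continuous fun ω : ProdSpace 𝕏 =>
      lipschitzEnvelope W k (fun i => (𝕏 i).X (ω i)) := fun k =>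
    (continuous_lipschitzEnvelope W k).comp (continuous_values 𝕏)
  have hmono : Monotone fun (k : ℕ) (ω : ProdSpace 𝕏) =>
      lipschitzEnvelope W k (fun i => (𝕏 i).X (ω i)) := fun k l hkl ω =>
    monotone_lipschitzEnvelope W hkl _
  let U : ℕ → Set (ProbabilityMeasure (ProdSpace 𝕏)) := fun k =>
    {π | b < ∫⁻ ω, lipschitzEnvelope W k (fun i => (𝕏 i).X (ω i)) ∂(π : Measure (ProdSpace 𝕏))}
  have hUo : ∀ k, IsOpen (U k) := fun k =>
    isOpen_Ioi.preimage (continuous_lintegral_of_continuous_of_le (hf k)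
      fun _ => lipschitzEnvelope_le_natCast W k _)
  have hUm : Monotone U := fun k l hkl π hπ =>
    lt_of_lt_of_le hπ (lintegral_mono fun ω => hmono hkl ω)
  have hUc : multicausalCouplings 𝕏 ⊆ ⋃ k, U k := fun π hπ => by
    have h1 : b < ∫⁻ ω, W (fun i => (𝕏 i).X (ω i)) ∂(π : Measure (ProdSpace 𝕏)) :=
      hb.trans_le (iInf₂_le π hπ)
    simp_rw [← iSup_lipschitzEnvelope hW] at h1
    rw [lintegral_iSup (fun k => (hf k).measurable) hmono, lt_iSup_iff] at h1
    exact Set.mem_iUnion.2 h1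
  obtain ⟨k, hk⟩ := (isCompact_multicausalCouplings 𝕏).elim_directed_cover U hUo hUc
    hUm.directed_le
  exact ⟨k, hab.trans_le (le_iInf₂ fun π hπ => (hk hπ).le)⟩

variable [∀ t, SecondCountableTopology (𝒳 t)] [∀ t, BorelSpace (𝒳 t)]

theorem exists_forall_adaptedDist_lt_multicausalCost {W : (Fin N → ∀ t, 𝒳 t) → ℝ≥0∞}
    (hW : LowerSemicontinuous W) {𝕏 : Fin N → FilteredProcess.{u} 𝒳} {a : ℝ≥0∞}
    (ha : a < multicausalCost W 𝕏) :
    ∃ ε : ℝ≥0∞, 0 < ε ∧ ∀ 𝕐 : Fin N → FilteredProcess.{u} 𝒳,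
      (∀ i, adaptedDist (𝕏 i) (𝕐 i) < ε) → a < multicausalCost W 𝕐 := by
  obtain ⟨k, hk⟩ := exists_lt_multicausalCost_lipschitzEnvelope hW ha
  obtain ⟨δ, hδ, hlt⟩ := ENNReal.lt_iff_exists_add_pos_lt.1 hk
  -- The radius makes the gluing error $\varepsilon kN$ smaller than the gap $\delta$ between $a$
  -- and the envelope value.
  obtain ⟨ε, hε, hεlt⟩ := ENNReal.exists_nnreal_pos_mul_lt (a := (k : ℝ≥0∞) * N) (b := δ)
    (ENNReal.mul_ne_top (ENNReal.natCast_ne_top k) (ENNReal.natCast_ne_top N))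
    (by exact_mod_cast hδ.ne')
  refine ⟨ε, by exact_mod_cast hε, fun 𝕐 h𝕐 => ?_⟩
  by_contra! hle
  have h1 := multicausalCost_lipschitzEnvelope_le W k h𝕐
  exact absurd (h1.trans (add_le_add hle hεlt.le)) (not_le.2 hlt)

end Compact

/-! ### Symmetry and reflexivity of the adapted distance -/

section AdaptedDist

variable {T N : ℕ} {𝒳 : Fin T → Type v} [∀ t, MetricSpace (𝒳 t)] [∀ t, MeasurableSpace (𝒳 t)]

/-- On the diagonal an event of the second prefix coincides with the same event of the first, so its
indicator is its own conditional probability. -/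
theorem isCausal_diagonal (𝕏 : FilteredProcess.{u} 𝒳)
    [IsProbabilityMeasure (𝕏.P.map fun ω => (ω, ω))] :
    IsCausal 𝕏 𝕏 (𝕏.P.map fun ω => (ω, ω)) := by
  have hm : Measurable fun ω : ∀ t, 𝕏.Ω t => (ω, ω) := measurable_id.prodMk measurable_id
  intro t
  refine CondIndep.symm (condIndep_of_forall_exists_version (pairFiltration_le 𝕏 𝕏 _ _)
    (pairFiltration_le 𝕏 𝕏 _ _) (pairFiltration_le 𝕏 𝕏 _ _) ?_ fun A hA => ?_)
  · rw [pairFiltration_zero_right, pairFiltration_zero_right]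
    have h : Measurable fun p : Prefix 𝕏.Ω (Fin.last T) => toPrefix 𝕏.Ω t.succ p.toPath := by
      refine measurable_pi_lambda _ fun s => measurable_pi_apply _
    rintro _ ⟨C, hC, rfl⟩
    exact ⟨_, h hC, rfl⟩
  · rw [pairFiltration_zero_left] at hA
    obtain ⟨C, hC, rfl⟩ := hA
    have hC1 : MeasurableSet[pairFiltration 𝕏 𝕏 t.succ 0]
        ((fun q : (∀ t, 𝕏.Ω t) × (∀ t, 𝕏.Ω t) => toPrefix 𝕏.Ω t.succ q.1) ⁻¹' C) := by
      rw [pairFiltration_zero_right]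
      exact ⟨C, hC, rfl⟩
    refine ⟨Set.indicator ((fun q => toPrefix 𝕏.Ω t.succ q.1) ⁻¹' C) fun _ => 1,
      (@measurable_const _ _ _ (pairFiltration 𝕏 𝕏 t.succ 0) _).indicator hC1, fun D hD => ?_⟩
    have hD' := pairFiltration_le 𝕏 𝕏 _ _ D hD
    have hC1' := pairFiltration_le 𝕏 𝕏 _ _ _ hC1
    have hC2' : MeasurableSet
        ((fun q : (∀ t, 𝕏.Ω t) × (∀ t, 𝕏.Ω t) => toPrefix 𝕏.Ω t.succ q.2) ⁻¹' C) :=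
      ((measurable_toPrefix _).comp measurable_snd) hC
    rw [lintegral_indicator hC1', setLIntegral_one, Measure.restrict_apply hC1',
      Measure.map_apply hm (hC2'.inter hD'), Measure.map_apply hm (hC1'.inter hD')]
    rfl

theorem adaptedDist_self (𝕏 : FilteredProcess.{u} 𝒳) [∀ t, SecondCountableTopology (𝒳 t)]
    [∀ t, BorelSpace (𝒳 t)] : adaptedDist 𝕏 𝕏 = 0 := by
  have hm : Measurable fun ω : ∀ t, 𝕏.Ω t => (ω, ω) := measurable_id.prodMk measurable_id
  have hprob : IsProbabilityMeasure (𝕏.P.map fun ω => (ω, ω)) :=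
    Measure.isProbabilityMeasure_map hm.aemeasurable
  have hfst : (𝕏.P.map fun ω => (ω, ω)).map Prod.fst = 𝕏.P := by
    rw [Measure.map_map measurable_fst hm]
    exact Measure.map_id
  have hsnd : (𝕏.P.map fun ω => (ω, ω)).map Prod.snd = 𝕏.P := by
    rw [Measure.map_map measurable_snd hm]
    exact Measure.map_id
  have hswap : (𝕏.P.map fun ω => (ω, ω)).map Prod.swap = 𝕏.P.map fun ω => (ω, ω) := by
    rw [Measure.map_map measurable_swap hm]
    rfl
  refine le_antisymm (iInf₂_le_of_le ⟨_, hprob⟩ ⟨hfst, hsnd, isCausal_diagonal 𝕏, ?_⟩ ?_) zero_le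
  · simp only [ProbabilityMeasure.coe_mk, hswap]
    exact isCausal_diagonal 𝕏
  · simp only [ProbabilityMeasure.coe_mk]
    rw [lintegral_map (measurable_ofReal_truncDist 𝕏 𝕏) hm]
    simp [truncDist_self]

theorem swap_mem_bicausalCouplings {𝕏 𝕐 : FilteredProcess.{u} 𝒳}
    {γ : ProbabilityMeasure ((∀ t, 𝕏.Ω t) × (∀ t, 𝕐.Ω t))} (hγ : γ ∈ bicausalCouplings 𝕏 𝕐) :
    γ.map measurable_swap.aemeasurable ∈ bicausalCouplings 𝕐 𝕏 := by
  obtain ⟨h1, h2, h3, h4⟩ := hγ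
  have hss : (γ.toMeasure.map Prod.swap).map Prod.swap = γ.toMeasure := by
    rw [Measure.map_map measurable_swap measurable_swap]
    simp
  refine ⟨?_, ?_, h4, ?_⟩
  · rw [ProbabilityMeasure.toMeasure_map, Measure.map_map measurable_fst measurable_swap]
    exact h2
  · rw [ProbabilityMeasure.toMeasure_map, Measure.map_map measurable_snd measurable_swap]
    exact h1
  · simp only [ProbabilityMeasure.toMeasure_map, hss]
    exact h3

variable [∀ t, SecondCountableTopology (𝒳 t)] [∀ t, BorelSpace (𝒳 t)]

theorem adaptedDist_comm_le (𝕏 𝕐 : FilteredProcess.{u} 𝒳) :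
    adaptedDist 𝕐 𝕏 ≤ adaptedDist 𝕏 𝕐 := by
  refine le_iInf₂ fun γ hγ => iInf₂_le_of_le _ (swap_mem_bicausalCouplings hγ) ?_
  rw [ProbabilityMeasure.toMeasure_map,
    lintegral_map (measurable_ofReal_truncDist 𝕐 𝕏) measurable_swap]
  simp [truncDist_comm]

theorem multicausalCost_eq_of_adaptedDist_eq_zero {W : (Fin N → ∀ t, 𝒳 t) → ℝ≥0∞}
    (hW : LowerSemicontinuous W) {𝕏 𝕐 : Fin N → FilteredProcess.{u} 𝒳}
    (h : ∀ i, adaptedDist (𝕏 i) (𝕐 i) = 0) : multicausalCost W 𝕏 = multicausalCost W 𝕐 := by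
  have key : ∀ {𝕏 𝕐 : Fin N → FilteredProcess.{u} 𝒳}, (∀ i, adaptedDist (𝕏 i) (𝕐 i) = 0) →
      multicausalCost W 𝕏 ≤ multicausalCost W 𝕐 := by
    intro 𝕏 𝕐 h
    refine le_of_forall_lt fun a ha => ?_
    obtain ⟨ε, hε, hlt⟩ := exists_forall_adaptedDist_lt_multicausalCost hW ha
    exact hlt 𝕐 fun i => (h i).trans_lt hε
  exact le_antisymm (key h) (key fun i =>
    le_antisymm ((adaptedDist_comm_le (𝕏 i) (𝕐 i)).trans_eq (h i)) zero_le)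

/-- The multicausal cost only depends on the classes of the processes in `FP`. -/
theorem multicausalCost_eq_of_mk_eq {W : (Fin N → ∀ t, 𝒳 t) → ℝ≥0∞}
    (hW : LowerSemicontinuous W) {𝕏 𝕐 : Fin N → FilteredProcess.{u} 𝒳}
    (h : ∀ i, FP.mk (𝕏 i) = FP.mk (𝕐 i)) : multicausalCost W 𝕏 = multicausalCost W 𝕐 := by
  classical
  -- Equality in the quotient means the generated equivalence relation, so the processes are
  -- exchanged one coordinate at a time by induction along a chain. Reflexivity of the distance
  -- handles the untouched coordinates.
  have hupd : ∀ (ℍ : Fin N → FilteredProcess.{u} 𝒳) (i : Fin N) {A B : FilteredProcess.{u} 𝒳},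
      Relation.EqvGen (fun 𝕏 𝕐 : FilteredProcess.{u} 𝒳 => adaptedDist 𝕏 𝕐 = 0) A B →
      multicausalCost W (Function.update ℍ i A) = multicausalCost W (Function.update ℍ i B) := by
    intro ℍ i A B hAB
    induction hAB with
    | rel A B hAB =>
      refine multicausalCost_eq_of_adaptedDist_eq_zero hW fun j => ?_
      by_cases hj : j = i
      · subst hj
        simpa using hAB
      · simpa [hj] using adaptedDist_self (ℍ j)
    | refl A => rfl
    | symm A B _ ih => exact ih.symm
    | trans A B C _ _ ih1 ih2 => exact ih1.trans ih2
  have hs : ∀ s : Finset (Fin N), multicausalCost W (s.piecewise 𝕏 𝕐) = multicausalCost W 𝕐 := by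
    intro s
    induction s using Finset.induction_on with
    | empty => simp
    | insert j s hj ih =>
      rw [Finset.piecewise_insert, hupd _ j (Quot.eqvGen_exact (h j)), ← ih]
      congr 1
      rw [Function.update_eq_self_iff, Finset.piecewise_eq_of_notMem _ _ _ hj]
  simpa using hs Finset.univ

end AdaptedDist

/-! ### Costs bounded from below -/

section Shift

open scoped NNReal

/-- The map `a ↦ a - M` from `[0, ∞]` to the extended reals. -/
def shift (M : ℝ≥0) (a : ℝ≥0∞) : EReal := (a : EReal) + ((-M : ℝ) : EReal)

variable (M : ℝ≥0)

theorem strictMono_shift : StrictMono (shift M) := fun a b hab => by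
  unfold shift
  exact EReal.add_lt_add_right_coe (EReal.coe_ennreal_lt_coe_ennreal_iff.2 hab) _

theorem continuous_shift : Continuous (shift M) := by
  refine continuous_iff_continuousAt.2 fun a => ?_
  have h := (EReal.continuousAt_add (p := ((a : EReal), ((-M : ℝ) : EReal))) (.inr (by simp))
    (.inr (by simp)))
  exact ContinuousAt.comp (f := fun a : ℝ≥0∞ => ((a : EReal), ((-M : ℝ) : EReal))) h
    (continuous_coe_ennreal_ereal.prodMk continuous_const).continuousAt

theorem shift_top : shift M ∞ = ⊤ := by
  simp [shift]

theorem shift_ne_bot (a : ℝ≥0∞) : shift M a ≠ ⊥ := by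
  simp [shift, EReal.add_eq_bot_iff]

theorem shift_ofReal {r : ℝ} (h : -M ≤ r) : shift M (ENNReal.ofReal (r + M)) = r := by
  rw [shift, EReal.coe_ennreal_ofReal, max_eq_left (by linarith), ← EReal.coe_add]
  simp

/-- The shift is monotone and continuous; its value $\top$ at $\infty$ takes care of empty infima.
-/
theorem shift_biInf {ι : Type*} (S : Set ι) (f : ι → ℝ≥0∞) :
    shift M (⨅ i ∈ S, f i) = ⨅ i ∈ S, shift M (f i) := by
  rw [(strictMono_shift M).monotone.map_iInf_of_continuousAt (continuous_shift M).continuousAt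
    (shift_top M)]
  exact iInf_congr fun i => (strictMono_shift M).monotone.map_iInf_of_continuousAt
    (continuous_shift M).continuousAt (shift_top M)

theorem coe_sub_coe_eq_shift {a b m : ℝ≥0∞} (h : b + m = M) :
    (a : EReal) - (b : EReal) = shift M (a + m) := by
  have hb : b ≠ ∞ := fun hb => by simp [hb] at h
  have hm : m ≠ ∞ := fun hm => by simp [hm] at h
  lift b to ℝ≥0 using hb
  lift m to ℝ≥0 using hm
  have hM : M = b + m := by exact_mod_cast h.symm
  subst hM
  induction a with
  | top => rw [top_add, shift_top]; rfl
  | coe a =>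
    rw [shift, ← ENNReal.coe_add]
    simp only [EReal.coe_nnreal_eq_coe_real]
    rw [← EReal.coe_sub, ← EReal.coe_add]
    congr 1
    push_cast
    ring

theorem toENNReal_shift (a : ℝ≥0∞) : (shift M a).toENNReal = a - M := by
  induction a with
  | top => simp [shift_top]
  | coe a =>
    rw [shift, EReal.coe_nnreal_eq_coe_real, ← EReal.coe_add, EReal.toENNReal_of_ne_top (EReal.coe_ne_top _),
      EReal.toReal_coe, ← ENNReal.coe_sub]
    rw [ENNReal.ofReal, ENNReal.coe_inj, NNReal.sub_def]
    rfl

theorem toENNReal_neg_shift (a : ℝ≥0∞) : (-shift M a).toENNReal = M - a := by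
  induction a with
  | top => simp [shift_top]
  | coe a =>
    rw [shift, EReal.coe_nnreal_eq_coe_real, ← EReal.coe_add, ← EReal.coe_neg,
      EReal.toENNReal_of_ne_top (EReal.coe_ne_top _), EReal.toReal_coe, ← ENNReal.coe_sub]
    rw [ENNReal.ofReal, ENNReal.coe_inj, NNReal.sub_def]
    congr 1
    ring

/-- The positive and negative parts of $g-M$ are the truncated differences $g-M$ and $M-g$. Adding
$\min(g,M)$ turns them into $g$ and $M$, so no integrability of $g$ is needed. -/
theorem extIntegral_shift {α : Type*} [MeasurableSpace α] (ρ : Measure α) [IsProbabilityMeasure ρ]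
    {g : α → ℝ≥0∞} (hg : Measurable g) :
    extIntegral ρ (fun x => shift M (g x)) = shift M (∫⁻ x, g x ∂ρ) := by
  have hmin : Measurable fun x => min (g x) M := hg.min measurable_const
  have h1 : ∫⁻ x, g x ∂ρ = ∫⁻ x, (g x - M) ∂ρ + ∫⁻ x, min (g x) M ∂ρ := by
    rw [← lintegral_add_right _ hmin]
    exact lintegral_congr fun x => (tsub_add_min).symm
  have h2 : ∫⁻ x, (M - g x) ∂ρ + ∫⁻ x, min (g x) M ∂ρ = M := by
    rw [← lintegral_add_right _ hmin]
    simp_rw [min_comm (g _) (M : ℝ≥0∞), tsub_add_min]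
    simp
  simp only [extIntegral, toENNReal_shift, toENNReal_neg_shift]
  rw [coe_sub_coe_eq_shift M h2, h1]

end Shift

/-! ### Transfer to real costs and to the quotient space -/

section Main

open scoped NNReal

variable {T N : ℕ} {𝒳 : Fin T → Type v} [∀ t, MetricSpace (𝒳 t)]

/-- The nonnegative extended cost `c + M`. -/
def shiftedCost (c : (Fin N → ∀ t, 𝒳 t) → ℝ) (M : ℝ≥0) (x : Fin N → ∀ t, 𝒳 t) : ℝ≥0∞ :=
  ENNReal.ofReal (c x + M)

variable {c : (Fin N → ∀ t, 𝒳 t) → ℝ} {M : ℝ≥0}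

theorem lowerSemicontinuous_shiftedCost (hc : LowerSemicontinuous c) :
    LowerSemicontinuous (shiftedCost c M) := by
  have h1 : Continuous fun r : ℝ => ENNReal.ofReal (r + M) :=
    ENNReal.continuous_ofReal.comp (continuous_id.add continuous_const)
  have h2 : Monotone fun r : ℝ => ENNReal.ofReal (r + M) := fun a b hab =>
    ENNReal.ofReal_le_ofReal (by linarith)
  exact h1.comp_lowerSemicontinuous hc h2

variable [∀ t, MeasurableSpace (𝒳 t)]

theorem lowerSemicontinuous_shiftedCost_values (hc : LowerSemicontinuous c)
    (𝕏 : Fin N → FilteredProcess.{u} 𝒳) :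
    LowerSemicontinuous fun ω : ProdSpace 𝕏 => shiftedCost c M fun i => (𝕏 i).X (ω i) :=
  LowerSemicontinuous.comp (f := shiftedCost c M) (lowerSemicontinuous_shiftedCost hc)
    (continuous_values 𝕏)

theorem expectedCost_eq_shift (hc : LowerSemicontinuous c) (hM : ∀ x, -M ≤ c x)
    (𝕏 : Fin N → FilteredProcess.{u} 𝒳) (π : ProbabilityMeasure (ProdSpace 𝕏)) :
    expectedCost c 𝕏 π = shift M (∫⁻ ω, shiftedCost c M (fun i => (𝕏 i).X (ω i)) ∂π.toMeasure) := by
  rw [← extIntegral_shift M _ (lowerSemicontinuous_shiftedCost_values hc 𝕏).measurable]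
  simp only [shiftedCost, shift_ofReal M (hM _)]
  rfl

theorem multicausalValue_eq_shift (hc : LowerSemicontinuous c) (hM : ∀ x, -M ≤ c x)
    (𝕏 : Fin N → FilteredProcess.{u} 𝒳) :
    multicausalValue c 𝕏 = shift M (multicausalCost (shiftedCost c M) 𝕏) := by
  rw [multicausalCost, shift_biInf]
  simp only [multicausalValue, expectedCost_eq_shift hc hM]

variable {𝕏 : Fin N → FilteredProcess.{u} 𝒳}
  {κ : ∀ i, ∀ t : Fin T, Kernel (Prefix (𝕏 i).Ω t.castSucc) ((𝕏 i).Ω t)}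

/-- The cost to go of the shifted cost along the processes. -/
abbrev shiftedCostToGo (c : (Fin N → ∀ t, 𝒳 t) → ℝ) (M : ℝ≥0)
    (𝕏 : Fin N → FilteredProcess.{u} 𝒳)
    (κ : ∀ i, ∀ t : Fin T, Kernel (Prefix (𝕏 i).Ω t.castSucc) ((𝕏 i).Ω t)) (t : Fin (T + 1)) :
    Prefix (ProdSpaceAt 𝕏) t → ℝ≥0∞ :=
  costToGo (Ω := fun i => (𝕏 i).Ω) (fun ω => shiftedCost c M fun i => (𝕏 i).X (ω i)) κ t

theorem stepCost_shift (hκ : ∀ i, IsContinuousDisintegration (𝕏 i).P (κ i))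
    (hc : LowerSemicontinuous c) (t : Fin T) (p : Prefix (ProdSpaceAt 𝕏) t.castSucc)
    {ρ : Measure (ProdSpaceAt 𝕏 t)} (hρ : ρ ∈ stepCouplings 𝕏 κ t p) :
    stepCost 𝕏 t (fun q => shift M (shiftedCostToGo c M 𝕏 κ t.succ q)) p ρ =
      shift M (∫⁻ y, shiftedCostToGo c M 𝕏 κ t.succ (p.append y) ∂ρ) := by
  have := hρ.1
  have hm : Measurable fun y : ProdSpaceAt 𝕏 t => shiftedCostToGo c M 𝕏 κ t.succ (p.append y) :=
    (LowerSemicontinuous.comp (lowerSemicontinuous_costToGo (Ω := fun i => (𝕏 i).Ω) hκ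
      (lowerSemicontinuous_shiftedCost_values hc 𝕏) t.succ)
      (Prefix.continuous_append.comp (continuous_const.prodMk continuous_id))).measurable
  exact extIntegral_shift M ρ hm

theorem valueProcess_eq_shift (hκ : ∀ i, IsContinuousDisintegration (𝕏 i).P (κ i))
    (hc : LowerSemicontinuous c) (hM : ∀ x, -M ≤ c x) (t : Fin (T + 1)) :
    valueProcess c 𝕏 κ t = fun p => shift M (shiftedCostToGo c M 𝕏 κ t p) := by
  induction t using Fin.reverseInduction with
  | last =>
    funext p
    rw [shiftedCostToGo, costToGo_last, valueProcess, Fin.reverseInduction_last]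
    exact (shift_ofReal M (hM _)).symm
  | cast t ih =>
    funext p
    have h1 : valueProcess c 𝕏 κ t.castSucc p = ⨅ ρ ∈ stepCouplings 𝕏 κ t p,
        stepCost 𝕏 t (valueProcess c 𝕏 κ t.succ) p ρ := by
      rw [valueProcess, Fin.reverseInduction_castSucc]
      rfl
    have h2 : shiftedCostToGo c M 𝕏 κ t.castSucc p = ⨅ ρ ∈ stepCouplings 𝕏 κ t p,
        ∫⁻ y, shiftedCostToGo c M 𝕏 κ t.succ (p.append y) ∂ρ := by
      rw [shiftedCostToGo, costToGo_castSucc]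
      rfl
    rw [h1, h2, shift_biInf, ih]
    exact iInf_congr fun ρ => iInf_congr fun hρ => stepCost_shift hκ hc t p hρ

theorem isMinOn_stepCost_iff (hκ : ∀ i, IsContinuousDisintegration (𝕏 i).P (κ i))
    (hc : LowerSemicontinuous c) (hM : ∀ x, -M ≤ c x) {t : Fin T}
    {p : Prefix (ProdSpaceAt 𝕏) t.castSucc} {ρ : Measure (ProdSpaceAt 𝕏 t)}
    (hρ : ρ ∈ stepCouplings 𝕏 κ t p) :
    IsMinOn (stepCost 𝕏 t (valueProcess c 𝕏 κ t.succ) p) (stepCouplings 𝕏 κ t p) ρ ↔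
      ∫⁻ y, shiftedCostToGo c M 𝕏 κ t.succ (p.append y) ∂ρ =
        shiftedCostToGo c M 𝕏 κ t.castSucc p := by
  have h2 : shiftedCostToGo c M 𝕏 κ t.castSucc p = ⨅ ρ ∈ stepCouplings 𝕏 κ t p,
      ∫⁻ y, shiftedCostToGo c M 𝕏 κ t.succ (p.append y) ∂ρ := by
    rw [shiftedCostToGo, costToGo_castSucc]
    rfl
  rw [valueProcess_eq_shift hκ hc hM, isMinOn_iff, h2]
  constructor
  · intro h
    refine le_antisymm (le_iInf₂ fun ρ' hρ' => ?_) (iInf₂_le ρ hρ)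
    have := h ρ' hρ'
    rwa [stepCost_shift hκ hc t p hρ, stepCost_shift hκ hc t p hρ',
      (strictMono_shift M).le_iff_le] at this
  · intro h ρ' hρ'
    rw [stepCost_shift hκ hc t p hρ, stepCost_shift hκ hc t p hρ',
      (strictMono_shift M).le_iff_le, h]
    exact iInf₂_le ρ' hρ'

theorem exists_multicausalCoupling_lintegral_eq
    (hκ : ∀ i, IsContinuousDisintegration (𝕏 i).P (κ i)) (hc : LowerSemicontinuous c) :
    ∃ π ∈ multicausalCouplings 𝕏, ∫⁻ ω, shiftedCost c M (fun i => (𝕏 i).X (ω i)) ∂π.toMeasure =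
      shiftedCostToGo c M 𝕏 κ 0 fun s => s.elim0 := by
  obtain ⟨π, hπ, hstep, heq⟩ := exists_optimal_coupling (Ω := fun i => (𝕏 i).Ω) hκ
    (lowerSemicontinuous_shiftedCost_values (M := M) hc 𝕏)
  exact ⟨⟨π, hπ⟩, mem_multicausalCouplings_of_isStepwiseCoupling
    (fun i => (hκ i).toIsDisintegration) hstep, heq⟩

theorem multicausalCost_shiftedCost (hκ : ∀ i, IsContinuousDisintegration (𝕏 i).P (κ i))
    (hc : LowerSemicontinuous c) : multicausalCost (shiftedCost c M) 𝕏 =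
      shiftedCostToGo c M 𝕏 κ 0 fun s => s.elim0 := by
  refine le_antisymm ?_ (le_iInf₂ fun π hπ => ?_)
  · obtain ⟨π, hπ, heq⟩ := exists_multicausalCoupling_lintegral_eq (M := M) hκ hc
    exact heq ▸ iInf₂_le π hπ
  · exact costToGo_zero_le (Ω := fun i => (𝕏 i).Ω) hκ
      (lowerSemicontinuous_shiftedCost_values hc 𝕏)
      (isStepwiseCoupling_of_mem_multicausalCouplings (fun i => (hκ i).toIsDisintegration) hπ)

theorem hasStepwiseOptimalKernels_iff (hκ : ∀ i, IsContinuousDisintegration (𝕏 i).P (κ i))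
    (hc : LowerSemicontinuous c) (hM : ∀ x, -M ≤ c x) (π : ProbabilityMeasure (ProdSpace 𝕏)) :
    HasStepwiseOptimalKernels c 𝕏 κ π ↔
      ∃ K : ∀ t : Fin T, Kernel (Prefix (ProdSpaceAt 𝕏) t.castSucc) (ProdSpaceAt 𝕏 t),
        IsDisintegration (Ω := ProdSpaceAt 𝕏) (π.toMeasure.map fun ω t i => ω i t) K ∧
        (∀ t p, K t p ∈ stepCouplings 𝕏 κ t p) ∧
        ∀ t p, ∫⁻ y, shiftedCostToGo c M 𝕏 κ t.succ (p.append y) ∂(K t p) =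
          shiftedCostToGo c M 𝕏 κ t.castSucc p := by
  constructor
  · rintro ⟨K, hK, h⟩
    exact ⟨K, hK, fun t p => (h t p).1,
      fun t p => (isMinOn_stepCost_iff hκ hc hM (h t p).1).1 (h t p).2⟩
  · rintro ⟨K, hK, h1, h2⟩
    exact ⟨K, hK, fun t p => ⟨h1 t p, (isMinOn_stepCost_iff hκ hc hM (h1 t p)).2 (h2 t p)⟩⟩

variable [∀ t, SecondCountableTopology (𝒳 t)] [∀ t, BorelSpace (𝒳 t)]

theorem lowerSemicontinuous_multicausalCost_out {W : (Fin N → ∀ t, 𝒳 t) → ℝ≥0∞}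
    (hW : LowerSemicontinuous W) : LowerSemicontinuous fun x : Fin N → FP.{u} 𝒳 =>
      multicausalCost W fun i => (Quot.out (x i) : FilteredProcess.{u} 𝒳) := by
  intro x a ha
  obtain ⟨ε, hε, hlt⟩ := exists_forall_adaptedDist_lt_multicausalCost hW ha
  let B : Fin N → Set (FP.{u} 𝒳) := fun i => FP.mk '' {𝕐 | adaptedDist (Quot.out (x i)) 𝕐 < ε}
  have hB : ∀ i, B i ∈ 𝓝 (x i) := fun i => by
    refine IsOpen.mem_nhds (TopologicalSpace.isOpen_generateFrom_of_mem ⟨_, ε, hε, rfl⟩) ?_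
    exact ⟨Quot.out (x i), (adaptedDist_self _).trans_lt hε, Quot.out_eq (x i)⟩
  filter_upwards [set_pi_mem_nhds Set.finite_univ fun i _ => hB i] with y hy
  choose 𝕐 h𝕐 hmk using fun i => hy i (Set.mem_univ i)
  -- Membership in the image of a ball provides some representative within distance $\varepsilon$,
  -- not necessarily the chosen one; invariance on classes allows the change.
  have heq : multicausalCost W (fun i => (Quot.out (y i) : FilteredProcess.{u} 𝒳)) =
      multicausalCost W 𝕐 :=
    multicausalCost_eq_of_mk_eq hW fun i => (Quot.out_eq (y i)).trans (hmk i).symm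
  rw [heq]
  exact hlt 𝕐 h𝕐

end Main

end

end MultiCausal

/-! ### The main theorem -/

theorem mainTheorem2 {T N : ℕ} (𝒳 : Fin T → Type v) [∀ t, MetricSpace (𝒳 t)]
    [∀ t, CompleteSpace (𝒳 t)] [∀ t, TopologicalSpace.SeparableSpace (𝒳 t)]
    [∀ t, MeasurableSpace (𝒳 t)] [∀ t, BorelSpace (𝒳 t)]
    (c : (Fin N → ∀ t, 𝒳 t) → ℝ) (hc : LowerSemicontinuous c) (hcb : BddBelow (Set.range c)) :
    (∀ 𝕏 : Fin N → MultiCausal.FilteredProcess.{u} 𝒳,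
      (∀ κ : ∀ i, ∀ t : Fin T,
          Kernel (MultiCausal.Prefix (𝕏 i).Ω t.castSucc) ((𝕏 i).Ω t),
        (∀ i, MultiCausal.IsContinuousDisintegration (𝕏 i).P (κ i)) →
        MultiCausal.multicausalValue c 𝕏 = MultiCausal.initialValue c 𝕏 κ ∧
        ∀ π ∈ MultiCausal.multicausalCouplings 𝕏,
          (MultiCausal.HasStepwiseOptimalKernels c 𝕏 κ π →
            MultiCausal.expectedCost c 𝕏 π = MultiCausal.multicausalValue c 𝕏) ∧
          (MultiCausal.multicausalValue c 𝕏 < ⊤ →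
            MultiCausal.expectedCost c 𝕏 π = MultiCausal.multicausalValue c 𝕏 →
            MultiCausal.HasStepwiseOptimalKernels c 𝕏 κ π)) ∧
      ∃ π ∈ MultiCausal.multicausalCouplings 𝕏,
        MultiCausal.expectedCost c 𝕏 π = MultiCausal.multicausalValue c 𝕏) ∧
    ∃ V : (Fin N → MultiCausal.FP.{u} 𝒳) → EReal,
      (∀ 𝕏 : Fin N → MultiCausal.FilteredProcess.{u} 𝒳,
        V (fun i => MultiCausal.FP.mk (𝕏 i)) = MultiCausal.multicausalValue c 𝕏) ∧
      (∀ x, V x ≠ ⊥) ∧ LowerSemicontinuous V := by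
  open MultiCausal in
  have hsc : ∀ t, SecondCountableTopology (𝒳 t) := fun t =>
    UniformSpace.secondCountable_of_separable (𝒳 t)
  obtain ⟨b, hb⟩ := hcb
  -- Only $c+M\ge 0$ matters, so a positive lower bound may be replaced by zero.
  let M : NNReal := (-b).toNNReal
  have hM : ∀ x, -M ≤ c x := fun x => by
    have h1 : b ≤ c x := hb ⟨x, rfl⟩
    have h2 : -b ≤ M := Real.le_coe_toNNReal (-b)
    linarith
  have hW := lowerSemicontinuous_shiftedCost (M := M) hc
  refine ⟨fun 𝕏 => ⟨fun κ hκ => ⟨?_, fun π hπ => ⟨fun h => ?_, fun hfin hopt => ?_⟩⟩, ?_⟩, ?_⟩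
  · rw [multicausalValue_eq_shift hc hM, initialValue, valueProcess_eq_shift hκ hc hM,
      multicausalCost_shiftedCost hκ hc]
  · rw [expectedCost_eq_shift hc hM, multicausalValue_eq_shift hc hM,
      multicausalCost_shiftedCost hκ hc]
    obtain ⟨K, hK, -, hmin⟩ := (hasStepwiseOptimalKernels_iff hκ hc hM π).1 h
    exact congrArg (shift M) (lintegral_eq_costToGo_zero (Ω := fun i => (𝕏 i).Ω) hκ
      (lowerSemicontinuous_shiftedCost_values hc 𝕏) hK hmin)
  · rw [← hopt, expectedCost_eq_shift hc hM, ← shift_top M, (strictMono_shift M).lt_iff_lt] at hfin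
    rw [expectedCost_eq_shift hc hM, multicausalValue_eq_shift hc hM,
      multicausalCost_shiftedCost hκ hc] at hopt
    exact (hasStepwiseOptimalKernels_iff hκ hc hM π).2
      (exists_optimal_disintegration (Ω := fun i => (𝕏 i).Ω) hκ
        (lowerSemicontinuous_shiftedCost_values hc 𝕏)
        (isStepwiseCoupling_of_mem_multicausalCouplings (fun i => (hκ i).toIsDisintegration) hπ)
        ((strictMono_shift M).injective hopt) hfin.ne)
  · choose κ hκ using fun i => (𝕏 i).exists_kernels
    obtain ⟨π, hπ, heq⟩ := exists_multicausalCoupling_lintegral_eq (M := M) hκ hc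
    exact ⟨π, hπ, by rw [expectedCost_eq_shift hc hM, heq, multicausalValue_eq_shift hc hM,
      multicausalCost_shiftedCost hκ hc]⟩
  · refine ⟨fun x => shift M (multicausalCost (shiftedCost c M) fun i => Quot.out (x i)),
      fun 𝕏 => ?_, fun x => shift_ne_bot M _,
      (continuous_shift M).comp_lowerSemicontinuous (lowerSemicontinuous_multicausalCost_out hW)
        (strictMono_shift M).monotone⟩
    rw [multicausalValue_eq_shift hc hM]
    exact congrArg (shift M) (multicausalCost_eq_of_mk_eq hW fun i => Quot.out_eq (FP.mk (𝕏 i)))
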